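/- **Setting.** Let $k$ be an algebraically closed field and $\Lambda$ a finite-dimensional $k$-algebra. A *homological system* $({\cal P},\le,\{\Delta_i\}_{i\in{\cal P}})$ for $\Lambda$ consists of a finite non-empty preordered set ${\cal P}$ and pairwise non-isomorphic indecomposable finite-dimensional $\Lambda$-modules $\Delta_i$ such that $\mathrm{Hom}_\Lambda(\Delta_i,\Delta_j)\ne 0$ implies $i\le j$, and $\mathrm{Ext}^1_\Lambda(\Delta_i,\Delta_j)\neq 0$ implies $i\le j$ and $j\not\le i$. It is *admissible* if $\Lambda$ has a finite filtration by submodules with all factors isomorphic to modules $\Delta_i$, and the number of isomorphism classes of indecomposable projective $\Lambda$-modules is $|{\cal P}|$. Fix an admissible homological system and put $\Delta=\bigoplus_i\Delta_i$. Then $\mathrm{End}_\Lambda(\Delta)=S\oplus J$, where $J$ is the Jacobson radical and $S=\bigoplus_{i} ke_i$ is spanned by the idempotents $e_i$ projecting onto the $\Delta_i$. Let $A=\bigoplus_{n\ge 0}A_n$, with $A_n=\mathrm{Ext}^n_\Lambda(\Delta,\Delta)$, be the Yoneda algebra, a graded $S$-$S$-bimodule. Assume that $A$ carries a *strict $A_\infty$-structure*: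 homogeneous morphisms of $S$-$S$-bimodules $m_n:A^{\otimes_S n}\to A$ $(n\ge1)$ of degree $2-n$ satisfying, for all $n\geq 1$, with Koszul signs, $$\sum_{r+s+t=n,\ s\ge1}(-1)^{r+st}m_{r+1+t}(\mathrm{id}^{\otimes r}\otimes m_s\otimes \mathrm{id}^{\otimes t})=0,$$ with $m_1=0$, $m_2$ the product of $A$, and, for $n\ge 3$, $m_n(z_1\otimes\cdots\otimes z_n)=0$ whenever some $z_u$ belongs to $\{e_i\mid i\in{\cal P}\}$. **Construction of $({\cal A}(\Delta),I)$.** Let $B=A[1]$ be the bar construction: $B_j=A_{j+1}$, with operations $b_n:B^{\otimes n}\to B$ of degree $1$ given by $b_n\sigma^{\otimes n}=\sigma m_n$, where $\sigma:A\to B$ is the identity viewed as a map of degree $-1$ (Koszul signs). For an $S$-$S$-bimodule $U$ let $\hat D(U)$ be the space $\mathrm{Hom}_S(U,S)$ of left $S$-linear maps with the bimodule structure $(s*\varphi*s')(u)=s\,\varphi(us')$; for graded $U$, $\hat D(U)_n=\hat D(U_{-n})$. For $U$ of finite dimension and a basis of $U$ of directed elements $x\in e_jUe_i$, the dual element $x^*\in\hat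 D(U)$ satisfies $x^*(x)=e_j$ and vanishes on the other basis elements. Let $\hat d(b_n):\hat D(B)\to \hat D(B)^{\otimes_S n}$ be the dual of $b_n$ followed by the inverse of the canonical isomorphism $\hat D(B)^{\otimes n}\cong\hat D(B^{\otimes n})$, $(\alpha_1\otimes\cdots\otimes\alpha_n)(a_1\otimes\cdots\otimes a_n)=\alpha_1(a_1\alpha_2(a_2\cdots\alpha_n(a_n))\cdots)$; explicitly, on $\varphi \in \hat D(B)$, $$\hat d(b_n)(\varphi)=\sum_{x_1,\dots,x_n}\varphi\big(b_n(x_1\otimes\cdots\otimes x_n)\big)*x_1^*\otimes\cdots\otimes x_n^*,$$ over tuples of elements of a directed basis of $B$ containing the $e_i$ and a basis of $J$. Identify $\hat D(J)$ with the elements of $\hat D(B)_1=\hat D(\mathrm{End}_\Lambda(\Delta))$ vanishing on $S$. Put $$A(\Delta)=T_S(\hat D(B)_0)\ \subseteq\ T(\Delta)=T_S(\hat D(B)_0\oplus\hat D(J)),$$ graded with $S$ and $\hat D(B)_0$ in degree $0$ and $\hat D(J)$ in degree $1$. Let $\delta:T(\Delta)\to T(\Delta)$ be the $k$-linear map with $\delta(S)=0$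 and $\delta(ab)=\delta(a)b+(-1)^{|a|}a\,\delta(b)$ for homogeneous $a$, and whose value on a generator $w\in\hat D(B)_0\oplus \hat D(J)$ is the component of $\sum_{n\ge2}\hat d(b_n)(w)$ in $T_S(\hat D(B)_0\oplus\hat D(J))$, i.e. the (finite) sum above restricted to basis elements $x_1,\dots,x_n$ of $B_0\oplus J$. Let $\beta:\hat D(B)_{-1}\to A(\Delta)$ send $\zeta$ to the component of $\sum_{n\ge2}\hat d(b_n)(\zeta)$ in $T_S(\hat D(B)_0)$, i.e. the (finite) sum restricted to basis elements of $B_0$, and let $I$ be the ideal of $A(\Delta)$ generated by $\mathrm{Im}\,\beta$. Put ${\cal A}(\Delta)=(T(\Delta),\delta)$. **Definitions.** A *weak ditalgebra* is a pair $(T,\delta)$ where $T$ is a graded tensor $k$-algebra (i.e. $T=\bigoplus_{n\geq 0}T_n$ is graded and is the tensor algebra of the $T_0$-bimodule $T_1$) and $\delta:T\to T$ is $k$-linear, homogeneous of degree $1$, and satisfies $\delta(ab)=\delta(a)b+(-1)^{|a|}a\delta(b)$ for homogeneous $a$. Write $A=T_0$ and $V=T_1$. A *layer* is a pair $(R,W)$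 with $R\subseteq T_0$ a subalgebra and $W=W_0\oplus W_1$ a direct sum of $R$-$R$-subbimodules $W_0\subseteq T_0$, $W_1\subseteq T_1$, such that $T$ is freely generated by $(R,W)$ (it is the tensor algebra $T_R(W)$) and $\delta(R)=0$. It is *triangular* if there are finite filtrations by $R$-$R$-subbimodules $0=W_0^0\subseteq\cdots\subseteq W_0^r=W_0$ with $\delta(W_0^{i+1})\subseteq A_iW_1A_i$ for $0\le i<r$, where $A_i$ is the $R$-subalgebra of $A$ generated by $W_0^i$, and $0=W_1^0\subseteq\cdots\subseteq W_1^s=W_1$ with $\delta(W_1^{i+1})\subseteq AW_1^iAW_1^iA$ for $0\le i<s$. For an ideal $I$ of $A$, $(T,\delta)$ is *interlaced with $I$* if $\delta(I)\subseteq IV+VI$, $\delta^2(A)\subseteq IV^2+VIV+V^2I$ and $\delta^2(V)\subseteq IV^3+VIV^2+V^2IV+V^3I$. The ideal $I$ is *triangular* with respect to $(T,\delta)$ if there are $k$-subspaces $0=H_0\subseteq H_1\subseteq\cdots\subseteq H_t=I$ with $\delta(H_i)\subseteq AH_{i-1}V+VH_{i-1}A$ for all $1\le i\le t$. The pair $((T,\delta),I)$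 is a *triangular interlaced weak ditalgebra* if $(T,\delta)$ is a weak ditalgebra which is interlaced with $I$ and has a triangular layer, and $I$ is triangular with respect to $(T,\delta)$. **Proposition.** The pair $({\cal A}(\Delta),I)$ is a triangular interlaced weak ditalgebra. More precisely, ${\cal A}(\Delta)$ is a weak ditalgebra interlaced with $I$, the pair $(S,\hat D(B)_0\oplus\hat D(J))$ is a triangular layer of it, and the ideal $I$ is triangular with respect to ${\cal A}(\Delta)$. -/

import Mathlib

open CategoryTheory CategoryTheory.Abelian MulOpposite
universe u
set_option linter.unusedSectionVars false
namespace Yoneda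

section Systems
variable {Λ P : Type u} [Ring Λ]

/-- A homological system `(P, ≤, Δ)` for the algebra `Λ`: pairwise non-isomorphic indecomposable
finitely generated modules `Δ i`, indexed by a preordered set, with `Hom(Δ i, Δ j) ≠ 0` only if
`i ≤ j`, and `Ext¹(Δ i, Δ j) ≠ 0` only if `i ≤ j` and `i`, `j` are not equivalent. -/
structure HomologicalSystem (Λ P : Type u) [Ring Λ] [Preorder P] where
  Δ : P → ModuleCat.{u} Λ
  finite : ∀ i, Module.Finite Λ (Δ i)
  indecomposable : ∀ i, Indecomposable (Δ i)
  eq_of_iso : ∀ i j, Nonempty (Δ i ≅ Δ j) → i = j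
  le_of_hom : ∀ i j, Nontrivial (Δ i ⟶ Δ j) → i ≤ j
  lt_of_ext : ∀ i j, Nontrivial (Ext (Δ i) (Δ j) 1) → i ≤ j ∧ ¬ j ≤ i

variable (Λ) in
/-- `M` has a filtration with all factors isomorphic to some `Δ i`. -/
def HasDeltaFiltration (Δ : P → ModuleCat.{u} Λ) (M : Type u) [AddCommGroup M] [Module Λ M] :
    Prop :=
  ∃ (t : ℕ) (F : ℕ → Submodule Λ M), F 0 = ⊤ ∧ F t = ⊥ ∧ ∀ j < t, F (j + 1) ≤ F j ∧
    ∃ i, Nonempty ((F j ⧸ (F (j + 1)).submoduleOf (F j)) ≃ₗ[Λ] Δ i)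

variable (Λ) in
/-- Finitely generated indecomposable projective `Λ`-modules up to isomorphism. -/
def IndecProjClass : Type (u + 1) :=
  Quotient ((isIsomorphicSetoid (ModuleCat.{u} Λ)).comap
    (Subtype.val : {X : ModuleCat.{u} Λ //
      Module.Projective Λ X ∧ Module.Finite Λ X ∧ Indecomposable X} → ModuleCat.{u} Λ))

/-- The system is admissible: `Λ` has a `Δ`-filtration, and there are as many isomorphism classes of
indecomposable projective modules as elements of `P`. -/
structure HomologicalSystem.IsAdmissible [Preorder P] (H : HomologicalSystem Λ P) : Prop where
  filtered : HasDeltaFiltration Λ H.Δ Λ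
  card : Nat.card (IndecProjClass Λ) = Nat.card P
end Systems

section TensorAlg
variable (k S W : Type u) [Field k] [Ring S] [Algebra k S] [AddCommGroup W] [Module k W]
  [Module S W] [Module Sᵐᵒᵖ W]

/-- The relations that make `S` a subalgebra and `W` an `S`-`S`-bimodule inside the tensor algebra. -/
inductive BimodTensorRel : TensorAlgebra k (S × W) → TensorAlgebra k (S × W) → Prop
  | one : BimodTensorRel (TensorAlgebra.ι k (1, 0)) 1
  | mul (s t : S) : BimodTensorRel (TensorAlgebra.ι k (s * t, 0))
      (TensorAlgebra.ι k (s, 0) * TensorAlgebra.ι k (t, 0))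
  | left (s : S) (w : W) : BimodTensorRel (TensorAlgebra.ι k (0, s • w))
      (TensorAlgebra.ι k (s, 0) * TensorAlgebra.ι k (0, w))
  | right (w : W) (s : S) : BimodTensorRel (TensorAlgebra.ι k (0, MulOpposite.op s • w))
      (TensorAlgebra.ι k (0, w) * TensorAlgebra.ι k (s, 0))

/-- The tensor algebra `T_S(W)` of the `S`-`S`-bimodule `W`, on the generators `S` and `W`. -/
def BimodTensorAlgebra : Type u := RingQuot (BimodTensorRel k S W)

noncomputable instance : Ring (BimodTensorAlgebra k S W) :=
  inferInstanceAs (Ring (RingQuot (BimodTensorRel k S W)))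

noncomputable instance : Algebra k (BimodTensorAlgebra k S W) :=
  inferInstanceAs (Algebra k (RingQuot (BimodTensorRel k S W)))

namespace BimodTensorAlgebra

noncomputable def ofPair : S × W →ₗ[k] BimodTensorAlgebra k S W :=
  (RingQuot.mkAlgHom k (BimodTensorRel k S W)).toLinearMap ∘ₗ TensorAlgebra.ι k

/-- The structure map `S → T_S(W)`. -/
noncomputable def ofScalar : S →ₐ[k] BimodTensorAlgebra k S W :=
  AlgHom.ofLinearMap (ofPair k S W ∘ₗ LinearMap.inl k S W)
    (by
      have h := RingQuot.mkAlgHom_rel k (BimodTensorRel.one (k := k) (S := S) (W := W))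
      exact h.trans (map_one _))
    (fun s t => by
      have h := RingQuot.mkAlgHom_rel k (BimodTensorRel.mul (k := k) (S := S) (W := W) s t)
      exact h.trans (map_mul _ _ _))

/-- The structure map `W → T_S(W)`. -/
noncomputable def ofBimod : W →ₗ[k] BimodTensorAlgebra k S W :=
  ofPair k S W ∘ₗ LinearMap.inr k S W

theorem ofBimod_smul (s : S) (w : W) :
    ofBimod k S W (s • w) = ofScalar k S W s * ofBimod k S W w :=
  (RingQuot.mkAlgHom_rel k (BimodTensorRel.left (k := k) s w)).trans (map_mul _ _ _)

theorem ofBimod_op_smul (w : W) (s : S) :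
    ofBimod k S W (MulOpposite.op s • w) = ofBimod k S W w * ofScalar k S W s :=
  (RingQuot.mkAlgHom_rel k (BimodTensorRel.right (k := k) w s)).trans (map_mul _ _ _)

variable {k S W} in
noncomputable def lift {C : Type u} [Ring C] [Algebra k C] (f : S →ₐ[k] C) (g : W →ₗ[k] C)
    (hl : ∀ s w, g (s • w) = f s * g w)
    (hr : ∀ s w, g (MulOpposite.op s • w) = g w * f s) : BimodTensorAlgebra k S W →ₐ[k] C :=
  RingQuot.liftAlgHom k ⟨TensorAlgebra.lift k (LinearMap.coprod f.toLinearMap g), by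
    intro x y h
    induction h <;> simp_all⟩

variable {k S W}

@[simp] theorem lift_ofScalar {C : Type u} [Ring C] [Algebra k C] (f : S →ₐ[k] C)
    (g : W →ₗ[k] C) (hl) (hr) (s : S) : lift f g hl hr (ofScalar k S W s) = f s := by
  refine (RingQuot.liftAlgHom_mkAlgHom_apply k _ _ _).trans ?_
  simp

@[simp] theorem lift_ofBimod {C : Type u} [Ring C] [Algebra k C] (f : S →ₐ[k] C)
    (g : W →ₗ[k] C) (hl) (hr) (w : W) : lift f g hl hr (ofBimod k S W w) = g w := by
  refine (RingQuot.liftAlgHom_mkAlgHom_apply k _ _ _).trans ?_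
  simp

end BimodTensorAlgebra
end TensorAlg

section Dual
variable (S U : Type u) [CommRing S] [AddCommGroup U] [Module S U] [Module Sᵐᵒᵖ U]
  [SMulCommClass S Sᵐᵒᵖ U]
/-- The dual `D̂(U)`: left `S`-linear maps `U → S`, with the bimodule structure
`(s * β * s')(u) = s β(u s')`. -/
def HatDual : Type u := U →ₗ[S] S

namespace HatDual
instance : AddCommGroup (HatDual S U) := inferInstanceAs (AddCommGroup (U →ₗ[S] S))
instance : Module S (HatDual S U) := inferInstanceAs (Module S (U →ₗ[S] S))
instance {k : Type u} [CommRing k] [Algebra k S] : Module k (HatDual S U) :=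
  inferInstanceAs (Module k (U →ₗ[S] S))
instance : FunLike (HatDual S U) U S := inferInstanceAs (FunLike (U →ₗ[S] S) U S)
instance : LinearMapClass (HatDual S U) S U S :=
  inferInstanceAs (LinearMapClass (U →ₗ[S] S) S U S)

variable {S U}
@[ext] theorem ext {α β : HatDual S U} (h : ∀ u, α u = β u) : α = β := LinearMap.ext h
@[simp] theorem add_apply (α β : HatDual S U) (u : U) : (α + β) u = α u + β u := rfl
@[simp] theorem zero_apply (u : U) : (0 : HatDual S U) u = 0 := rfl
@[simp] theorem smul_apply (s : S) (β : HatDual S U) (u : U) : (s • β) u = s * β u := rfl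
@[simp] theorem ksmul_apply {k : Type u} [CommRing k] [Algebra k S] (c : k) (β : HatDual S U) (u : U) :
    (c • β) u = c • β u := rfl

instance : SMul Sᵐᵒᵖ (HatDual S U) where
  smul s β := (show U →ₗ[S] S from
    { toFun := fun u => β (s • u)
      map_add' := fun u v => by simp [smul_add]
      map_smul' := fun t u => by simp [← smul_comm t s u] } : U →ₗ[S] S)
@[simp] theorem op_smul_apply (s : Sᵐᵒᵖ) (β : HatDual S U) (u : U) : (s • β) u = β (s • u) := rfl

instance : Module Sᵐᵒᵖ (HatDual S U) where
  one_smul β := by ext u; simp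
  mul_smul s t β := by ext u; simp [← mul_smul, mul_comm]
  smul_zero s := by ext u; simp
  smul_add s α β := by ext u; simp
  add_smul s t β := by ext u; simp [add_smul]
  zero_smul β := by ext u; simp
end HatDual
end Dual
section
variable {Λ M : Type u} [Ring Λ] [AddCommGroup M] [Module Λ M]
theorem isCompl_of_indec (X : ModuleCat.{u} Λ) (h : Indecomposable X) (p q : Submodule Λ X)
    (hpq : IsCompl p q) : p = ⊥ ∨ q = ⊥ := by
  have e : X ≅ (ModuleCat.of Λ p ⊞ ModuleCat.of Λ q) :=
    (Submodule.prodEquivOfIsCompl p q hpq).symm.toModuleIso ≪≫ (ModuleCat.biprodIsoProd (ModuleCat.of Λ p) (ModuleCat.of Λ q)).symm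
  refine (h.2 _ _ e).imp ?_ ?_ <;> intro hz
  · have := ModuleCat.subsingleton_of_isZero hz
    exact (Submodule.subsingleton_iff_eq_bot).1 this
  · have := ModuleCat.subsingleton_of_isZero hz
    exact (Submodule.subsingleton_iff_eq_bot).1 this

theorem nilp_or_unit [IsNoetherian Λ M] [IsArtinian Λ M]
    (h : ∀ p q : Submodule Λ M, IsCompl p q → p = ⊥ ∨ q = ⊥) (f : Module.End Λ M) :
    IsNilpotent f ∨ IsUnit f := by
  obtain ⟨n, hn⟩ := Filter.eventually_atTop.1 (LinearMap.eventually_isCompl_ker_pow_range_pow f)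
  have hc := hn (n+1) (by omega)
  rcases h _ _ hc with h0 | h0
  · right
    rw [← isUnit_pow_iff (n := n+1) (by omega), Module.End.isUnit_iff]
    refine ⟨LinearMap.ker_eq_bot.1 h0, LinearMap.range_eq_top.1 ?_⟩
    have := hc.sup_eq_top
    rwa [h0, bot_sup_eq] at this
  · left
    exact ⟨n+1, LinearMap.range_eq_bot.1 h0⟩

theorem exists_sub_nilp {k : Type u} [Field k] [IsAlgClosed k] [Algebra k Λ] [Module.Finite k Λ] [Module.Finite Λ M]
    [Nontrivial M]
    (h : ∀ p q : Submodule Λ M, IsCompl p q → p = ⊥ ∨ q = ⊥) (f : Module.End Λ M) :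
    ∃ c : k, ∃ g : Module.End Λ M, IsNilpotent g ∧ ∀ x, f x = algebraMap k Λ c • x + g x := by
  let : Module k M := Module.compHom M (algebraMap k Λ)
  have : IsScalarTower k Λ M := IsScalarTower.of_algebraMap_smul fun _ _ => rfl
  have : Module.Finite k M := Module.Finite.trans Λ M
  have : IsNoetherian Λ M := isNoetherian_of_tower k inferInstance
  have : IsArtinian Λ M := isArtinian_of_tower k inferInstance
  obtain ⟨c, hc⟩ := Module.End.exists_eigenvalue (f.restrictScalars k : Module.End k M)
  let s : Module.End Λ M := 
    { toFun x := algebraMap k Λ c • x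
      map_add' x y := by simp
      map_smul' r x := by simp only [RingHom.id_apply, ← mul_smul, Algebra.commutes] }
  refine ⟨c, f - s, ?_, fun x => by simp [s]⟩
  refine (nilp_or_unit h _).resolve_right fun hu => ?_
  obtain ⟨x, hx⟩ := hc.exists_hasEigenvector
  rw [Module.End.isUnit_iff] at hu
  refine hx.2 (hu.1 ?_)
  have := hx.apply_eq_smul
  simp only [map_zero, LinearMap.sub_apply]
  exact sub_eq_zero.2 this

theorem comp_pow_comp {N M : Type u} [AddCommGroup M] [Module Λ M] [AddCommGroup N] [Module Λ N]
    (f : M →ₗ[Λ] N) (g : N →ₗ[Λ] M) (n : ℕ) (x : M) :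
    ((g ∘ₗ f : Module.End Λ M) ^ (n + 1)) x = g (((f ∘ₗ g : Module.End Λ N) ^ n) (f x)) := by
  induction n generalizing x with
  | zero => simp
  | succ n ih => rw [pow_succ, Module.End.mul_apply, ih]; rw [pow_succ]; rfl

theorem nilp_comp {N M : Type u} [AddCommGroup M] [Module Λ M] [AddCommGroup N] [Module Λ N]
    (f : M →ₗ[Λ] N) (g : N →ₗ[Λ] M) (h : IsNilpotent (f ∘ₗ g : Module.End Λ N)) :
    IsNilpotent (g ∘ₗ f : Module.End Λ M) := by
  obtain ⟨n, hn⟩ := h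
  exact ⟨n + 1, by ext x; rw [comp_pow_comp, hn]; simp⟩

theorem not_nilp_of_bij {M : Type u} [AddCommGroup M] [Module Λ M] [Nontrivial M] {f : Module.End Λ M}
   (h : IsNilpotent f) : ¬ Function.Bijective f := fun hf => by
  rw [← Module.End.isUnit_iff] at hf
  exact h.not_isUnit hf

theorem single_mem_jacobson {P : Type u} [DecidableEq P] (D : P → Type u) [∀ i, AddCommGroup (D i)] [∀ i, Module Λ (D i)]
    [∀ i, IsNoetherian Λ (D i)] [∀ i, IsArtinian Λ (D i)] [∀ i, Nontrivial (D i)]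
    (h : ∀ i, ∀ p q : Submodule Λ (D i), IsCompl p q → p = ⊥ ∨ q = ⊥) (i j : P) (f : D j →ₗ[Λ] D i)
    (hf : ¬ Function.Bijective f) :
    (LinearMap.single Λ D i ∘ₗ f ∘ₗ LinearMap.proj j : Module.End Λ (∀ i, D i)) ∈
      Ring.jacobson (Module.End Λ (∀ i, D i)) := by
  rw [← Ideal.jacobson_bot, Ideal.mem_jacobson_iff]
  intro y
  have key : IsNilpotent (y * (LinearMap.single Λ D i ∘ₗ f ∘ₗ LinearMap.proj j) :
      Module.End Λ (∀ i, D i)) := by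
    refine nilp_comp (LinearMap.proj j) (y ∘ₗ LinearMap.single Λ D i ∘ₗ f) ?_
    change IsNilpotent ((LinearMap.proj j ∘ₗ y ∘ₗ LinearMap.single Λ D i) ∘ₗ f : Module.End Λ (D j))
    set a := LinearMap.proj j ∘ₗ y ∘ₗ LinearMap.single Λ D i
    refine (nilp_or_unit (h j) _).resolve_right fun hu => hf ?_
    have hu' : IsUnit (f ∘ₗ a : Module.End Λ (D i)) :=
      (nilp_or_unit (h i) _).resolve_left fun hn => (nilp_comp _ _ hn).not_isUnit hu
    rw [Module.End.isUnit_iff] at hu hu'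
    exact ⟨Function.Injective.of_comp (show Function.Injective (a ∘ f) from hu.1),
      Function.Surjective.of_comp (show Function.Surjective (f ∘ a) from hu'.2)⟩
  obtain ⟨z, hz⟩ := key.isUnit_one_add.exists_left_inv
  refine ⟨z, ?_⟩
  rw [Ideal.mem_bot, ← hz, mul_add, mul_one, mul_assoc]
  abel
end
section Ext
variable {k Λ P : Type u} [Field k] [Ring Λ] [Algebra k Λ]

/-- The module `Δ = ⨁ Δ i`, over a finite index set. -/
abbrev tot (Δ : P → ModuleCat.{u} Λ) : ModuleCat.{u} Λ := ModuleCat.of Λ (∀ i, Δ i)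

/-- The endomorphism of `⨁ Δ i` given by the element `∑ s i • e_i` of `S = k^P`. -/
def actEnd (Δ : P → ModuleCat.{u} Λ) (s : P → k) : Module.End Λ (∀ i, Δ i) where
  toFun x i := algebraMap k Λ (s i) • x i
  map_add' x y := by ext i; simp
  map_smul' r x := by
    ext i
    simp only [Pi.smul_apply, RingHom.id_apply, ← mul_smul, Algebra.commutes]

def act (Δ : P → ModuleCat.{u} Λ) (s : P → k) : tot Δ ⟶ tot Δ := ModuleCat.ofHom (actEnd Δ s)

theorem act_apply (Δ : P → ModuleCat.{u} Λ) (s : P → k) (x : ∀ i, Δ i) (i : P) :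
    ((act Δ s).hom (show tot Δ from x) : ∀ i, Δ i) i = algebraMap k Λ (s i) • x i := rfl

theorem hom_tot_ext {Δ : P → ModuleCat.{u} Λ} {f g : tot Δ ⟶ tot Δ}
    (h : ∀ (x : ∀ i, Δ i) (i : P), (f.hom (show tot Δ from x) : ∀ i, Δ i) i =
      (g.hom (show tot Δ from x) : ∀ i, Δ i) i) : f = g :=
  ModuleCat.hom_ext (LinearMap.ext fun x => funext fun i => h x i)

variable (Δ : P → ModuleCat.{u} Λ)

theorem act_one : act Δ (1 : P → k) = 𝟙 _ :=
  hom_tot_ext fun x i => by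
    rw [act_apply]
    simp only [Pi.one_apply, map_one, one_smul]
    rfl

theorem act_mul (s t : P → k) : act Δ (s * t) = act Δ t ≫ act Δ s :=
  hom_tot_ext fun x i => by
    rw [act_apply, Pi.mul_apply, map_mul, mul_smul]
    rfl

theorem act_add (s t : P → k) : act Δ (s + t) = act Δ s + act Δ t :=
  hom_tot_ext fun x i => by
    rw [act_apply, Pi.add_apply, map_add, add_smul]
    rfl

theorem act_zero : act Δ (0 : P → k) = 0 :=
  hom_tot_ext fun x i => by
    rw [act_apply, Pi.zero_apply, map_zero, zero_smul]
    rfl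

theorem act_smul (c : k) (s : P → k) : act Δ (c • s) = c • act Δ s :=
  hom_tot_ext fun x i => by
    rw [act_apply, Pi.smul_apply, smul_eq_mul, map_mul, mul_smul]
    rfl

/-- The homogeneous component `Extⁿ(Δ, Δ)` of the Yoneda algebra. -/
def YExt (n : ℕ) : Type u := Ext (tot Δ) (tot Δ) n

variable {Δ}
namespace YExt
variable {n : ℕ}
noncomputable instance : AddCommGroup (YExt Δ n) :=
  inferInstanceAs (AddCommGroup (Ext (tot Δ) (tot Δ) n))
noncomputable instance : Module k (YExt Δ n) :=
  inferInstanceAs (Module k (Ext (tot Δ) (tot Δ) n))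

noncomputable instance : Module (P → k) (YExt Δ n) where
  smul s z := Ext.comp (show Ext (tot Δ) (tot Δ) n from z) (Ext.mk₀ (act Δ s)) (add_zero n)
  one_smul z := by
    change Ext.comp _ (Ext.mk₀ (act Δ (1 : P → k))) _ = _
    rw [act_one]; exact Ext.comp_mk₀_id _
  mul_smul s t z := by
    change Ext.comp _ (Ext.mk₀ (act Δ (s * t))) _ = Ext.comp (Ext.comp _ (Ext.mk₀ _) _) (Ext.mk₀ _) _
    rw [act_mul, ← Ext.mk₀_comp_mk₀, Ext.comp_assoc_of_third_deg_zero]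
  smul_zero s := Ext.zero_comp (X := tot Δ) (Y := tot Δ) _ _ _ (add_zero n)
  smul_add s x y := Ext.add_comp _ _ _ _
  add_smul s t z := by
    change Ext.comp _ (Ext.mk₀ (act Δ (s + t))) _ = Ext.comp _ (Ext.mk₀ _) _ + Ext.comp _ (Ext.mk₀ _) _
    rw [act_add, Ext.mk₀_add, Ext.comp_add]; rfl
  zero_smul z := by
    change Ext.comp _ (Ext.mk₀ (act Δ (0 : P → k))) _ = _
    rw [act_zero, Ext.mk₀_zero, Ext.comp_zero]; rfl

noncomputable instance : Module (P → k)ᵐᵒᵖ (YExt Δ n) where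
  smul s z := Ext.comp (Ext.mk₀ (act Δ (unop s))) (show Ext (tot Δ) (tot Δ) n from z) (zero_add n)
  one_smul z := by
    change Ext.comp (Ext.mk₀ (act Δ (1 : P → k))) _ _ = _
    rw [act_one]; exact Ext.mk₀_id_comp _
  mul_smul s t z := by
    change Ext.comp (Ext.mk₀ (act Δ (unop t * unop s))) _ _ =
      Ext.comp (Ext.mk₀ _) (Ext.comp (Ext.mk₀ _) _ _) _
    rw [act_mul]; exact (Ext.mk₀_comp_mk₀_assoc _ _ _).symm
  smul_zero s := Ext.comp_zero (Ext.mk₀ (act Δ (unop s))) (tot Δ) n _ (zero_add n)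
  smul_add s x y := Ext.comp_add _ _ _ _
  add_smul s t z := by
    change Ext.comp (Ext.mk₀ (act Δ (unop s + unop t))) _ _ =
      Ext.comp (Ext.mk₀ _) _ _ + Ext.comp (Ext.mk₀ _) _ _
    rw [act_add, Ext.mk₀_add, Ext.add_comp]; rfl
  zero_smul z := by
    change Ext.comp (Ext.mk₀ (act Δ (0 : P → k))) _ _ = _
    rw [act_zero, Ext.mk₀_zero, Ext.zero_comp]; rfl

theorem smul_def (s : P → k) (z : YExt Δ n) :
    s • z = Ext.comp (show Ext (tot Δ) (tot Δ) n from z) (Ext.mk₀ (act Δ s)) (add_zero n) := rfl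
theorem op_smul_def (s : P → k) (z : YExt Δ n) :
    op s • z = Ext.comp (Ext.mk₀ (act Δ s)) (show Ext (tot Δ) (tot Δ) n from z) (zero_add n) := rfl

instance : SMulCommClass (P → k) (P → k)ᵐᵒᵖ (YExt Δ n) where
  smul_comm s t z := by
    induction t using MulOpposite.rec' with | _ t
    exact Ext.comp_assoc_of_third_deg_zero _ _ _ _

instance : IsScalarTower k (P → k) (YExt Δ n) where
  smul_assoc c s z := by
    simp only [smul_def]
    rw [act_smul, Ext.mk₀_smul]; exact Ext.comp_smul _ _ _ _

instance : IsScalarTower k (P → k)ᵐᵒᵖ (YExt Δ n) where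
  smul_assoc c s z := by
    induction s using MulOpposite.rec' with | _ s
    rw [← op_smul]
    simp only [op_smul_def]
    rw [act_smul, Ext.mk₀_smul]; exact Ext.smul_comp _ _ _ _

/-- The product of the Yoneda algebra: `x * y` is `y` followed by `x`. -/
noncomputable def mul {m n : ℕ} (x : YExt Δ m) (y : YExt Δ n) : YExt Δ (m + n) :=
  Ext.comp (show Ext (tot Δ) (tot Δ) n from y) (show Ext (tot Δ) (tot Δ) m from x) (add_comm n m)

/-- The identification of `Ext⁰(Δ, Δ)` with `End(Δ)`. -/
noncomputable def toEnd : YExt Δ 0 ≃+ Module.End Λ (∀ i, Δ i) :=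
  (Ext.addEquiv₀ (X := tot Δ) (Y := tot Δ)).trans
    { toFun := fun f => f.hom
      invFun := fun f => ModuleCat.ofHom f
      left_inv := fun _ => rfl
      right_inv := fun _ => rfl
      map_add' := fun _ _ => rfl }

theorem toEnd_mk₀ (f : tot Δ ⟶ tot Δ) : toEnd (Ext.mk₀ f : YExt Δ 0) = f.hom := by
  have := (Ext.addEquiv₀ (X := tot Δ) (Y := tot Δ)).apply_symm_apply f
  exact congrArg (fun g : tot Δ ⟶ tot Δ => g.hom) this

theorem mk₀_toEnd (z : YExt Δ 0) :
    (Ext.mk₀ (ModuleCat.ofHom (toEnd z)) : YExt Δ 0) = z :=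
  toEnd.injective (toEnd_mk₀ _)

theorem toEnd_smul (s : P → k) (z : YExt Δ 0) : toEnd (s • z) = actEnd Δ s * toEnd z := by
  conv_lhs => rw [← mk₀_toEnd z]
  exact (congrArg toEnd (Ext.mk₀_comp_mk₀ _ (act Δ s))).trans (toEnd_mk₀ _)

theorem toEnd_op_smul (s : P → k) (z : YExt Δ 0) :
    toEnd (op s • z) = toEnd z * actEnd Δ s := by
  conv_lhs => rw [← mk₀_toEnd z]
  exact (congrArg toEnd (Ext.mk₀_comp_mk₀ (act Δ s) _)).trans (toEnd_mk₀ _)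

theorem const_smul (c : k) (z : YExt Δ n) : Function.const P c • z = c • z := by
  have : Function.const P c = c • (1 : P → k) := by ext; simp
  rw [this, smul_assoc, one_smul]

variable (Δ) in
/-- The idempotent `e_i`, as an element of `Ext⁰(Δ, Δ)`. -/
noncomputable def idem [DecidableEq P] (i : P) : YExt Δ 0 :=
  Ext.mk₀ (act Δ (Pi.single i (1 : k)))
end YExt

variable (k) in
/-- The Jacobson radical `J` of `End(Δ)`, inside `Ext⁰(Δ, Δ)`. -/
noncomputable def radJ : Submodule k (YExt Δ 0) where
  carrier := {z | YExt.toEnd z ∈ Ring.jacobson (Module.End Λ (∀ i, Δ i))}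
  add_mem' hx hy := by
    simp only [Set.mem_ofPred_eq, map_add] at *; exact add_mem hx hy
  zero_mem' := by simp
  smul_mem' c z hz := by
    simp only [Set.mem_ofPred_eq] at *
    rw [← YExt.const_smul, YExt.toEnd_smul]
    exact Ideal.mul_mem_left _ _ hz

theorem smul_mem_radJ (s : P → k) {z : YExt Δ 0} (hz : z ∈ radJ k) : s • z ∈ radJ k (Δ := Δ) := by
  change YExt.toEnd (s • z) ∈ Ring.jacobson (Module.End Λ (∀ i, Δ i))
  rw [YExt.toEnd_smul]
  exact Ideal.mul_mem_left _ _ hz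

theorem op_smul_mem_radJ (s : (P → k)ᵐᵒᵖ) {z : YExt Δ 0} (hz : z ∈ radJ k) :
    s • z ∈ radJ k (Δ := Δ) := by
  induction s using MulOpposite.rec' with | _ s
  change YExt.toEnd (op s • z) ∈ Ring.jacobson (Module.End Λ (∀ i, Δ i))
  rw [YExt.toEnd_op_smul]
  exact Ideal.mul_mem_right _ _ hz


noncomputable instance : Module (P → k) (radJ k (Δ := Δ)) :=
  letI : SMul (P → k) (radJ k (Δ := Δ)) := ⟨fun s z => ⟨s • z.1, smul_mem_radJ s z.2⟩⟩
  Function.Injective.module (P → k) (radJ k (Δ := Δ)).subtype.toAddMonoidHom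
    Subtype.val_injective fun _ _ => rfl

noncomputable instance : Module (P → k)ᵐᵒᵖ (radJ k (Δ := Δ)) :=
  letI : SMul (P → k)ᵐᵒᵖ (radJ k (Δ := Δ)) := ⟨fun s z => ⟨s • z.1, op_smul_mem_radJ s z.2⟩⟩
  Function.Injective.module (P → k)ᵐᵒᵖ (radJ k (Δ := Δ)).subtype.toAddMonoidHom
    Subtype.val_injective fun _ _ => rfl

instance : SMulCommClass (P → k) (P → k)ᵐᵒᵖ (radJ k (Δ := Δ)) where
  smul_comm s t z := Subtype.ext (smul_comm s t z.1)

instance : IsScalarTower k (P → k) (radJ k (Δ := Δ)) where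
  smul_assoc c s z := Subtype.ext (smul_assoc c s z.1)

instance : IsScalarTower k (P → k)ᵐᵒᵖ (radJ k (Δ := Δ)) where
  smul_assoc c s z := Subtype.ext (smul_assoc c s z.1)

variable (k Δ) in
/-- The inclusion of `S = k^P` in `Ext⁰(Δ, Δ)`, sending `s` to `∑ s i • e_i`. -/
noncomputable def scalarS : (P → k) →ₗ[k] YExt Δ 0 where
  toFun s := Ext.mk₀ (act Δ s)
  map_add' s t := by rw [act_add, Ext.mk₀_add]; rfl
  map_smul' c s := by rw [act_smul, Ext.mk₀_smul]; rfl

theorem toEnd_scalarS (s : P → k) : YExt.toEnd (scalarS k Δ s) = actEnd Δ s := YExt.toEnd_mk₀ _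

theorem HomologicalSystem.isCompl [IsAlgClosed k] [Module.Finite k Λ] [Preorder P] [Fintype P]
   (H : HomologicalSystem Λ P) : IsCompl (LinearMap.range (scalarS k H.Δ)) (radJ k) := by
  classical
  have := H.finite
  have : IsNoetherianRing Λ := isNoetherian_of_tower k inferInstance
  have : IsArtinianRing Λ := isArtinian_of_tower k inferInstance
  have nt : ∀ i, Nontrivial (H.Δ i) := fun i => by
    rw [← not_subsingleton_iff_nontrivial]
    exact fun h => (H.indecomposable i).1 (ModuleCat.isZero_of_subsingleton _)
  have ind := fun i => isCompl_of_indec (H.Δ i) (H.indecomposable i)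
  constructor
  · rw [Submodule.disjoint_def]
    rintro _ ⟨s, rfl⟩ hs
    have hs' : actEnd H.Δ s ∈ Ring.jacobson (Module.End Λ (∀ i, H.Δ i)) := by
      rw [← toEnd_scalarS]; exact hs
    have : s = 0 := by
      by_contra h
      obtain ⟨i, hi⟩ : ∃ i, s i ≠ 0 := by
        by_contra! h'; exact h (funext h')
      rw [← Ideal.jacobson_bot, Ideal.mem_jacobson_iff] at hs'
      obtain ⟨z, hz⟩ := hs' (actEnd H.Δ (Pi.single i (- (s i)⁻¹)))
      rw [Ideal.mem_bot] at hz
      obtain ⟨x, hx⟩ := exists_ne (0 : H.Δ i)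
      have h1 := congrArg (fun f => f (Pi.single i x : ∀ i, H.Δ i)) hz
      have h2 : (actEnd H.Δ (Pi.single i (- (s i)⁻¹))) (actEnd H.Δ s (Pi.single i x)) =
          - (Pi.single i x : ∀ i, H.Δ i) := by
        funext j
        change algebraMap k Λ ((Pi.single i (- (s i)⁻¹) : P → k) j) • algebraMap k Λ (s j) •
          (Pi.single i x : ∀ i, H.Δ i) j = _
        rw [← mul_smul, ← map_mul]
        rcases eq_or_ne j i with rfl | hj
        · simp [hi]
        · simp [hj]
      simp only [LinearMap.sub_apply, LinearMap.add_apply, Module.End.mul_apply, h2, map_neg,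
        Module.End.one_apply, LinearMap.zero_apply, neg_add_cancel, zero_sub, neg_eq_zero] at h1
      have h3 := congrFun h1 i
      rw [Pi.single_eq_same] at h3
      exact hx h3
    rw [this, map_zero]
  · rw [codisjoint_iff, eq_top_iff]
    rintro z -
    choose c g hg hf using fun i => exists_sub_nilp (k := k) (ind i)
      (LinearMap.proj i ∘ₗ YExt.toEnd z ∘ₗ LinearMap.single Λ (fun i => H.Δ i) i)
    refine Submodule.mem_sup.2 ⟨scalarS k H.Δ c, ⟨c, rfl⟩, z - scalarS k H.Δ c, ?_, by abel⟩
    change YExt.toEnd _ ∈ Ring.jacobson (Module.End Λ (∀ i, H.Δ i))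
    rw [map_sub, toEnd_scalarS]
    set e := YExt.toEnd z - actEnd H.Δ c with he
    have sum : e = ∑ i, ∑ j, LinearMap.single Λ (fun i => H.Δ i) i ∘ₗ
        (LinearMap.proj i ∘ₗ e ∘ₗ LinearMap.single Λ (fun i => H.Δ i) j) ∘ₗ LinearMap.proj j := by
      refine LinearMap.ext fun x => funext fun l => ?_
      simp only [LinearMap.sum_apply, LinearMap.comp_apply, Finset.sum_apply, LinearMap.proj_apply,
        LinearMap.coe_single]
      rw [Finset.sum_comm]
      simp only [Finset.sum_pi_single, Finset.mem_univ, if_true]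
      rw [← Finset.sum_apply, ← map_sum, Finset.univ_sum_single]
    rw [sum]
    refine sum_mem fun i _ => sum_mem fun j _ =>
      single_mem_jacobson (fun i => H.Δ i) ind i j _ fun hb => ?_
    have hij : j = i := H.eq_of_iso j i ⟨(LinearEquiv.ofBijective _ hb).toModuleIso⟩
    subst hij
    refine not_nilp_of_bij (hg j) ?_
    convert hb using 2
    ext x
    have := hf j x
    simp only [he, LinearMap.comp_apply, LinearMap.sub_apply, map_sub]
    change YExt.toEnd z (Pi.single j x) j = algebraMap k Λ (c j) • x + g j x at this
    change g j x = YExt.toEnd z (Pi.single j x) j -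
      algebraMap k Λ (c j) • (Pi.single j x : ∀ i, H.Δ i) j
    rw [this, Pi.single_eq_same]
    abel

/-- The projection of `End(Δ) = S ⊕ J` onto `J`. -/
noncomputable def HomologicalSystem.projJ [IsAlgClosed k] [Module.Finite k Λ] [Preorder P] [Fintype P]
   (H : HomologicalSystem Λ P) : YExt H.Δ 0 →ₗ[k] radJ k (Δ := H.Δ) :=
  Submodule.projectionOnto (radJ k) (LinearMap.range (scalarS k H.Δ)) (H.isCompl (k := k)).symm
end Ext

section Directed
variable (k : Type u) {P : Type u} [Field k] [DecidableEq P] (U : Type u) [AddCommGroup U] [Module k U]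
  [Module (P → k) U] [Module (P → k)ᵐᵒᵖ U] [SMulCommClass (P → k) (P → k)ᵐᵒᵖ U]
  [IsScalarTower k (P → k) U] [IsScalarTower k (P → k)ᵐᵒᵖ U]

abbrev eS (i : P) : P → k := Pi.single i 1

variable {k} in
theorem mul_eS (s : P → k) (i : P) : s * eS k i = s i • eS k i := by
  funext l
  rcases eq_or_ne l i with rfl | h
  · simp
  · simp [h]

/-- The map `u ↦ e_j u e_i`. -/
def cut (i j : P) : U →ₗ[k] U where
  toFun u := eS k j • (op (eS k i) • u)
  map_add' u v := by simp only [smul_add]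
  map_smul' c u := by
    rw [RingHom.id_apply, smul_comm (op (eS k i)) c u, smul_comm (eS k j) c]

variable {k U} in
theorem cut_smul (i j : P) (s : P → k) (u : U) : cut k U i j (s • u) = s j • cut k U i j u := by
  change eS k j • (op (eS k i) • (s • u)) = s j • (eS k j • (op (eS k i) • u))
  rw [← smul_comm s, smul_smul, mul_comm, mul_eS, smul_assoc]

variable {k U} in
theorem op_smul_cut (i j : P) (s : P → k) (u : U) :
    op s • cut k U i j u = s i • cut k U i j u := by
  change op s • (eS k j • (op (eS k i) • u)) = s i • (eS k j • (op (eS k i) • u))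
  rw [← smul_comm (eS k j), smul_smul, ← op_mul, mul_comm, mul_eS, op_smul, smul_assoc]
  rw [← smul_one_smul (P → k) (s i), smul_smul, mul_comm, ← smul_smul, smul_one_smul]

variable {k U} in
theorem cut_op_smul (i j : P) (s : P → k) (u : U) :
    cut k U i j (op s • u) = s i • cut k U i j u := by
  rw [← op_smul_cut]
  change eS k j • (op (eS k i) • (op s • u)) = op s • (eS k j • (op (eS k i) • u))
  rw [← smul_comm (eS k j), smul_smul, smul_smul, ← op_mul, ← op_mul, mul_comm]

abbrev corner (i j : P) : Submodule k U := LinearMap.range (cut k U i j)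

/-- Indices for a directed basis of `U`: a basis of each of the subspaces `e_j U e_i`. -/
def DirIdx : Type u := Σ p : P × P, Module.Basis.ofVectorSpaceIndex k (corner k U p.1 p.2)

namespace DirIdx
variable {k U}
def src (a : DirIdx k (P := P) U) : P := a.1.1
def tgt (a : DirIdx k (P := P) U) : P := a.1.2
/-- The directed basis element `x` with index `a`. -/
noncomputable def elt (a : DirIdx k (P := P) U) : U :=
  (Module.Basis.ofVectorSpace k (corner k U a.1.1 a.1.2) a.2 : corner k U a.1.1 a.1.2)

/-- The dual basis element `x^*`, with `x^*(y) = δ_{x,y} e_{t(x)}` on directed basis elements. -/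
noncomputable def dual (a : DirIdx k (P := P) U) : HatDual (P → k) U :=
  (show U →ₗ[P → k] (P → k) from
    { toFun := fun u => Pi.single a.tgt ((Module.Basis.ofVectorSpace k
        (corner k U a.1.1 a.1.2)).coord a.2 ((cut k U a.1.1 a.1.2).rangeRestrict u))
      map_add' := fun u v => by simp only [map_add, Pi.single_add]
      map_smul' := fun s u => by
        have : (cut k U a.1.1 a.1.2).rangeRestrict (s • u) =
            s a.tgt • (cut k U a.1.1 a.1.2).rangeRestrict u :=
          Subtype.ext (cut_smul _ _ _ _)
        rw [this, map_smul, RingHom.id_apply]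
        funext l
        rcases eq_or_ne l a.tgt with rfl | h
        · simp
        · simp [h] })

theorem op_smul_elt (s : P → k) (a : DirIdx k (P := P) U) : op s • a.elt = s a.src • a.elt := by
  obtain ⟨u, hu⟩ := (Module.Basis.ofVectorSpace k (corner k U a.1.1 a.1.2) a.2).2
  change op s • (Module.Basis.ofVectorSpace k (corner k U a.1.1 a.1.2) a.2).1 =
    s a.1.1 • (Module.Basis.ofVectorSpace k (corner k U a.1.1 a.1.2) a.2).1
  rw [← hu, op_smul_cut]

theorem op_smul_dual (s : P → k) (a : DirIdx k (P := P) U) :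
    op s • a.dual = s a.src • a.dual := by
  ext1 u
  have : (cut k U a.1.1 a.1.2).rangeRestrict (op s • u) =
      s a.src • (cut k U a.1.1 a.1.2).rangeRestrict u :=
    Subtype.ext (cut_op_smul _ _ _ _)
  change Pi.single a.tgt ((Module.Basis.ofVectorSpace k (corner k U a.1.1 a.1.2)).coord a.2
    ((cut k U a.1.1 a.1.2).rangeRestrict (op s • u))) = s a.src • Pi.single a.tgt _
  rw [this, map_smul, ← Pi.single_smul]
end DirIdx
end Directed

section AInf
variable (k : Type u) {Λ P : Type u} [Field k] [Ring Λ] [Algebra k Λ] [DecidableEq P]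
  (Δ : P → ModuleCat.{u} Λ)

/-- The Yoneda algebra `A = ⨁ Extⁿ(Δ, Δ)`. -/
abbrev YAlg (Δ : P → ModuleCat.{u} Λ) : Type u := DirectSum ℕ (YExt Δ)

/-- A homogeneous element of the Yoneda algebra. -/
noncomputable abbrev homog {Δ : P → ModuleCat.{u} Λ} {d : ℕ} (x : YExt Δ d) : YAlg Δ :=
  DirectSum.of (YExt Δ) d x

/-- A strict `A_∞`-structure on the Yoneda algebra. The maps `m n : A^{⊗_S n} → A` of
`S`-`S`-bimodules are given as `k`-multilinear maps that are `S`-balanced and compatible with the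
two outer actions of `S`; only `n ≥ 1` matters. They have degree `2 - n` and satisfy the Stasheff
identities `∑ (-1)^{r+st} m_{r+1+t} (id^{⊗r} ⊗ m_s ⊗ id^{⊗t}) = 0`, where evaluation on
homogeneous elements follows the Koszul sign rule. Moreover `m 1 = 0`, `m 2` is the product, and
`m n` with `n ≥ 3` vanishes as soon as one of its arguments is some `e_i`. -/
structure StrictAInfinity where
  m : ∀ n : ℕ, MultilinearMap k (fun _ : Fin n => YAlg Δ) (YAlg Δ)
  smul_left : ∀ (n : ℕ) (s : P → k) (a : Fin (n + 1) → YAlg Δ),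
    m (n + 1) (Function.update a 0 (s • a 0)) = s • m (n + 1) a
  smul_right : ∀ (n : ℕ) (s : P → k) (a : Fin (n + 1) → YAlg Δ),
    m (n + 1) (Function.update a (Fin.last n) (op s • a (Fin.last n))) = op s • m (n + 1) a
  balanced : ∀ (n : ℕ) (s : P → k) (a : Fin (n + 1) → YAlg Δ) (i : Fin n),
    m (n + 1) (Function.update a i.castSucc (op s • a i.castSucc)) =
      m (n + 1) (Function.update a i.succ (s • a i.succ))
  degree : ∀ (n : ℕ) (d : Fin (n + 1) → ℕ) (x : ∀ r, YExt Δ (d r)) (e : ℕ),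
    (e : ℤ) ≠ (∑ r, (d r : ℤ)) + 2 - (n + 1) → m (n + 1) (fun r => homog (x r)) e = 0
  stasheff : ∀ n : ℕ, 1 ≤ n → ∀ (d : ℕ → ℕ) (x : ∀ r, YExt Δ (d r)),
    ∑ r ∈ Finset.range n, ∑ s ∈ Finset.Icc 1 (n - r),
      (-1 : k) ^ (r + s * (n - r - s) + s * ∑ i ∈ Finset.range r, d i) •
        m (r + 1 + (n - r - s)) (fun i =>
          if (i : ℕ) < r then homog (x i)
          else if (i : ℕ) = r then m s (fun j => homog (x (r + j)))
          else homog (x (i + s - 1))) = 0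
  m_one : m 1 = 0
  m_two : ∀ (d e : ℕ) (x : YExt Δ d) (y : YExt Δ e),
    m 2 ![homog x, homog y] = homog (x.mul y)
  strict : ∀ (n : ℕ), 3 ≤ n → ∀ (a : Fin n → YAlg Δ) (r : Fin n) (i : P),
    a r = homog (YExt.idem (k := k) Δ i) → m n a = 0

variable {k Δ}
/-- Multiplication by `(-1)^{e d}` in degree `d`. -/
noncomputable def signMap (e : ℕ) : YAlg Δ →ₗ[k] YAlg Δ :=
  DirectSum.lmap fun d => ((-1 : k) ^ (e * d)) • LinearMap.id

variable (k) in
/-- The component of degree `d`. -/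
noncomputable def degComp (d : ℕ) : YAlg Δ →ₗ[k] YExt Δ d := DirectSum.component k ℕ (YExt Δ) d

theorem degComp_op_smul (d : ℕ) (s : P → k) (x : YAlg Δ) : degComp k d (op s • x) = op s • degComp k d x :=
  rfl
theorem degComp_smul (d : ℕ) (s : P → k) (x : YAlg Δ) : degComp k d (s • x) = s • degComp k d x :=
  rfl

/-- The operations `b_n` of the bar construction `B = A[1]`, with `b_n σ^{⊗n} = σ m_n`, where
`σ : A → B` is the identity regarded as a map of degree `-1`. By the Koszul rule
`σ^{⊗n}(a_1 ⊗ ⋯ ⊗ a_n)` carries the sign `∏ (-1)^{(n-r) deg a_r}`. The underlying space of `B` is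
identified with `A`, the degree in `A` being the degree in `B` plus one. -/
noncomputable def StrictAInfinity.b (m : StrictAInfinity k Δ) (n : ℕ) :
    MultilinearMap k (fun _ : Fin n => YAlg Δ) (YAlg Δ) :=
  (m.m n).compLinearMap fun r => signMap (n - 1 - r)

theorem smul_homog {d : ℕ} (c : k) (x : YExt Δ d) : c • homog x = homog (c • x) :=
  ((DirectSum.lof k ℕ (YExt Δ) d).map_smul c x).symm

theorem op_smul_homog {d : ℕ} (s : P → k) (x : YExt Δ d) : op s • homog x = homog (op s • x) :=
  ((DirectSum.lof (P → k)ᵐᵒᵖ ℕ (YExt Δ) d).map_smul (op s) x).symm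

theorem signMap_homog (e d : ℕ) (x : YExt Δ d) :
    signMap (k := k) e (homog x) = (-1 : k) ^ (e * d) • homog x := by
  rw [smul_homog]
  exact DirectSum.lmap_of _ _ _

theorem StrictAInfinity.b_op_smul (m : StrictAInfinity k Δ) {n : ℕ} (a : Fin (n + 1) → YAlg Δ)
    (s : P → k) (c : k) {d : ℕ} (x : YExt Δ d) (hx : a (Fin.last n) = homog x)
    (h : op s • x = c • x) : op s • m.b (n + 1) a = c • m.b (n + 1) a := by
  rw [StrictAInfinity.b, MultilinearMap.compLinearMap_apply, ← m.smul_right]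
  have key (e : ℕ) : op s • signMap (k := k) e (a (Fin.last n)) =
      c • signMap (k := k) e (a (Fin.last n)) := by
    rw [hx, signMap_homog, smul_homog, op_smul_homog, smul_comm (op s), h, smul_comm,
      ← smul_homog]
  rw [key, (m.m (n + 1)).map_update_smul, Function.update_eq_self]
end AInf

section Ditalgebra
variable {k Λ P : Type u} [Field k] [IsAlgClosed k] [Ring Λ] [Algebra k Λ] [Module.Finite k Λ]
  [DecidableEq P] [Fintype P] [Preorder P]

variable (k) in
/-- The `S`-`S`-bimodule `D̂(B)₀ ⊕ D̂(J)`, where `B₀ = Ext¹(Δ, Δ)`. -/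
abbrev GenW (H : HomologicalSystem Λ P) : Type u :=
  HatDual (P → k) (YExt H.Δ 1) × HatDual (P → k) (radJ k (Δ := H.Δ))

variable (k) in
/-- The tensor algebra `T(Δ) = T_S(D̂(B)₀ ⊕ D̂(J))`. -/
abbrev TDelta (H : HomologicalSystem Λ P) : Type u := BimodTensorAlgebra k (P → k) (GenW k H)

def HatDual.toLin {U : Type u} [AddCommGroup U] [Module k U] [Module (P → k) U]
    [Module (P → k)ᵐᵒᵖ U] [SMulCommClass (P → k) (P → k)ᵐᵒᵖ U] [IsScalarTower k (P → k) U] :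
    HatDual (P → k) U →ₗ[k] (U →ₗ[k] (P → k)) where
  toFun φ := LinearMap.restrictScalars k (show U →ₗ[P → k] (P → k) from φ)
  map_add' _ _ := rfl
  map_smul' _ _ := rfl

theorem projJ_scalarS (H : HomologicalSystem Λ P) (c : P → k) :
    H.projJ (k := k) (scalarS k H.Δ c) = 0 :=
  Submodule.projectionOnto_apply_right _ (⟨_, ⟨c, rfl⟩⟩ : LinearMap.range (scalarS k H.Δ))

theorem projJ_coe (H : HomologicalSystem Λ P) (j : radJ k (Δ := H.Δ)) : H.projJ (k := k) j.1 = j :=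
  Submodule.projectionOnto_apply_left _ j

theorem op_smul_scalarS (Δ : P → ModuleCat.{u} Λ) (s c : P → k) :
    op s • scalarS k Δ c = scalarS k Δ (s * c) := by
  apply YExt.toEnd.injective
  rw [YExt.toEnd_op_smul, toEnd_scalarS, toEnd_scalarS]
  refine LinearMap.ext fun x => funext fun i => ?_
  change algebraMap k Λ (c i) • algebraMap k Λ (s i) • x i = algebraMap k Λ (s i * c i) • x i
  rw [mul_comm, map_mul, mul_smul]

theorem projJ_op_smul (H : HomologicalSystem Λ P) (s : P → k) (z : YExt H.Δ 0) :
    H.projJ (op s • z) = op s • H.projJ (k := k) z := by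
  have hz : z ∈ LinearMap.range (scalarS k H.Δ) ⊔ radJ k := by
    rw [(H.isCompl (k := k)).sup_eq_top]; trivial
  obtain ⟨_, ⟨c, rfl⟩, j, hj, rfl⟩ := Submodule.mem_sup.1 hz
  have h3 : op s • (scalarS k H.Δ c + j) =
      scalarS k H.Δ (s * c) + (op s • (⟨j, hj⟩ : radJ k (Δ := H.Δ))).1 := by
    rw [smul_add, op_smul_scalarS]; rfl
  have h4 : H.projJ (k := k) (scalarS k H.Δ c + j) = ⟨j, hj⟩ := by
    rw [LinearMap.map_add, projJ_scalarS, zero_add]; exact projJ_coe H ⟨j, hj⟩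
  rw [h4, h3, LinearMap.map_add, projJ_scalarS, zero_add, projJ_coe]

variable (H : HomologicalSystem Λ P)
/-- An element `(α, ξ)` of `D̂(B)₀ ⊕ D̂(J)` as a function on the Yoneda algebra: `α` on `Ext¹`, and
`ξ` on `Ext⁰ = S ⊕ J`, extended by zero on `S`. -/
noncomputable def extW : GenW k H →ₗ[k] (YAlg H.Δ →ₗ[k] (P → k)) :=
  LinearMap.coprod
    ((LinearMap.lcomp k (P → k) (degComp k 1)) ∘ₗ HatDual.toLin)
    ((LinearMap.lcomp k (P → k) (H.projJ ∘ₗ degComp k 0)) ∘ₗ HatDual.toLin)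

theorem extW_apply (w : GenW k H) (x : YAlg H.Δ) :
    extW H w x = w.1 (degComp k 1 x) + w.2 (H.projJ (degComp k 0 x)) := rfl

theorem extW_smul (s : P → k) (w : GenW k H) (x : YAlg H.Δ) :
    extW H (s • w) x = s * extW H w x := by
  simp only [extW_apply, mul_add]; rfl

theorem extW_op_smul (s : P → k) (w : GenW k H) (x : YAlg H.Δ) :
    extW H (op s • w) x = extW H w (op s • x) := by
  simp only [extW_apply, degComp_op_smul, projJ_op_smul]; rfl

/-- An element of `D̂(B)₋₁`, where `B₁ = Ext²(Δ, Δ)`, as a function on the Yoneda algebra. -/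
noncomputable def ext2 : HatDual (P → k) (YExt H.Δ 2) →ₗ[k] (YAlg H.Δ →ₗ[k] (P → k)) :=
  (LinearMap.lcomp k (P → k) (degComp k 2)) ∘ₗ HatDual.toLin

variable (k)
/-- Indices for a directed basis of `B₀ = Ext¹(Δ, Δ)`. -/
abbrev SolidIdx : Type u := DirIdx k (P := P) (YExt H.Δ 1)
/-- Indices for a directed basis of `J`. -/
abbrev DashedIdx : Type u := DirIdx k (P := P) (radJ k (Δ := H.Δ))

/-- The inclusion of `D̂(B)₀` in `T(Δ)`. -/
noncomputable def ofSolid : HatDual (P → k) (YExt H.Δ 1) →ₗ[k] TDelta k H :=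
  BimodTensorAlgebra.ofBimod k (P → k) (GenW k H) ∘ₗ LinearMap.inl k _ _

/-- The inclusion of `D̂(J)` in `T(Δ)`. -/
noncomputable def ofDashed : HatDual (P → k) (radJ k (Δ := H.Δ)) →ₗ[k] TDelta k H :=
  BimodTensorAlgebra.ofBimod k (P → k) (GenW k H) ∘ₗ LinearMap.inr k _ _

/-- The directed basis elements of `B₀ ⊕ J`. -/
noncomputable def arrowElt : SolidIdx k H ⊕ DashedIdx k H → YAlg H.Δ
  | .inl a => homog a.elt
  | .inr a => homog a.elt.1

/-- The dual basis elements of `D̂(B)₀ ⊕ D̂(J)`, inside `T(Δ)`. -/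
noncomputable def arrowDual : SolidIdx k H ⊕ DashedIdx k H → TDelta k H
  | .inl a => ofSolid k H a.dual
  | .inr a => ofDashed k H a.dual

variable {k H}
/-- The summand `φ(b_n(x_1 ⊗ ⋯ ⊗ x_n)) x_1^* ⊗ ⋯ ⊗ x_n^*` of `d̂(b_n)(φ)`, for directed basis
elements `x_1, …, x_n`. Here `d̂(b_n) : D̂(B) → D̂(B)^{⊗n}` is the dual of `b_n` followed by the
inverse of the canonical isomorphism `D̂(B)^{⊗n} → D̂(B^{⊗n})`, and `d̂(b_n)(φ)` is the sum of these
terms over all tuples of elements of a directed basis of `B`. -/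
noncomputable def StrictAInfinity.pathTerm (m : StrictAInfinity k H.Δ) {n : ℕ}
    (a : Fin n → SolidIdx k H ⊕ DashedIdx k H) : (YAlg H.Δ →ₗ[k] (P → k)) →ₗ[k] TDelta k H :=
  LinearMap.mulRight k (List.ofFn fun r => arrowDual k H (a r)).prod ∘ₗ
    (BimodTensorAlgebra.ofScalar k (P → k) (GenW k H)).toLinearMap ∘ₗ
      LinearMap.applyₗ (m.b n fun r => arrowElt k H (a r))

theorem StrictAInfinity.pathTerm_apply (m : StrictAInfinity k H.Δ) {n : ℕ}
    (a : Fin n → SolidIdx k H ⊕ DashedIdx k H) (φ : YAlg H.Δ →ₗ[k] (P → k)) :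
    m.pathTerm a φ = BimodTensorAlgebra.ofScalar k (P → k) (GenW k H)
      (φ (m.b n fun r => arrowElt k H (a r))) * (List.ofFn fun r => arrowDual k H (a r)).prod := rfl

/-- The differential `δ` on the generators: the component in `T_S(D̂(B)₀ ⊕ D̂(J))` of
`d = ∑_{n ≥ 2} d̂(b_n)`. Only finitely many terms of the sum are non-zero. -/
noncomputable def StrictAInfinity.deltaGen (m : StrictAInfinity k H.Δ) :
    GenW k H →ₗ[k] TDelta k H :=
  ∑ᶠ (n : ℕ) (_ : 2 ≤ n) (a : Fin n → SolidIdx k H ⊕ DashedIdx k H), m.pathTerm a ∘ₗ extW H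

/-- The map `β : D̂(B)₋₁ → T_S(D̂(B)₀)`, which is the component in `T_S(D̂(B)₀)` of the map
`∑_{n ≥ 2} d̂(b_n)`. Only finitely many terms of the sum are non-zero. -/
noncomputable def StrictAInfinity.beta (m : StrictAInfinity k H.Δ) :
    HatDual (P → k) (YExt H.Δ 2) →ₗ[k] TDelta k H :=
  ∑ᶠ (n : ℕ) (_ : 2 ≤ n) (a : Fin n → SolidIdx k H),
    m.pathTerm (fun r => Sum.inl (a r)) ∘ₗ ext2 H

theorem StrictAInfinity.deltaGen_smul (m : StrictAInfinity k H.Δ) (s : P → k) (w : GenW k H) :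
    m.deltaGen (s • w) =
      BimodTensorAlgebra.ofScalar k (P → k) (GenW k H) s * m.deltaGen w := by
  unfold StrictAInfinity.deltaGen
  refine finsum_induction (fun f : GenW k H →ₗ[k] TDelta k H => f (s • w) = _ * f w) (by simp)
    (fun f g hf hg => by simp only [LinearMap.add_apply, hf, hg, mul_add]) fun n => ?_
  refine finsum_induction (fun f : GenW k H →ₗ[k] TDelta k H => f (s • w) = _ * f w) (by simp)
    (fun f g hf hg => by simp only [LinearMap.add_apply, hf, hg, mul_add]) fun hn => ?_
  refine finsum_induction (fun f : GenW k H →ₗ[k] TDelta k H => f (s • w) = _ * f w) (by simp)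
    (fun f g hf hg => by simp only [LinearMap.add_apply, hf, hg, mul_add]) fun a => ?_
  simp only [LinearMap.comp_apply, pathTerm_apply, extW_smul, map_mul, mul_assoc]

theorem StrictAInfinity.deltaGen_op_smul (m : StrictAInfinity k H.Δ) (s : P → k) (w : GenW k H) :
    m.deltaGen (op s • w) =
      m.deltaGen w * BimodTensorAlgebra.ofScalar k (P → k) (GenW k H) s := by
  unfold StrictAInfinity.deltaGen
  refine finsum_induction (fun f : GenW k H →ₗ[k] TDelta k H => f (op s • w) = f w * _) (by simp)
    (fun f g hf hg => by simp only [LinearMap.add_apply, hf, hg, add_mul]) fun n => ?_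
  refine finsum_induction (fun f : GenW k H →ₗ[k] TDelta k H => f (op s • w) = f w * _) (by simp)
    (fun f g hf hg => by simp only [LinearMap.add_apply, hf, hg, add_mul]) fun hn => ?_
  refine finsum_induction (fun f : GenW k H →ₗ[k] TDelta k H => f (op s • w) = f w * _) (by simp)
    (fun f g hf hg => by simp only [LinearMap.add_apply, hf, hg, add_mul]) fun a => ?_
  obtain ⟨n, rfl⟩ : ∃ l, n = l + 1 := ⟨n - 1, by omega⟩
  simp only [LinearMap.comp_apply, pathTerm_apply, extW_op_smul]
  obtain ⟨c, h1, h2⟩ : ∃ c : k, op s • m.b (n + 1) (fun r => arrowElt k H (a r)) =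
      c • m.b (n + 1) (fun r => arrowElt k H (a r)) ∧
      arrowDual k H (a (Fin.last n)) * BimodTensorAlgebra.ofScalar k (P → k) (GenW k H) s =
        c • arrowDual k H (a (Fin.last n)) := by
    rcases h : a (Fin.last n) with b | b
    · refine ⟨s b.src, m.b_op_smul _ s _ b.elt (by simp only [h]; rfl) (b.op_smul_elt s), ?_⟩
      refine (BimodTensorAlgebra.ofBimod_op_smul k (P → k) (GenW k H) _ _).symm.trans ?_
      refine (congrArg _ (?_ : _ = s b.src • (LinearMap.inl k _ _ b.dual : GenW k H))).trans
        (map_smul _ _ _)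
      refine Prod.ext (b.op_smul_dual s) ?_
      simp
    · refine ⟨s b.src, m.b_op_smul _ s _ b.elt.1 (by simp only [h]; rfl)
        (congrArg Subtype.val (b.op_smul_elt s)), ?_⟩
      refine (BimodTensorAlgebra.ofBimod_op_smul k (P → k) (GenW k H) _ _).symm.trans ?_
      refine (congrArg _ (?_ : _ = s b.src • (LinearMap.inr k _ _ b.dual : GenW k H))).trans
        (map_smul _ _ _)
      refine Prod.ext ?_ (b.op_smul_dual s)
      simp
  rw [h1, map_smul, map_smul, smul_mul_assoc, List.ofFn_succ', List.concat_eq_append,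
    List.prod_append, List.prod_singleton, mul_assoc, mul_assoc, h2, mul_smul_comm, mul_smul_comm]

variable (k H) in
/-- Multiplication by `(-1)^d` in degree `d` on the generators. -/
noncomputable def gradeInvol : GenW k H →ₗ[k] GenW k H := LinearMap.prodMap LinearMap.id (-LinearMap.id)

/-- The algebra map `x ↦ [ε x, δ x; 0, x]`, where `ε` is multiplication by `(-1)^d` in degree `d`.
Its multiplicativity is the graded Leibniz rule `δ (x y) = δ x y + ε x δ y`. -/
noncomputable def StrictAInfinity.deltaMatrix (m : StrictAInfinity k H.Δ) :
    TDelta k H →ₐ[k] Matrix (Fin 2) (Fin 2) (TDelta k H) :=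
  BimodTensorAlgebra.lift
    { toFun := fun s => !![BimodTensorAlgebra.ofScalar k (P → k) (GenW k H) s, 0; 0,
        BimodTensorAlgebra.ofScalar k (P → k) (GenW k H) s]
      map_one' := by simp [Matrix.one_fin_two]
      map_mul' := fun s t => by simp
      map_zero' := by ext i j; fin_cases i <;> fin_cases j <;> simp
      map_add' := fun s t => by simp
      commutes' := fun c => by
        rw [AlgHom.commutes]
        ext i j; fin_cases i <;> fin_cases j <;> simp [Matrix.algebraMap_matrix_apply] }
    { toFun := fun w => !![BimodTensorAlgebra.ofBimod k (P → k) (GenW k H) (gradeInvol k H w),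
        m.deltaGen w; 0, BimodTensorAlgebra.ofBimod k (P → k) (GenW k H) w]
      map_add' := fun v w => by simp
      map_smul' := fun c w => by simp }
    (fun s w => by
      have : gradeInvol k H (s • w) = s • gradeInvol k H w := by
        refine Prod.ext rfl ?_
        simp [gradeInvol]
      simp [this, deltaGen_smul, BimodTensorAlgebra.ofBimod_smul])
    (fun s w => by
      have : gradeInvol k H (op s • w) = op s • gradeInvol k H w := by
        refine Prod.ext rfl ?_
        simp [gradeInvol]
      simp [this, deltaGen_op_smul, BimodTensorAlgebra.ofBimod_op_smul])

/-- The differential `δ` of `T(Δ)`: it vanishes on `S`, is `deltaGen` on the generators, and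
satisfies the graded Leibniz rule. -/
noncomputable def StrictAInfinity.delta (m : StrictAInfinity k H.Δ) : TDelta k H →ₗ[k] TDelta k H :=
  Matrix.entryLinearMap k (TDelta k H) (0 : Fin 2) (1 : Fin 2) ∘ₗ m.deltaMatrix.toLinearMap


theorem StrictAInfinity.delta_apply (m : StrictAInfinity k H.Δ) (x : TDelta k H) :
    m.delta x = m.deltaMatrix x 0 1 := rfl

theorem StrictAInfinity.delta_ofScalar (m : StrictAInfinity k H.Δ) (s : P → k) :
    m.delta (BimodTensorAlgebra.ofScalar k (P → k) (GenW k H) s) = 0 := by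
  rw [delta_apply, deltaMatrix, BimodTensorAlgebra.lift_ofScalar]; simp

theorem StrictAInfinity.delta_ofBimod (m : StrictAInfinity k H.Δ) (w : GenW k H) :
    m.delta (BimodTensorAlgebra.ofBimod k (P → k) (GenW k H) w) = m.deltaGen w := by
  rw [delta_apply, deltaMatrix, BimodTensorAlgebra.lift_ofBimod]; simp

end Ditalgebra

section Predicates
variable {k T : Type u} [Field k] [Ring T] [Algebra k T]

/-- The `k`-algebra `T` is freely generated by the subalgebra `R` and the `R`-`R`-subbimodule `W`,
that is, the inclusions exhibit `T` as the tensor algebra of the `R`-`R`-bimodule `W`. -/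
def FreelyGenerated (R : Subalgebra k T) (W : Submodule k T) : Prop :=
  (∀ r ∈ R, ∀ w ∈ W, r * w ∈ W ∧ w * r ∈ W) ∧
  ∀ (C : Type u) [Ring C] [Algebra k C] (f : R →ₐ[k] C) (g : W →ₗ[k] C),
    (∀ (r : R) (w w' : W), (w' : T) = r * w → g w' = f r * g w) →
    (∀ (r : R) (w w' : W), (w' : T) = w * r → g w' = g w * f r) →
    ∃! F : T →ₐ[k] C, (∀ r : R, F r = f r) ∧ ∀ w : W, F w = g w

/-- `(T, δ)` is a weak ditalgebra: `T` is a graded tensor algebra, so that it is the tensor algebra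
of the bimodule `T₁` over `T₀`, and `δ` is a differential: homogeneous of degree one and satisfying
the graded Leibniz rule. -/
structure IsWeakDitalgebra (𝒯 : ℕ → Submodule k T) (δ : T →ₗ[k] T) : Prop where
  graded : SetLike.GradedMonoid 𝒯
  internal : DirectSum.IsInternal 𝒯
  free : ∃ A : Subalgebra k T, Subalgebra.toSubmodule A = 𝒯 0 ∧ FreelyGenerated A (𝒯 1)
  degree : ∀ n, ∀ x ∈ 𝒯 n, δ x ∈ 𝒯 (n + 1)
  leibniz : ∀ n, ∀ x ∈ 𝒯 n, ∀ y, δ (x * y) = δ x * y + (-1) ^ n * (x * δ y)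

/-- `(R, W₀ ⊕ W₁)` is a layer of the weak ditalgebra `(T, δ)`. -/
structure IsLayer (𝒯 : ℕ → Submodule k T) (δ : T →ₗ[k] T) (R : Subalgebra k T)
    (W₀ W₁ : Submodule k T) : Prop where
  scalars_le : Subalgebra.toSubmodule R ≤ 𝒯 0
  zero_le : W₀ ≤ 𝒯 0
  one_le : W₁ ≤ 𝒯 1
  zero_stable : ∀ r ∈ R, ∀ w ∈ W₀, r * w ∈ W₀ ∧ w * r ∈ W₀
  one_stable : ∀ r ∈ R, ∀ w ∈ W₁, r * w ∈ W₁ ∧ w * r ∈ W₁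
  disjoint : Disjoint W₀ W₁
  free : FreelyGenerated R (W₀ ⊔ W₁)
  delta_scalars : ∀ r ∈ R, δ r = 0

/-- `(R, W₀ ⊕ W₁)` is a triangular layer of the weak ditalgebra `(T, δ)`. -/
structure IsTriangularLayer (𝒯 : ℕ → Submodule k T) (δ : T →ₗ[k] T) (R : Subalgebra k T)
    (W₀ W₁ : Submodule k T) : Prop extends IsLayer 𝒯 δ R W₀ W₁ where
  filtration_zero : ∃ (r : ℕ) (F : ℕ → Submodule k T), F 0 = ⊥ ∧ F r = W₀ ∧
    (∀ i < r, F i ≤ F (i + 1)) ∧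
    (∀ i ≤ r, ∀ s ∈ R, ∀ w ∈ F i, s * w ∈ F i ∧ w * s ∈ F i) ∧
    ∀ i < r, (F (i + 1)).map δ ≤
      Subalgebra.toSubmodule (Algebra.adjoin k ((R : Set T) ∪ (F i : Set T))) * W₁ *
        Subalgebra.toSubmodule (Algebra.adjoin k ((R : Set T) ∪ (F i : Set T)))
  filtration_one : ∃ (r : ℕ) (F : ℕ → Submodule k T), F 0 = ⊥ ∧ F r = W₁ ∧
    (∀ i < r, F i ≤ F (i + 1)) ∧
    (∀ i ≤ r, ∀ s ∈ R, ∀ w ∈ F i, s * w ∈ F i ∧ w * s ∈ F i) ∧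
    ∀ i < r, (F (i + 1)).map δ ≤ 𝒯 0 * F i * 𝒯 0 * F i * 𝒯 0

/-- With `A = T₀` and `V = T₁`, the subspace `I` is an ideal of `A` and `(T, δ)` is interlaced with
`I`. -/
structure IsInterlaced (𝒯 : ℕ → Submodule k T) (δ : T →ₗ[k] T) (I : Submodule k T) : Prop where
  le : I ≤ 𝒯 0
  mul_left : 𝒯 0 * I ≤ I
  mul_right : I * 𝒯 0 ≤ I
  delta_ideal : I.map δ ≤ I * 𝒯 1 ⊔ 𝒯 1 * I
  delta_sq_zero : (𝒯 0).map (δ ∘ₗ δ) ≤ I * 𝒯 1 ^ 2 ⊔ 𝒯 1 * I * 𝒯 1 ⊔ 𝒯 1 ^ 2 * I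
  delta_sq_one : (𝒯 1).map (δ ∘ₗ δ) ≤
    I * 𝒯 1 ^ 3 ⊔ 𝒯 1 * I * 𝒯 1 ^ 2 ⊔ 𝒯 1 ^ 2 * I * 𝒯 1 ⊔ 𝒯 1 ^ 3 * I

/-- The ideal `I` of `A = T₀` is triangular with respect to `(T, δ)`. -/
def IsTriangularIdeal (𝒯 : ℕ → Submodule k T) (δ : T →ₗ[k] T) (I : Submodule k T) : Prop :=
  ∃ (t : ℕ) (F : ℕ → Submodule k T), F 0 = ⊥ ∧ F t = I ∧ (∀ i < t, F i ≤ F (i + 1)) ∧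
    ∀ i < t, (F (i + 1)).map δ ≤ 𝒯 0 * F i * 𝒯 1 ⊔ 𝒯 1 * F i * 𝒯 0

/-- The pair `((T, δ), I)` is a triangular interlaced weak ditalgebra. -/
structure IsTriangularInterlacedWeakDitalgebra (𝒯 : ℕ → Submodule k T) (δ : T →ₗ[k] T)
    (I : Submodule k T) : Prop where
  weak : IsWeakDitalgebra 𝒯 δ
  interlaced : IsInterlaced 𝒯 δ I
  layer : ∃ (R : Subalgebra k T) (W₀ W₁ : Submodule k T), IsTriangularLayer 𝒯 δ R W₀ W₁
  ideal : IsTriangularIdeal 𝒯 δ I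
end Predicates

section Construction
variable {k Λ P : Type u} [Field k] [IsAlgClosed k] [Ring Λ] [Algebra k Λ] [Module.Finite k Λ]
  [DecidableEq P] [Fintype P] [Preorder P]

variable (k) (H : HomologicalSystem Λ P)
/-- The copy of `S` in `T(Δ)`. -/
noncomputable def layerS : Subalgebra k (TDelta k H) :=
  (BimodTensorAlgebra.ofScalar k (P → k) (GenW k H)).range

/-- The copy of `D̂(B)₀` in `T(Δ)`. -/
noncomputable def layerW₀ : Submodule k (TDelta k H) := LinearMap.range (ofSolid k H)

/-- The copy of `D̂(J)` in `T(Δ)`. -/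
noncomputable def layerW₁ : Submodule k (TDelta k H) := LinearMap.range (ofDashed k H)

/-- The subalgebra `A(Δ) = T_S(D̂(B)₀)` of `T(Δ)`. -/
noncomputable def algebraA : Subalgebra k (TDelta k H) :=
  Algebra.adjoin k ((layerS k H : Set (TDelta k H)) ∪ (layerW₀ k H : Set (TDelta k H)))

/-- The homogeneous component of degree `d` of `T(Δ)`, where `S` and `D̂(B)₀` have degree zero and
`D̂(J)` has degree one: the span of the products `a₀ ξ₁ a₁ ⋯ ξ_d a_d` with `a_i` in `A(Δ)` and `ξ_i`
in `D̂(J)`. -/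
noncomputable def gradeT (d : ℕ) : Submodule k (TDelta k H) :=
  Subalgebra.toSubmodule (algebraA k H) *
    (layerW₁ k H * Subalgebra.toSubmodule (algebraA k H)) ^ d

variable {k H}
/-- The ideal `I` of `A(Δ)` generated by the image of `β`. -/
noncomputable def StrictAInfinity.idealI (m : StrictAInfinity k H.Δ) : Submodule k (TDelta k H) :=
  Subalgebra.toSubmodule (algebraA k H) * LinearMap.range m.beta *
    Subalgebra.toSubmodule (algebraA k H)

end Construction

end Yoneda

/-!
The pair `(𝒜(Δ), I)` is a cobar construction, and the statement is the translation of the Stasheff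
identities to it, together with a filtration argument.

*Cobar elements.* A functional `f` on the Yoneda algebra `A` defines the element
`cobar f = ∑ f(b_n(x₁, …, x_n)) x₁^* ⋯ x_n^*` of `T(Δ)`, the sum being over all words of length at
least two in the arrows, that is, in a directed basis of `Ext¹(Δ, Δ) ⊕ J`. Since `Ext¹(Δ_i, Δ_j) ≠ 0`
implies `i < j`, a word on which `b_n` does not vanish has a bounded number of letters of degree one
(`solid` letters), and the degree of `b_n` bounds the number of letters in `J` (`dashed` letters), so
that the sum is finite. With left `S`-linear maps to `S` identified with functionals, the values of
`δ` on generators and the values of `β` are cobar elements (`deltaGen_eq`, `beta_eq`).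

*The square of the differential.* The bar operations on arrows take their values in
`J ⊕ Ext¹ ⊕ Ext²` (`bw_elts_zero_mem_radJ`). By the Leibniz rule and the Stasheff identities,
`δ (cobar f)` is, up to sign, the sum of the elements `word l₁ * cobar g * word l₂`, where `g` is the
restriction to `Ext²` of `z ↦ f(b(l₁, z, l₂))` (`delta_cobar`). Here `cobar g` is a value of `β`. As the
words `l₁` and `l₂` contain the number of dashed letters that is determined by the degrees, this gives
the interlacing.

*Triangularity.* On `Extᵈ(Δ, Δ)` consider the weight filtration, in which an element of
`Extᵈ(Δ_i, Δ_j)` lying in the `p`-th step of the filtration by powers of the radical of `End Δ` has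
weight `p + N h`, where `h` is the height difference from `i` to `j` and `N` is so large that the `N`-th
step of the radical filtration vanishes. If `z` has degree `d`, then the component of degree `d` of
`b(l₁, z, l₂)` has a larger weight than `z` (`bw_mid_mem_weightFil`): this component vanishes unless
there is exactly one dashed letter, and then either there is also a solid letter, which raises the
height difference, or `b` is the product with an element of `J`. The annihilators of the weight
filtrations of `Ext¹`, `J` and `Ext²` are the required filtrations of `D̂(B)₀`, `D̂(J)` and of the
image of `β`; for the ideal `I` generated by this image one more step is added.
-/

namespace Yoneda

/-! ### Finiteness of the Yoneda algebra and nilpotency of the radical -/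

section Finiteness
variable {k Λ P : Type u} [Field k] [Ring Λ] [Algebra k Λ] [Module.Finite k Λ]

theorem finite_hom (N M : ModuleCat.{u} Λ) [Module.Finite Λ N] [Module.Finite Λ M] :
    Module.Finite k (N ⟶ M) := by
  let : Module k N := ModuleCat.moduleOfAlgebraModule N
  let : Module k M := ModuleCat.moduleOfAlgebraModule M
  have : IsScalarTower k Λ N := ModuleCat.isScalarTower_of_algebra_moduleCat N
  have : IsScalarTower k Λ M := ModuleCat.isScalarTower_of_algebra_moduleCat M
  have : Module.Finite k N := Module.Finite.trans Λ N
  have : Module.Finite k M := Module.Finite.trans Λ M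
  let F : (N ⟶ M) →ₗ[k] (N →ₗ[k] M) :=
    { toFun := fun f => f.hom.restrictScalars k
      map_add' := fun f g => rfl
      map_smul' := fun c f => rfl }
  refine Module.Finite.of_injective F fun f g h => ?_
  ext x
  exact LinearMap.congr_fun h x

/-- The extension groups between finitely generated modules over a finite-dimensional algebra are
finite-dimensional: a presentation by a free module of finite rank gives a surjection onto
`Extⁿ⁺¹(N, M)` from `Extⁿ(K, M)`, for the kernel `K`. -/
theorem finite_ext (N M : ModuleCat.{u} Λ) [Module.Finite Λ N] [Module.Finite Λ M] (i : ℕ) :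
    Module.Finite k (Ext N M i) := by
  have : IsNoetherianRing Λ := isNoetherian_of_tower k inferInstance
  induction i generalizing N with
  | zero =>
    have := finite_hom (k := k) N M
    exact Module.Finite.equiv (Ext.linearEquiv₀ (R := k) (X := N) (Y := M)).symm
  | succ n ih =>
    obtain ⟨l, f, surjf⟩ := Module.Finite.exists_fin' Λ N
    let f' : ModuleCat.of Λ (Fin l → Λ) →ₗ[Λ] N := f
    let exac := LinearMap.shortExact_shortComplexKer (f := f') surjf
    have := ih f'.shortComplexKer.X₁
    exact Module.Finite.of_surjective (exac.extClass.precompOfLinear k M (add_comm 1 n))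
      (precomp_extClass_surjective_of_projective_X₂ M exac n)

variable [Fintype P]

/-- `End Δ` is finite-dimensional, hence Artinian. The `k`-structures are installed locally, since
`Δ` is only a `Λ`-module. -/
theorem isNilpotent_jacobson_end (k : Type u) [Field k] [Algebra k Λ] [Module.Finite k Λ]
    (Δ : P → ModuleCat.{u} Λ) (hΔ : ∀ i, Module.Finite Λ (Δ i)) :
    IsNilpotent (Ring.jacobson (Module.End Λ (∀ i, Δ i))) := by
  let : Module k (∀ i, Δ i) := Module.compHom _ (algebraMap k Λ)
  have : IsScalarTower k Λ (∀ i, Δ i) := IsScalarTower.of_algebraMap_smul fun _ _ => rfl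
  have : SMulCommClass Λ k (∀ i, Δ i) := ⟨fun r c x => by
    rw [← algebraMap_smul Λ c x, ← algebraMap_smul Λ c (r • x), smul_smul, smul_smul,
      Algebra.commutes]⟩
  have : Module.Finite k (∀ i, Δ i) := Module.Finite.trans Λ _
  have : Module.Finite k (Module.End Λ (∀ i, Δ i)) := by
    refine Module.Finite.of_injective
      ({ toFun := fun f => f.restrictScalars k, map_add' := fun _ _ => rfl,
         map_smul' := fun _ _ => rfl } :
        Module.End Λ (∀ i, Δ i) →ₗ[k] Module.End k (∀ i, Δ i)) fun f g h => ?_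
    ext1 x
    exact LinearMap.congr_fun h x
  have : IsArtinianRing (Module.End Λ (∀ i, Δ i)) := isArtinian_of_tower k inferInstance
  exact IsSemiprimaryRing.isNilpotent

end Finiteness

/-! ### Directed bases and linear functionals -/

section DirectedBases
variable {k : Type u} {P : Type u} [Field k] [DecidableEq P] [Fintype P] {U : Type u}
  [AddCommGroup U] [Module k U] [Module (P → k) U] [Module (P → k)ᵐᵒᵖ U]
  [SMulCommClass (P → k) (P → k)ᵐᵒᵖ U] [IsScalarTower k (P → k) U] [IsScalarTower k (P → k)ᵐᵒᵖ U]

theorem sum_eS : ∑ i : P, eS k i = (1 : P → k) := Finset.univ_sum_single _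

theorem sum_eS_smul (u : U) : ∑ j : P, eS k j • u = u := by
  rw [← Finset.sum_smul, sum_eS, one_smul]

theorem sum_op_eS_smul (u : U) : ∑ i : P, op (eS k i) • u = u := by
  rw [← Finset.sum_smul, ← Finset.op_sum, sum_eS, op_one, one_smul]

theorem sum_cut (u : U) : ∑ i : P, ∑ j : P, cut k U i j u = u := by
  calc ∑ i : P, ∑ j : P, cut k U i j u = ∑ i : P, op (eS k i) • u :=
        Finset.sum_congr rfl fun i _ => sum_eS_smul (k := k) (op (eS k i) • u)
    _ = u := sum_op_eS_smul u

theorem eS_smul_cut (i j : P) (u : U) : eS k j • cut k U i j u = cut k U i j u := by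
  change eS k j • (eS k j • (op (eS k i) • u)) = eS k j • (op (eS k i) • u)
  rw [smul_smul, mul_eS]; simp

theorem smul_cut (i j : P) (s : P → k) (u : U) : s • cut k U i j u = s j • cut k U i j u := by
  conv_lhs => rw [← eS_smul_cut, smul_smul, mul_eS, smul_assoc, eS_smul_cut]

theorem cut_cut (i j i' j' : P) (u : U) :
    cut k U i' j' (cut k U i j u) = if i' = i ∧ j' = j then cut k U i j u else 0 := by
  change eS k j' • (op (eS k i') • cut k U i j u) = _
  rw [op_smul_cut, smul_comm, smul_cut, smul_smul]
  by_cases hi : i = i' <;> by_cases hj : j = j' <;> simp [hi, hj, eq_comm]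

namespace DirIdx

/-- The coordinate functional of a directed basis element. -/
noncomputable def coef (a : DirIdx k (P := P) U) : U →ₗ[k] k :=
  (Module.Basis.ofVectorSpace k (corner k U a.1.1 a.1.2)).coord a.2 ∘ₗ
    (cut k U a.1.1 a.1.2).rangeRestrict

theorem dual_apply (a : DirIdx k (P := P) U) (u : U) : a.dual u = Pi.single a.tgt (a.coef u) := rfl

theorem coef_smul (a : DirIdx k (P := P) U) (s : P → k) (u : U) :
    a.coef (s • u) = s a.tgt * a.coef u := by
  have : (cut k U a.1.1 a.1.2).rangeRestrict (s • u) =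
      s a.tgt • (cut k U a.1.1 a.1.2).rangeRestrict u := Subtype.ext (cut_smul _ _ _ _)
  rw [coef, LinearMap.comp_apply, LinearMap.comp_apply, this, map_smul, smul_eq_mul]

theorem smul_elt (s : P → k) (a : DirIdx k (P := P) U) : s • a.elt = s a.tgt • a.elt := by
  obtain ⟨u, hu⟩ := (Module.Basis.ofVectorSpace k (corner k U a.1.1 a.1.2) a.2).2
  change s • (Module.Basis.ofVectorSpace k (corner k U a.1.1 a.1.2) a.2).1 =
    s a.1.2 • (Module.Basis.ofVectorSpace k (corner k U a.1.1 a.1.2) a.2).1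
  rw [← hu, smul_cut]

theorem eS_smul_elt (a : DirIdx k (P := P) U) : eS k a.tgt • a.elt = a.elt := by
  rw [smul_elt]; simp

theorem op_eS_smul_elt (a : DirIdx k (P := P) U) : op (eS k a.src) • a.elt = a.elt := by
  rw [op_smul_elt]; simp

theorem elt_ne_zero (a : DirIdx k (P := P) U) : a.elt ≠ 0 := fun h =>
  (Module.Basis.ofVectorSpace k (corner k U a.1.1 a.1.2)).ne_zero a.2 (Subtype.ext h)

instance [Module.Finite k U] : Finite (DirIdx k (P := P) U) :=
  have (p : P × P) : Finite (Module.Basis.ofVectorSpaceIndex k (corner k U p.1 p.2)) :=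
    Module.Finite.finite_basis (Module.Basis.ofVectorSpace k (corner k U p.1 p.2))
  inferInstanceAs (Finite (Σ p : P × P, Module.Basis.ofVectorSpaceIndex k (corner k U p.1 p.2)))

/-- A directed basis is a basis. -/
theorem sum_coef [Fintype (DirIdx k (P := P) U)] (u : U) :
    ∑ a : DirIdx k (P := P) U, a.coef u • a.elt = u := by
  classical
  have : ∀ p : P × P, Fintype (Module.Basis.ofVectorSpaceIndex k (corner k U p.1 p.2)) := fun p =>
    have : Finite (Module.Basis.ofVectorSpaceIndex k (corner k U p.1 p.2)) :=
      @Finite.of_injective _ (DirIdx k (P := P) U) _ (fun b => ⟨p, b⟩)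
        fun b b' h => eq_of_heq (Sigma.mk.inj h).2
    Fintype.ofFinite _
  have key := Fintype.sum_sigma
    (fun a : (Σ p : P × P, Module.Basis.ofVectorSpaceIndex k (corner k U p.1 p.2)) =>
      coef (U := U) a u • elt (U := U) a)
  calc ∑ a : DirIdx k (P := P) U, a.coef u • a.elt
      = ∑ p : P × P, ∑ b : Module.Basis.ofVectorSpaceIndex k (corner k U p.1 p.2),
          coef (U := U) ⟨p, b⟩ u • elt (U := U) ⟨p, b⟩ :=
        (@Fintype.sum_equiv _ _ _ (_) (_) _ (Equiv.refl _) _ _ fun _ => rfl).trans key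
    _ = ∑ p : P × P, cut k U p.1 p.2 u := by
        refine Finset.sum_congr rfl fun p _ => ?_
        have := congrArg Subtype.val ((Module.Basis.ofVectorSpace k (corner k U p.1 p.2)).sum_repr
          ((cut k U p.1 p.2).rangeRestrict u))
        rw [Submodule.coe_sum] at this
        exact this
    _ = u := by rw [Fintype.sum_prod_type]; exact sum_cut u

end DirIdx

/-- The sum of the coordinates, `S → k`. -/
noncomputable def sumS : (P → k) →ₗ[k] k := ∑ j, LinearMap.proj j

theorem sumS_apply (s : P → k) : sumS s = ∑ j, s j := by simp [sumS]

theorem sumS_eS_mul (j : P) (s : P → k) : sumS (eS k j * s) = s j := by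
  rw [sumS_apply, Finset.sum_eq_single j] <;> simp +contextual

namespace HatDual

/-- A left `S`-linear map `U → S` is the same as a `k`-linear functional on `U`: the functional
associated with `φ` is `u ↦ ∑ j, φ(u) j`, and `φ(u) j` is its value at `e_j u`. -/
noncomputable def functional : HatDual (P → k) U ≃ₗ[k] (U →ₗ[k] k) where
  toFun φ := sumS ∘ₗ HatDual.toLin φ
  map_add' φ ψ := by ext u; simp [HatDual.toLin]
  map_smul' c φ := by ext u; simp [HatDual.toLin]
  invFun l := (show U →ₗ[P → k] (P → k) from
    { toFun := fun u j => l (eS k j • u)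
      map_add' := fun u v => by ext j; simp
      map_smul' := fun s u => by
        ext j
        rw [smul_smul, mul_comm, mul_eS, smul_assoc, map_smul]; rfl })
  left_inv φ := by
    refine HatDual.ext fun u => funext fun j => ?_
    change sumS (φ (eS k j • u)) = φ u j
    rw [map_smul, smul_eq_mul, sumS_eS_mul]
  right_inv l := by
    ext u
    change sumS (fun j => l (eS k j • u)) = l u
    rw [sumS_apply, ← map_sum, sum_eS_smul]

theorem functional_apply (φ : HatDual (P → k) U) (u : U) : functional φ u = sumS (φ u) := rfl

theorem functional_dual (a : DirIdx k (P := P) U) : functional a.dual = a.coef := by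
  ext u
  rw [functional_apply, DirIdx.dual_apply, sumS_apply]; simp

theorem functional_smul (s : P → k) (φ : HatDual (P → k) U) (u : U) :
    functional (s • φ) u = functional φ (s • u) := by
  rw [functional_apply, functional_apply, map_smul]; rfl

theorem functional_op_smul (s : P → k) (φ : HatDual (P → k) U) (u : U) :
    functional (op s • φ) u = functional φ (op s • u) := rfl

end HatDual
end DirectedBases

/-! ### Sums over words -/

section WordSums
variable {X : Type u} [Fintype X]

/-- The sum of the values of `f` on the words of length `n` in the alphabet `X`. -/
def wsum {M : Type u} [AddCommMonoid M] : ℕ → (List X → M) → M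
  | 0, f => f []
  | n + 1, f => ∑ x, wsum n fun l => f (x :: l)

variable {M N : Type u} [AddCommMonoid M] [AddCommMonoid N]

theorem wsum_succ (n : ℕ) (f : List X → M) : wsum (n + 1) f = ∑ x, wsum n fun l => f (x :: l) := rfl

theorem wsum_congr {n : ℕ} {f g : List X → M} (h : ∀ l, l.length = n → f l = g l) :
    wsum n f = wsum n g := by
  induction n generalizing f g with
  | zero => exact h [] rfl
  | succ n ih => exact Finset.sum_congr rfl fun x _ => ih fun l hl => h (x :: l) (by simp [hl])

theorem wsum_eq_zero {n : ℕ} {f : List X → M} (h : ∀ l, l.length = n → f l = 0) :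
    wsum n f = 0 := by
  induction n generalizing f with
  | zero => exact h [] rfl
  | succ n ih => exact Finset.sum_eq_zero fun x _ => ih fun l hl => h (x :: l) (by simp [hl])

theorem map_wsum {F : Type*} [FunLike F M N] [AddMonoidHomClass F M N] (φ : F) (n : ℕ)
    (f : List X → M) : φ (wsum n f) = wsum n fun l => φ (f l) := by
  induction n generalizing f with
  | zero => rfl
  | succ n ih => rw [wsum_succ, map_sum]; exact Finset.sum_congr rfl fun x _ => ih _

theorem wsum_sum {ι : Type*} (s : Finset ι) (n : ℕ) (f : ι → List X → M) :
    wsum n (fun l => ∑ i ∈ s, f i l) = ∑ i ∈ s, wsum n (f i) := by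
  induction n generalizing f with
  | zero => rfl
  | succ n ih => simp only [wsum_succ, ih]; exact Finset.sum_comm

theorem wsum_add (p q : ℕ) (f : List X → M) :
    wsum (p + q) f = wsum p fun l => wsum q fun l' => f (l ++ l') := by
  induction p generalizing f with
  | zero => simp [wsum]
  | succ p ih =>
    rw [Nat.succ_add, wsum_succ]
    exact Finset.sum_congr rfl fun x _ => ih _

theorem wsum_add_distrib (n : ℕ) (f g : List X → M) :
    wsum n (fun l => f l + g l) = wsum n f + wsum n g := by
  induction n generalizing f g with
  | zero => rfl
  | succ n ih => simp only [wsum_succ, ih, Finset.sum_add_distrib]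

theorem wsum_eq_sum_ofFn (n : ℕ) (f : List X → M) :
    wsum n f = ∑ a : Fin n → X, f (List.ofFn a) := by
  induction n generalizing f with
  | zero => simp [wsum]
  | succ n ih =>
    rw [wsum_succ, ← (Fin.consEquiv fun _ : Fin (n + 1) => X).sum_comp, Fintype.sum_prod_type]
    refine Finset.sum_congr rfl fun x _ => ?_
    rw [ih]
    refine Finset.sum_congr rfl fun a _ => ?_
    simp [Fin.consEquiv, List.ofFn_succ]

theorem wsum_mem {R : Type*} {M : Type u} [Semiring R] [AddCommMonoid M] [Module R M]
    {p : Submodule R M} {n : ℕ}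
    {f : List X → M} (h : ∀ l, l.length = n → f l ∈ p) : wsum n f ∈ p := by
  induction n generalizing f with
  | zero => exact h [] rfl
  | succ n ih => exact sum_mem fun x _ => ih fun l hl => h (x :: l) (by simp [hl])

end WordSums

/-! ### The bar operations on lists -/

section BarOperations
variable {k Λ P : Type u} [Field k] [Ring Λ] [Algebra k Λ] [DecidableEq P]
  {Δ : P → ModuleCat.{u} Λ} (m : StrictAInfinity k Δ)

/-- The operation `m_n` applied to a list of length `n`. -/
noncomputable def StrictAInfinity.mw (l : List (YAlg Δ)) : YAlg Δ :=
  m.m l.length fun i => l.getD i 0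

/-- The bar operation `b_n` applied to a list of length `n`. -/
noncomputable def StrictAInfinity.bw (l : List (YAlg Δ)) : YAlg Δ :=
  m.b l.length fun i => l.getD i 0

theorem StrictAInfinity.m_eq_mw {n : ℕ} (f : Fin n → YAlg Δ) (l : List (YAlg Δ))
    (hn : n = l.length) (h : ∀ i : Fin n, f i = l.getD i 0) : m.m n f = m.mw l := by
  subst hn; exact congrArg _ (funext h)

theorem StrictAInfinity.b_eq_bw {n : ℕ} (f : Fin n → YAlg Δ) (l : List (YAlg Δ))
    (hn : n = l.length) (h : ∀ i : Fin n, f i = l.getD i 0) : m.b n f = m.bw l := by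
  subst hn; exact congrArg _ (funext h)

theorem getD_mid {M : Type*} (l₁ l₂ : List M) (z d : M) (i : ℕ) :
    (l₁ ++ z :: l₂).getD i d = if i < l₁.length then l₁.getD i d
      else if i = l₁.length then z else l₂.getD (i - l₁.length - 1) d := by
  rcases lt_trichotomy i l₁.length with h | h | h
  · rw [if_pos h, List.getD_append _ _ _ _ h]
  · simp [h]
  · have : i - l₁.length = (i - l₁.length - 1) + 1 := by omega
    rw [if_neg (by omega), if_neg (by omega), List.getD_append_right _ _ _ _ (by omega), this,
      List.getD_cons_succ]
    simp

theorem StrictAInfinity.bw_mid (l₁ l₂ : List (YAlg Δ)) (z : YAlg Δ) :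
    m.bw (l₁ ++ z :: l₂) = m.b (l₁.length + 1 + l₂.length) (Function.update
      (fun i => (l₁ ++ 0 :: l₂).getD i 0) ⟨l₁.length, by omega⟩ z) := by
  refine (m.b_eq_bw _ _ (by simp; omega) fun i => ?_).symm
  simp only [Function.update_apply, getD_mid, Fin.ext_iff]
  split_ifs <;> first | rfl | omega

/-- `z ↦ b_n(l₁, z, l₂)`, as a linear map. -/
noncomputable def StrictAInfinity.bwMid (l₁ l₂ : List (YAlg Δ)) : YAlg Δ →ₗ[k] YAlg Δ where
  toFun z := m.bw (l₁ ++ z :: l₂)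
  map_add' y z := by simp only [bw_mid, MultilinearMap.map_update_add]
  map_smul' c z := by simp only [bw_mid, MultilinearMap.map_update_smul, RingHom.id_apply]

theorem StrictAInfinity.bwMid_apply (l₁ l₂ : List (YAlg Δ)) (z : YAlg Δ) :
    m.bwMid l₁ l₂ z = m.bw (l₁ ++ z :: l₂) := rfl

theorem signMap_smul (e : ℕ) (s : P → k) (x : YAlg Δ) :
    signMap (k := k) e (s • x) = s • signMap (k := k) e x := by
  refine DirectSum.ext_component k fun d => ?_
  change ((-1 : k) ^ (e * d)) • (s • x d) = s • ((-1 : k) ^ (e * d)) • x d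
  exact smul_comm _ _ _

theorem signMap_op_smul (e : ℕ) (s : P → k) (x : YAlg Δ) :
    signMap (k := k) e (op s • x) = op s • signMap (k := k) e x := by
  refine DirectSum.ext_component k fun d => ?_
  change ((-1 : k) ^ (e * d)) • (op s • x d) = op s • ((-1 : k) ^ (e * d)) • x d
  exact smul_comm _ _ _

theorem StrictAInfinity.b_update {n : ℕ} (a : Fin n → YAlg Δ) (i : Fin n) (z : YAlg Δ) :
    m.b n (Function.update a i z) = m.m n (Function.update
      (fun r : Fin n => signMap (k := k) (n - 1 - r) (a r)) i (signMap (k := k) (n - 1 - i) z)) := by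
  rw [StrictAInfinity.b, MultilinearMap.compLinearMap_apply]
  exact congrArg _ (funext fun r => Function.apply_update
    (fun r : Fin n => ⇑(signMap (k := k) (Δ := Δ) (n - 1 - r))) a i z r)

theorem StrictAInfinity.bw_smul_cons (s : P → k) (x : YAlg Δ) (l : List (YAlg Δ)) :
    m.bw (s • x :: l) = s • m.bw (x :: l) := by
  have h (z : YAlg Δ) : m.bw (z :: l) =
      m.b (l.length + 1) (Function.update (fun i => (x :: l).getD i 0) 0 z) := by
    refine (m.b_eq_bw _ _ (by simp) fun i => ?_).symm
    refine Fin.cases ?_ (fun j => ?_) i <;> simp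
  rw [h, h x, b_update, b_update, signMap_smul, ← m.smul_left, Function.update_idem]
  simp

theorem StrictAInfinity.bw_concat_op_smul (s : P → k) (x : YAlg Δ) (l : List (YAlg Δ)) :
    m.bw (l ++ [op s • x]) = op s • m.bw (l ++ [x]) := by
  have h (z : YAlg Δ) : m.bw (l ++ [z]) =
      m.b (l.length + 1) (Function.update (fun i => (l ++ [x]).getD i 0) (Fin.last _) z) := by
    refine (m.b_eq_bw _ _ (by simp) fun i => ?_).symm
    refine Fin.lastCases ?_ (fun j => ?_) i
    · simp
    · simp [List.getElem?_append]
  rw [h, h x, b_update, b_update, signMap_op_smul, ← m.smul_right, Function.update_idem]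
  simp

theorem StrictAInfinity.bw_balanced (s : P → k) (l₁ l₂ : List (YAlg Δ)) (x y : YAlg Δ) :
    m.bw (l₁ ++ op s • x :: y :: l₂) = m.bw (l₁ ++ x :: s • y :: l₂) := by
  have hn : l₁.length < l₁.length + 1 + l₂.length := by omega
  let i : Fin (l₁.length + 1 + l₂.length) := ⟨l₁.length, hn⟩
  let a : Fin (l₁.length + 1 + l₂.length + 1) → YAlg Δ :=
    fun r => (l₁ ++ x :: y :: l₂).getD r 0
  have h1 : m.bw (l₁ ++ op s • x :: y :: l₂) = m.b _ (Function.update a i.castSucc (op s • x)) := by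
    refine (m.b_eq_bw _ _ (by simp; omega) fun r => ?_).symm
    simp only [Function.update_apply, getD_mid, Fin.ext_iff, a, i]
    split_ifs <;> first | rfl | (simp at *; omega)
  have h2 : m.bw (l₁ ++ x :: s • y :: l₂) = m.b _ (Function.update a i.succ (s • y)) := by
    refine (m.b_eq_bw _ _ (by simp; omega) fun r => ?_).symm
    simp only [Function.update_apply, getD_mid, Fin.ext_iff, a, i]
    by_cases hr : (r : ℕ) = l₁.length + 1
    · rw [if_pos (by simp [hr]), if_neg (by omega), if_neg (by omega), hr]; simp
    · rw [if_neg (by simpa using hr)]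
      split_ifs
      · rfl
      · rfl
      · have : (r : ℕ) - l₁.length - 1 = ((r : ℕ) - l₁.length - 2) + 1 := by omega
        rw [this]; rfl
  have ha1 : a i.castSucc = x := by simp [a, i]
  have ha2 : a i.succ = y := by simp [a, i]
  rw [h1, h2, b_update, b_update, signMap_smul, signMap_op_smul]
  refine Eq.trans ?_ ((m.balanced _ s (fun r => signMap (k := k)
    (l₁.length + 1 + l₂.length + 1 - 1 - r) (a r)) i).trans ?_)
  · rw [ha1]
  · rw [ha2]

end BarOperations

/-! ### The Stasheff identities for the bar operations -/

section Stasheff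
variable {k Λ P : Type u} [Field k] [Ring Λ] [Algebra k Λ] [DecidableEq P]

/-- A homogeneous element of the Yoneda algebra together with its degree. -/
abbrev HomEl (Δ : P → ModuleCat.{u} Λ) : Type u := Σ d, YExt Δ d

variable {Δ : P → ModuleCat.{u} Λ}

/-- The underlying element of the Yoneda algebra. -/
noncomputable def HomEl.val (z : HomEl Δ) : YAlg Δ := homog z.2

/-- The sum of the degrees of the entries. -/
def degSum (l : List (HomEl Δ)) : ℕ := (l.map Sigma.fst).sum

@[simp] theorem degSum_nil : degSum ([] : List (HomEl Δ)) = 0 := rfl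
@[simp] theorem degSum_cons (z : HomEl Δ) (l : List (HomEl Δ)) :
    degSum (z :: l) = z.1 + degSum l := rfl
@[simp] theorem degSum_append (l l' : List (HomEl Δ)) : degSum (l ++ l') = degSum l + degSum l' := by
  simp [degSum]

/-- The exponent of the Koszul sign of `σ^{⊗n}(z₁ ⊗ ⋯ ⊗ zₙ)`: every entry contributes its degree
times the number of entries to its right. -/
def signExp : List (HomEl Δ) → ℕ
  | [] => 0
  | z :: l => l.length * z.1 + signExp l

theorem signExp_append (l l' : List (HomEl Δ)) :
    signExp (l ++ l') = signExp l + degSum l * l'.length + signExp l' := by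
  induction l with
  | nil => simp [signExp]
  | cons z l ih => simp only [List.cons_append, signExp, ih, List.length_append, degSum_cons]; ring

variable (m : StrictAInfinity k Δ)

theorem HomEl.getD_map_val (l : List (HomEl Δ)) (i : ℕ) :
    (l.map HomEl.val).getD i 0 = homog (l.getD i ⟨0, 0⟩).2 := by
  have : (0 : YAlg Δ) = HomEl.val ⟨0, 0⟩ := (map_zero _).symm
  rw [this, List.getD_map]; rfl

theorem prod_sign (l : List (HomEl Δ)) :
    ∏ i : Fin l.length, (-1 : k) ^ ((l.length - 1 - i) * (l.getD i ⟨0, 0⟩).1) =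
      (-1) ^ signExp l := by
  induction l with
  | nil => simp [signExp]
  | cons z l ih =>
    rw [List.length_cons, Fin.prod_univ_succ, signExp, pow_add, ← ih]
    congr 1
    refine Finset.prod_congr rfl fun i _ => ?_
    rw [Fin.val_succ, List.getD_cons_succ]
    congr 2; omega

/-- On homogeneous elements `b_n` is `m_n` up to the Koszul sign. -/
theorem StrictAInfinity.bw_map_val (l : List (HomEl Δ)) :
    m.bw (l.map HomEl.val) = (-1 : k) ^ signExp l • m.mw (l.map HomEl.val) := by
  have h1 : m.mw (l.map HomEl.val) = m.m l.length fun i => homog (l.getD i ⟨0, 0⟩).2 :=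
    (m.m_eq_mw _ _ (by simp) fun i => (HomEl.getD_map_val l i).symm).symm
  have h2 : m.bw (l.map HomEl.val) = m.b l.length fun i => homog (l.getD i ⟨0, 0⟩).2 :=
    (m.b_eq_bw _ _ (by simp) fun i => (HomEl.getD_map_val l i).symm).symm
  rw [h1, h2, ← prod_sign, ← MultilinearMap.map_smul_univ, StrictAInfinity.b,
    MultilinearMap.compLinearMap_apply]
  exact congrArg _ (funext fun i => signMap_homog _ _ _)

theorem StrictAInfinity.mw_apply_eq_zero (l : List (HomEl Δ)) (hl : l ≠ []) (e : ℕ)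
    (h : e + l.length ≠ degSum l + 2) : m.mw (l.map HomEl.val) e = 0 := by
  obtain ⟨n, hn⟩ : ∃ n, l.length = n + 1 := Nat.exists_eq_succ_of_ne_zero (by simpa using hl)
  rw [← m.m_eq_mw (n := n + 1) (fun r => homog (l.getD r ⟨0, 0⟩).2) _ (by simp [hn])
    fun i => (HomEl.getD_map_val l i).symm]
  refine m.degree n (fun r => (l.getD r ⟨0, 0⟩).1) (fun r => (l.getD r ⟨0, 0⟩).2) e fun he => h ?_
  have : degSum l = ∑ r : Fin (n + 1), (l.getD r ⟨0, 0⟩).1 := by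
    rw [← hn, degSum]
    conv_lhs => rw [← List.ofFn_getElem (xs := l), List.map_ofFn, List.sum_ofFn]
    exact Finset.sum_congr rfl fun i _ => by simp
  rw [this]
  zify
  rw [hn]; push_cast; linarith

theorem StrictAInfinity.bw_apply_eq_zero (l : List (HomEl Δ)) (hl : l ≠ []) (e : ℕ)
    (h : e + l.length ≠ degSum l + 2) : m.bw (l.map HomEl.val) e = 0 := by
  rw [bw_map_val, DirectSum.smul_apply, m.mw_apply_eq_zero l hl e h, smul_zero]

/-- On homogeneous elements `b_n` has homogeneous values, and vanishes if its degree is negative. -/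
theorem StrictAInfinity.mw_eq_zero_or (l : List (HomEl Δ)) (hl : l ≠ []) :
    m.mw (l.map HomEl.val) = 0 ∨
      ∃ z : HomEl Δ, z.1 + l.length = degSum l + 2 ∧ m.mw (l.map HomEl.val) = z.val := by
  by_cases h : l.length ≤ degSum l + 2
  · refine Or.inr ⟨⟨degSum l + 2 - l.length, m.mw (l.map HomEl.val) _⟩, by
      change degSum l + 2 - l.length + l.length = _; omega, ?_⟩
    refine DirectSum.ext_component k fun e => ?_
    change m.mw (l.map HomEl.val) e =
      (DirectSum.of (YExt Δ) (degSum l + 2 - l.length) (m.mw (l.map HomEl.val) _)) e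
    by_cases he : degSum l + 2 - l.length = e
    · subst he; rw [DirectSum.of_eq_same]
    · rw [DirectSum.of_eq_of_ne _ _ _ (Ne.symm he), m.mw_apply_eq_zero l hl e (by omega)]
  · refine Or.inl (DirectSum.ext_component k fun e => ?_)
    exact m.mw_apply_eq_zero l hl e (by omega)

theorem neg_one_pow_eq_of_zmod {a b : ℕ} (h : (a : ZMod 2) = b) : (-1 : k) ^ a = (-1) ^ b := by
  rw [neg_one_pow_eq_pow_mod_two, neg_one_pow_eq_pow_mod_two (n := b),
    (ZMod.natCast_eq_natCast_iff' a b 2).1 h]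

/-- The Stasheff identities in terms of the bar operations: the signs reduce to the Koszul sign of
moving an inner operation of degree one past the entries on its left. -/
theorem StrictAInfinity.stasheff_bw (L : List (HomEl Δ)) (hL : L ≠ []) :
    ∑ r ∈ Finset.range L.length, ∑ s ∈ Finset.Icc 1 (L.length - r),
      (-1 : k) ^ (degSum (L.take r) + r) • m.bw ((L.take r).map HomEl.val ++
        m.bw (((L.drop r).take s).map HomEl.val) :: (L.drop (r + s)).map HomEl.val) = 0 := by
  have key := congrArg (fun z => (-1 : k) ^ signExp L • z)
    (m.stasheff L.length (List.length_pos_iff.2 hL)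
    (fun r => (L.getD r ⟨0, 0⟩).1) (fun r => (L.getD r ⟨0, 0⟩).2))
  rw [smul_zero, Finset.smul_sum] at key
  rw [← key]
  refine Finset.sum_congr rfl fun r hr => ?_
  rw [Finset.smul_sum]
  refine Finset.sum_congr rfl fun s hs => ?_
  rw [Finset.mem_range] at hr
  rw [Finset.mem_Icc] at hs
  obtain ⟨l₁, l', l₂, rfl, rfl, rfl⟩ : ∃ l₁ l' l₂, L = l₁ ++ l' ++ l₂ ∧ r = l₁.length ∧
      s = l'.length :=
    ⟨L.take r, (L.drop r).take s, L.drop (r + s), by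
      rw [List.append_assoc, ← List.drop_drop, List.take_append_drop, List.take_append_drop], by
      simp; omega, by simp; omega⟩
  have e1 : (l₁ ++ l' ++ l₂).take l₁.length = l₁ := by simp
  have e2 : ((l₁ ++ l' ++ l₂).drop l₁.length).take l'.length = l' := by simp
  have e3 : (l₁ ++ l' ++ l₂).drop (l₁.length + l'.length) = l₂ := by
    rw [← List.length_append]; simp
  have e4 : (l₁ ++ l' ++ l₂).length - l₁.length - l'.length = l₂.length := by simp
  have hl' : l' ≠ [] := by rintro rfl; simp at hs
  have e5 : ∑ i ∈ Finset.range l₁.length, ((l₁ ++ l' ++ l₂).getD i ⟨0, 0⟩).1 = degSum l₁ := by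
    rw [degSum]
    conv_rhs => rw [← List.ofFn_getElem (xs := l₁), List.map_ofFn, List.sum_ofFn]
    rw [Finset.sum_range]
    refine Finset.sum_congr rfl fun i _ => ?_
    rw [List.getD_eq_getElem _ _ (by simp; omega)]
    simp
  rw [e1, e2, e3, e4, e5]
  have inner : m.m l'.length (fun j => homog ((l₁ ++ l' ++ l₂).getD (l₁.length + j) ⟨0, 0⟩).2) =
      m.mw (l'.map HomEl.val) := by
    refine m.m_eq_mw _ _ (by simp) fun j => ?_
    rw [HomEl.getD_map_val, List.append_assoc, List.getD_append_right _ _ _ _ (by omega),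
      List.getD_append _ _ _ _ (by omega), Nat.add_sub_cancel_left]
  have outer : m.m (l₁.length + 1 + l₂.length) (fun i =>
      if (i : ℕ) < l₁.length then homog ((l₁ ++ l' ++ l₂).getD i ⟨0, 0⟩).2
      else if (i : ℕ) = l₁.length then
        m.m l'.length (fun j => homog ((l₁ ++ l' ++ l₂).getD (l₁.length + j) ⟨0, 0⟩).2)
      else homog ((l₁ ++ l' ++ l₂).getD (i + l'.length - 1) ⟨0, 0⟩).2) =
      m.mw (l₁.map HomEl.val ++ m.mw (l'.map HomEl.val) :: l₂.map HomEl.val) := by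
    refine m.m_eq_mw _ _ (by simp; omega) fun i => ?_
    rw [getD_mid, inner, List.length_map]
    split_ifs with h1 h2
    · rw [HomEl.getD_map_val, List.append_assoc, List.getD_append _ _ _ _ h1]
    · rfl
    · rw [HomEl.getD_map_val, List.getD_append_right _ _ _ _ (by simp; omega)]
      have : (i : ℕ) + l'.length - 1 - (l₁ ++ l').length = i - l₁.length - 1 := by simp; omega
      rw [this]
  rw [outer, bw_map_val]
  rcases m.mw_eq_zero_or l' hl' with h0 | ⟨z, hz, h0⟩
  · rw [h0, smul_zero, ← bwMid_apply, map_zero, smul_zero]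
    have : m.mw (l₁.map HomEl.val ++ 0 :: l₂.map HomEl.val) = 0 := by
      refine (m.m _).map_coord_zero ⟨l₁.length, by simp⟩ ?_
      simp
    rw [this, smul_zero, smul_zero]
  · rw [← bwMid_apply, map_smul, bwMid_apply, h0]
    have : l₁.map HomEl.val ++ z.val :: l₂.map HomEl.val = (l₁ ++ z :: l₂).map HomEl.val := by simp
    rw [this, bw_map_val, smul_smul, smul_smul, smul_smul, ← pow_add, ← pow_add, ← pow_add]
    congr 1
    refine neg_one_pow_eq_of_zmod ?_
    have hz' : (z.1 : ZMod 2) + l'.length = degSum l' + 2 := by exact_mod_cast congrArg _ hz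
    have h2 : (2 : ZMod 2) = 0 := rfl
    simp only [signExp_append, signExp, degSum_append, List.length_cons]
    push_cast
    linear_combination (l₂.length : ZMod 2) * hz' + (degSum l₁ - degSum l₁ * l'.length
      - (l₂.length : ZMod 2) * l'.length + l₂.length) * h2

end Stasheff

/-! ### Arrows and composable words -/

section ExtCorners
variable {k Λ P : Type u} [Field k] [Ring Λ] [Algebra k Λ] [DecidableEq P]
  {Δ : P → ModuleCat.{u} Λ}

theorem act_single (i : P) : act Δ (eS k i) =
    (ModuleCat.ofHom (LinearMap.proj i) : tot Δ ⟶ Δ i) ≫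
      ModuleCat.ofHom (LinearMap.single Λ (fun i => Δ i) i) := by
  refine hom_tot_ext fun x l => ?_
  rw [act_apply]
  change algebraMap k Λ ((Pi.single i (1 : k) : P → k) l) • x l = (Pi.single i (x i) : ∀ i, Δ i) l
  rcases eq_or_ne l i with rfl | h
  · simp
  · simp [h]

/-- Composing an extension class of `X` with endomorphisms that factor through `A` and `B` passes
through `Extⁿ(A, B)`. -/
theorem ext_comp_eq_zero {n : ℕ} {X A B : ModuleCat.{u} Λ} [Subsingleton (Ext A B n)] (p : X ⟶ A)
    (i : A ⟶ X) (q : X ⟶ B) (j : B ⟶ X) (z : Ext X X n) :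
    Ext.comp (Ext.comp (Ext.mk₀ (p ≫ i)) z (zero_add n)) (Ext.mk₀ (q ≫ j)) (add_zero n) = 0 := by
  have : Ext.comp (Ext.comp (Ext.mk₀ i) z (zero_add n)) (Ext.mk₀ q) (add_zero n) = 0 :=
    Subsingleton.elim _ _
  calc _ = Ext.comp (Ext.mk₀ p) (Ext.comp (Ext.comp (Ext.comp (Ext.mk₀ i) z (zero_add n))
        (Ext.mk₀ q) (add_zero n)) (Ext.mk₀ j) (add_zero n)) (zero_add n) := by
        rw [← Ext.mk₀_comp_mk₀, ← Ext.mk₀_comp_mk₀]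
        simp only [Ext.comp_assoc_of_second_deg_zero, Ext.comp_assoc_of_third_deg_zero]
    _ = 0 := by rw [this, Ext.zero_comp, Ext.comp_zero]

theorem nontrivial_ext_of_cut_ne_zero {n : ℕ} (i j : P) (z : YExt Δ n)
    (h : cut k (YExt Δ n) i j z ≠ 0) : Nontrivial (Ext (Δ i) (Δ j) n) := by
  by_contra hn
  rw [not_nontrivial_iff_subsingleton] at hn
  refine h ?_
  have h1 := ext_comp_eq_zero (ModuleCat.ofHom (LinearMap.proj i) : tot Δ ⟶ Δ i)
    (ModuleCat.ofHom (LinearMap.single Λ (fun i => Δ i) i))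
    (ModuleCat.ofHom (LinearMap.proj j) : tot Δ ⟶ Δ j)
    (ModuleCat.ofHom (LinearMap.single Λ (fun i => Δ i) j)) z
  rw [← act_single (k := k), ← act_single (k := k)] at h1
  exact h1

theorem smul_scalarS (s c : P → k) : s • scalarS k Δ c = scalarS k Δ (s * c) := by
  apply YExt.toEnd.injective
  rw [YExt.toEnd_smul, toEnd_scalarS, toEnd_scalarS]
  refine LinearMap.ext fun x => funext fun i => ?_
  change algebraMap k Λ (s i) • algebraMap k Λ (c i) • x i = algebraMap k Λ (s i * c i) • x i
  rw [map_mul, mul_smul]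

theorem toEnd_mul (x y : YExt Δ 0) : YExt.toEnd (x.mul y) = YExt.toEnd x * YExt.toEnd y := by
  conv_lhs => rw [← YExt.mk₀_toEnd x, ← YExt.mk₀_toEnd y]
  exact (congrArg YExt.toEnd (Ext.mk₀_comp_mk₀ _ _)).trans (YExt.toEnd_mk₀ _)

theorem smul_homog_S {d : ℕ} (s : P → k) (x : YExt Δ d) : s • homog x = homog (s • x) :=
  ((DirectSum.lof (P → k) ℕ (YExt Δ) d).map_smul s x).symm

end ExtCorners

section Arrows
variable (k : Type u) {Λ P : Type u} [Field k] [Ring Λ] [Algebra k Λ] [DecidableEq P] [Preorder P]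
  [Fintype P] (H : HomologicalSystem Λ P)

/-- The alphabet: a directed basis of `B₀ ⊕ J`. The letters from `B₀` are solid, those from `J`
are dashed. -/
abbrev Arrow : Type u := SolidIdx k H ⊕ DashedIdx k H

variable {k H}
namespace Arrow

/-- The source of an arrow. -/
noncomputable def src : Arrow k H → P
  | .inl a => DirIdx.src a
  | .inr a => DirIdx.src a

/-- The target of an arrow. -/
noncomputable def tgt : Arrow k H → P
  | .inl a => DirIdx.tgt a
  | .inr a => DirIdx.tgt a

/-- The degree of the dual of an arrow in `T(Δ)`. -/
noncomputable def deg : Arrow k H → ℕ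
  | .inl _ => 0
  | .inr _ => 1

/-- An arrow as a homogeneous element of the Yoneda algebra. -/
noncomputable def hom : Arrow k H → HomEl H.Δ
  | .inl a => ⟨1, a.elt⟩
  | .inr a => ⟨0, a.elt.1⟩

theorem val_hom (x : Arrow k H) : x.hom.val = arrowElt k H x := by
  rcases x with a | a <;> rfl

theorem fst_hom_add_deg (x : Arrow k H) : x.hom.1 + x.deg = 1 := by
  rcases x with a | a <;> rfl

theorem eS_smul_elt (x : Arrow k H) : eS k x.tgt • arrowElt k H x = arrowElt k H x := by
  rcases x with a | a
  · exact (smul_homog_S _ _).trans (congrArg homog a.eS_smul_elt)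
  · exact (smul_homog_S _ _).trans (congrArg (fun z => homog (Subtype.val z)) a.eS_smul_elt)

theorem op_eS_smul_elt (x : Arrow k H) : op (eS k x.src) • arrowElt k H x = arrowElt k H x := by
  rcases x with a | a
  · exact (op_smul_homog _ _).trans (congrArg homog a.op_eS_smul_elt)
  · exact (op_smul_homog _ _).trans (congrArg (fun z => homog (Subtype.val z)) a.op_eS_smul_elt)

end Arrow

/-- A strictly monotone function from the preordered set `P` to the natural numbers: the number of
elements strictly below `i`. -/
noncomputable def height (i : P) : ℕ := by
  classical exact (Finset.univ.filter fun l => l < i).card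

theorem height_mono {i j : P} (h : i ≤ j) : height i ≤ height j := by
  classical
  refine Finset.card_le_card fun l hl => ?_
  simp only [Finset.mem_filter, Finset.mem_univ, true_and] at hl ⊢
  exact hl.trans_le h

theorem height_strictMono {i j : P} (h : i < j) : height i < height j := by
  classical
  refine Finset.card_lt_card (Finset.ssubset_iff_subset_ne.2 ⟨fun l hl => ?_, fun he => ?_⟩)
  · simp only [Finset.mem_filter, Finset.mem_univ, true_and] at hl ⊢
    exact hl.trans h
  · have : i ∈ Finset.univ.filter fun l => l < i := by rw [he]; simpa using h
    simp at this

theorem height_lt_card (i : P) : height i < Fintype.card P := by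
  classical
  refine (Finset.card_lt_card (Finset.filter_ssubset.2 ⟨i, Finset.mem_univ _, lt_irrefl i⟩))

theorem Arrow.height_src_add_le (x : Arrow k H) :
    height x.src + x.hom.1 ≤ height x.tgt := by
  rcases x with a | a
  · have h : cut k (YExt H.Δ 1) a.src a.tgt a.elt ≠ 0 := by
      change eS k a.tgt • (op (eS k a.src) • a.elt) ≠ 0
      rw [a.op_eS_smul_elt, a.eS_smul_elt]
      exact a.elt_ne_zero
    have := H.lt_of_ext _ _ (nontrivial_ext_of_cut_ne_zero a.src a.tgt a.elt h)
    exact height_strictMono (lt_iff_le_not_ge.2 this)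
  · have h : cut k (YExt H.Δ 0) a.src a.tgt a.elt.1 ≠ 0 := by
      change (eS k a.tgt • (op (eS k a.src) • a.elt) : radJ k (Δ := H.Δ)).1 ≠ 0
      rw [a.op_eS_smul_elt, a.eS_smul_elt]
      exact fun h => a.elt_ne_zero (Subtype.ext h)
    have := nontrivial_ext_of_cut_ne_zero a.src a.tgt a.elt.1 h
    have := H.le_of_hom _ _ ((Ext.addEquiv₀ (X := H.Δ a.src) (Y := H.Δ a.tgt)).symm.nontrivial)
    exact height_mono this

variable (k H) in
/-- Two consecutive letters of a composable word. -/
def Composable (x y : Arrow k H) : Prop := x.src = y.tgt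

/-- The number of dashed letters of a word. -/
noncomputable def dashCount (l : List (Arrow k H)) : ℕ := (l.map Arrow.deg).sum

/-- The number of solid letters of a word. -/
noncomputable def solidCount (l : List (Arrow k H)) : ℕ := degSum (l.map Arrow.hom)

@[simp] theorem dashCount_nil : dashCount ([] : List (Arrow k H)) = 0 := rfl
@[simp] theorem dashCount_cons (x : Arrow k H) (l) : dashCount (x :: l) = x.deg + dashCount l := rfl
@[simp] theorem solidCount_nil : solidCount ([] : List (Arrow k H)) = 0 := rfl
@[simp] theorem solidCount_cons (x : Arrow k H) (l) :
    solidCount (x :: l) = x.hom.1 + solidCount l := rfl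

theorem solidCount_add_dashCount (l : List (Arrow k H)) :
    solidCount l + dashCount l = l.length := by
  induction l with
  | nil => rfl
  | cons x l ih => rw [solidCount_cons, dashCount_cons, List.length_cons, ← ih,
      ← x.fst_hom_add_deg]; ring

theorem height_getLast_add_le (x : Arrow k H) (l : List (Arrow k H))
    (h : (x :: l).IsChain (Composable k H)) :
    height ((x :: l).getLast (by simp)).src + solidCount (x :: l) ≤ height x.tgt := by
  induction l generalizing x with
  | nil => simpa using x.height_src_add_le
  | cons y l ih =>
    rw [List.isChain_cons_cons] at h
    have h1 := ih y h.2
    have h2 := x.height_src_add_le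
    rw [show x.src = y.tgt from h.1] at h2
    rw [List.getLast_cons (by simp), solidCount_cons]
    omega

theorem solidCount_le_card (l : List (Arrow k H)) (h : l.IsChain (Composable k H)) :
    solidCount l ≤ Fintype.card P := by
  rcases l with _ | ⟨x, l⟩
  · simp
  · have := height_getLast_add_le x l h
    have := height_lt_card x.tgt
    omega

end Arrows

section BarOnArrows
variable {k Λ P : Type u} [Field k] [Ring Λ] [Algebra k Λ] [DecidableEq P] [Preorder P] [Fintype P]
  {H : HomologicalSystem Λ P} (m : StrictAInfinity k H.Δ)

/-- The elements of the Yoneda algebra listed by a word. -/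
noncomputable abbrev elts (l : List (Arrow k H)) : List (YAlg H.Δ) := l.map (arrowElt k H)

theorem map_val_map_hom (l : List (Arrow k H)) : (l.map Arrow.hom).map HomEl.val = elts l := by
  simp [Arrow.val_hom]

/-- The bar operations are balanced over `S`, so they vanish on words with adjacent letters that do not
compose. -/
theorem StrictAInfinity.bw_eq_zero_of_ne {Δ : P → ModuleCat.{u} Λ} (m : StrictAInfinity k Δ)
    (l₁ l₂ : List (YAlg Δ)) {x y : YAlg Δ} {i j : P} (hij : i ≠ j) (hx : op (eS k i) • x = x)
    (hy : eS k j • y = y) : m.bw (l₁ ++ x :: y :: l₂) = 0 := by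
  have h0 : eS k i • y = 0 := by rw [← hy, smul_smul, mul_eS]; simp [hij]
  have : l₁ ++ x :: (0 : YAlg Δ) :: l₂ = (l₁ ++ [x]) ++ 0 :: l₂ := by simp
  rw [← hx, bw_balanced, h0, this, ← bwMid_apply, map_zero]

theorem StrictAInfinity.isChain_of_bw_ne_zero (l₁ l₂ : List (YAlg H.Δ)) (l : List (Arrow k H))
    (h : m.bw (l₁ ++ elts l ++ l₂) ≠ 0) : l.IsChain (Composable k H) := by
  rw [List.isChain_iff_forall_rel_of_append_cons_cons]
  rintro x y l₃ l₄ rfl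
  by_contra hxy
  refine h ?_
  have : l₁ ++ elts (l₃ ++ x :: y :: l₄) ++ l₂ =
    (l₁ ++ elts l₃) ++ arrowElt k H x :: arrowElt k H y :: (elts l₄ ++ l₂) := by simp
  rw [this]
  exact m.bw_eq_zero_of_ne _ _ hxy x.op_eS_smul_elt y.eS_smul_elt

/-- By degrees, the value on a word of arrows lives in degree two minus the number of dashed letters. -/
theorem StrictAInfinity.bw_elts_apply (l : List (Arrow k H)) (hl : l ≠ []) (e : ℕ)
    (h : e + dashCount l ≠ 2) : m.bw (elts l) e = 0 := by
  rw [← map_val_map_hom]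
  refine m.bw_apply_eq_zero _ (by simpa using hl) e fun he => h ?_
  have := solidCount_add_dashCount l
  rw [List.length_map, ← this] at he
  change _ = solidCount l + 2 at he
  omega

theorem StrictAInfinity.bw_mid_apply (l₁ l₂ : List (Arrow k H)) (z : HomEl H.Δ) (e : ℕ)
    (h : e + dashCount l₁ + dashCount l₂ ≠ z.1 + 1) :
    m.bw (elts l₁ ++ z.val :: elts l₂) e = 0 := by
  have : elts l₁ ++ z.val :: elts l₂ = (l₁.map Arrow.hom ++ z :: l₂.map Arrow.hom).map HomEl.val := by
    rw [← map_val_map_hom, ← map_val_map_hom]; simp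
  rw [this]
  refine m.bw_apply_eq_zero _ (by simp) e fun he => h ?_
  have h1 := solidCount_add_dashCount l₁
  have h2 := solidCount_add_dashCount l₂
  simp only [List.length_append, List.length_cons, List.length_map, ← h1, ← h2, degSum_append,
    degSum_cons] at he
  change _ = solidCount l₁ + (_ + solidCount l₂) + 2 at he
  omega

theorem StrictAInfinity.bw_elts_eq_zero_or (l : List (Arrow k H)) (hl : l ≠ []) :
    m.bw (elts l) = 0 ∨ ∃ z : HomEl H.Δ, z.1 + dashCount l = 2 ∧ m.bw (elts l) = z.val := by
  by_cases h : dashCount l ≤ 2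
  · refine Or.inr ⟨⟨2 - dashCount l, m.bw (elts l) _⟩, by
      change 2 - dashCount l + dashCount l = _; omega, ?_⟩
    refine DirectSum.ext_component k fun e => ?_
    change m.bw (elts l) e = (DirectSum.of (YExt H.Δ) (2 - dashCount l) (m.bw (elts l) _)) e
    by_cases he : 2 - dashCount l = e
    · subst he; rw [DirectSum.of_eq_same]
    · rw [DirectSum.of_eq_of_ne _ _ _ (Ne.symm he), m.bw_elts_apply l hl e (by omega)]
  · refine Or.inl (DirectSum.ext_component k fun e => ?_)
    exact m.bw_elts_apply l hl e (by omega)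

/-- A non-vanishing word has at most two dashed letters, and its solid letters raise the height. -/
theorem StrictAInfinity.length_le_of_bw_ne_zero (l : List (Arrow k H)) (hl : l ≠ [])
    (h : m.bw (elts l) ≠ 0) : l.length ≤ Fintype.card P + 2 := by
  have h1 := solidCount_le_card l (m.isChain_of_bw_ne_zero [] [] l (by simpa using h))
  have h2 := solidCount_add_dashCount l
  rcases m.bw_elts_eq_zero_or l hl with h3 | ⟨z, h3, -⟩
  · exact absurd h3 h
  · omega

/-- The inner value has degree at most two, so at most three dashed letters surround it; the solid
letters on either side raise the height and number at most `|P|`. -/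
theorem StrictAInfinity.length_le_of_bw_bw_ne_zero (l₁ l' l₂ : List (Arrow k H)) (hl : l' ≠ [])
    (h : m.bw (elts l₁ ++ m.bw (elts l') :: elts l₂) ≠ 0) :
    l₁.length + l₂.length ≤ 2 * Fintype.card P + 3 := by
  have h1 := solidCount_le_card l₁ (m.isChain_of_bw_ne_zero []
    (m.bw (elts l') :: elts l₂) l₁ (by simpa using h))
  have h2 := solidCount_le_card l₂ (m.isChain_of_bw_ne_zero
    (elts l₁ ++ [m.bw (elts l')]) [] l₂ (by simpa using h))
  have h3 := solidCount_add_dashCount l₁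
  have h4 := solidCount_add_dashCount l₂
  rcases m.bw_elts_eq_zero_or l' hl with h5 | ⟨z, h5, h6⟩
  · rw [h5, ← bwMid_apply, map_zero] at h
    exact absurd rfl h
  · by_contra hlen
    refine h (DirectSum.ext_component k fun e => ?_)
    rw [h6]
    exact m.bw_mid_apply l₁ l₂ z e (by omega)

theorem StrictAInfinity.eS_smul_bw_cons (x : YAlg H.Δ) (l : List (YAlg H.Δ)) (j : P)
    (hx : eS k j • x = x) : eS k j • m.bw (x :: l) = m.bw (x :: l) := by
  rw [← bw_smul_cons, hx]

theorem StrictAInfinity.op_eS_smul_bw_concat (x : YAlg H.Δ) (l : List (YAlg H.Δ)) (i : P)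
    (hx : op (eS k i) • x = x) : op (eS k i) • m.bw (l ++ [x]) = m.bw (l ++ [x]) := by
  rw [← bw_concat_op_smul, hx]

theorem StrictAInfinity.b_two (x y : HomEl H.Δ) :
    m.bw [x.val, y.val] = (-1 : k) ^ x.1 • homog (x.2.mul y.2) := by
  have h := m.bw_map_val [x, y]
  simp only [List.map_cons, List.map_nil] at h
  rw [h]
  have : m.mw [x.val, y.val] = m.m 2 ![x.val, y.val] :=
    (m.m_eq_mw _ _ rfl fun i => by fin_cases i <;> rfl).symm
  rw [this]
  refine congr_arg₂ _ ?_ (m.m_two _ _ _ _)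
  simp [signExp]

theorem StrictAInfinity.bw_singleton (x : YAlg H.Δ) : m.bw [x] = 0 := by
  change (m.m 1) _ = 0
  rw [m.m_one]; rfl

end BarOnArrows

section NoScalars
variable {k Λ P : Type u} [Field k] [IsAlgClosed k] [Ring Λ] [Algebra k Λ] [Module.Finite k Λ]
  [DecidableEq P] [Preorder P] [Fintype P]
  {H : HomologicalSystem Λ P} (m : StrictAInfinity k H.Δ)

theorem cut_scalarS {i j : P} (h : i ≠ j) (c : P → k) :
    cut k (YExt H.Δ 0) i j (scalarS k H.Δ c) = 0 := by
  change eS k j • (op (eS k i) • scalarS k H.Δ c) = 0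
  rw [op_smul_scalarS, smul_scalarS, ← mul_assoc, mul_eS]
  simp [h.symm]

theorem mem_radJ_of_cut_eq {i j : P} (h : i ≠ j) (z : YExt H.Δ 0)
    (hz : cut k (YExt H.Δ 0) i j z = z) : z ∈ radJ k (Δ := H.Δ) := by
  have hz' : z ∈ LinearMap.range (scalarS k H.Δ) ⊔ radJ k := by
    rw [(H.isCompl (k := k)).sup_eq_top]; trivial
  obtain ⟨_, ⟨c, rfl⟩, j, hj, rfl⟩ := Submodule.mem_sup.1 hz'
  rw [map_add, cut_scalarS h, zero_add] at hz
  rw [← hz]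
  exact smul_mem_radJ _ (op_smul_mem_radJ _ hj)

/-- The values of the bar operations on words have no component in `S`. For two dashed letters this
holds because `J` is an ideal; a longer word with a value of degree zero contains a solid letter,
so that its source and target differ. -/
theorem StrictAInfinity.bw_elts_zero_mem_radJ (l : List (Arrow k H)) (hl : 2 ≤ l.length) :
    m.bw (elts l) 0 ∈ radJ k (Δ := H.Δ) := by
  have hne : l ≠ [] := by rintro rfl; simp at hl
  by_cases hd : dashCount l = 2
  swap
  · rw [m.bw_elts_apply l hne 0 (by omega)]; exact zero_mem _
  by_cases h0 : m.bw (elts l) = 0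
  · rw [h0]; exact zero_mem _
  have hc := m.isChain_of_bw_ne_zero [] [] l (by simpa using h0)
  have hsd := solidCount_add_dashCount l
  by_cases hs : solidCount l = 0
  · have hlen : l.length = 2 := by omega
    obtain ⟨x, y, rfl⟩ := List.length_eq_two.1 hlen
    rcases x with a | a <;> rcases y with b | b
    · simp [Arrow.deg] at hd
    · simp [Arrow.deg] at hd
    · simp [Arrow.deg] at hd
    · have h := m.b_two (Arrow.hom (.inr a)) (Arrow.hom (.inr b))
      rw [Arrow.val_hom, Arrow.val_hom] at h
      rw [show elts [Sum.inr a, Sum.inr b] =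
        [arrowElt k H (Sum.inr a), arrowElt k H (Sum.inr b)] from rfl, h, DirectSum.smul_apply]
      refine Submodule.smul_mem _ _ ?_
      have : (homog (a.elt.1.mul b.elt.1) : YAlg H.Δ) 0 = a.elt.1.mul b.elt.1 :=
        DirectSum.of_eq_same _ _
      refine (congrArg (· ∈ radJ k (Δ := H.Δ)) this).mpr ?_
      change YExt.toEnd (a.elt.1.mul b.elt.1) ∈ Ring.jacobson (Module.End Λ (∀ i, H.Δ i))
      rw [toEnd_mul]
      exact Ideal.mul_mem_left _ _ b.elt.2
  · rcases List.eq_nil_or_concat l with rfl | ⟨l₀, y, hl₀⟩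
    · exact absurd rfl hne
    obtain ⟨x, l₁, rfl⟩ := List.exists_cons_of_ne_nil hne
    have hh := height_getLast_add_le x l₁ hc
    have hy : (x :: l₁).getLast (by simp) = y := by simp [hl₀]
    rw [hy] at hh
    have hij : y.src ≠ x.tgt := fun h => by rw [h] at hh; omega
    refine mem_radJ_of_cut_eq hij _ ?_
    have e1 : eS k x.tgt • m.bw (elts (x :: l₁)) = m.bw (elts (x :: l₁)) :=
      m.eS_smul_bw_cons _ _ _ x.eS_smul_elt
    have e2 : op (eS k y.src) • m.bw (elts (x :: l₁)) = m.bw (elts (x :: l₁)) := by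
      rw [hl₀]
      simp only [List.concat_eq_append, elts, List.map_append, List.map_cons, List.map_nil]
      exact m.op_eS_smul_bw_concat _ _ _ y.op_eS_smul_elt
    change (eS k x.tgt • (op (eS k y.src) • m.bw (elts (x :: l₁)))) 0 = _
    rw [e2, e1]

end NoScalars

/-! ### The tensor algebra of a bimodule -/

section TensorAlgebraLemmas
variable {k S W : Type u} [Field k] [Ring S] [Algebra k S] [AddCommGroup W] [Module k W]
  [Module S W] [Module Sᵐᵒᵖ W]

namespace BimodTensorAlgebra

theorem algHom_ext {C : Type u} [Ring C] [Algebra k C] {F G : BimodTensorAlgebra k S W →ₐ[k] C}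
    (h₁ : ∀ s, F (ofScalar k S W s) = G (ofScalar k S W s))
    (h₂ : ∀ w, F (ofBimod k S W w) = G (ofBimod k S W w)) : F = G := by
  refine RingQuot.ringQuot_ext' _ _ _ (TensorAlgebra.hom_ext (LinearMap.ext fun p => ?_))
  have hp : p = (p.1, 0) + (0, p.2) := by simp
  change F (ofPair k S W p) = G (ofPair k S W p)
  rw [hp, map_add, map_add, map_add]
  exact congr_arg₂ _ (h₁ p.1) (h₂ p.2)

/-- The universal property, applied to the subalgebra generated, retracts the tensor algebra onto it. -/
theorem adjoin_eq_top : Algebra.adjoin k (Set.range (ofScalar k S W) ∪ Set.range (ofBimod k S W)) =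
    (⊤ : Subalgebra k (BimodTensorAlgebra k S W)) := by
  set A := Algebra.adjoin k (Set.range (ofScalar k S W) ∪ Set.range (ofBimod k S W)) with hA
  have hs : ∀ s, ofScalar k S W s ∈ A := fun s => Algebra.subset_adjoin (Or.inl ⟨s, rfl⟩)
  have hw : ∀ w, ofBimod k S W w ∈ A := fun w => Algebra.subset_adjoin (Or.inr ⟨w, rfl⟩)
  let F : BimodTensorAlgebra k S W →ₐ[k] A :=
    lift ((ofScalar k S W).codRestrict A hs)
      ((ofBimod k S W).codRestrict (Subalgebra.toSubmodule A) hw)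
      (fun s w => Subtype.ext (ofBimod_smul k S W s w))
      (fun s w => Subtype.ext (ofBimod_op_smul k S W w s))
  have hF : A.val.comp F = AlgHom.id k _ := algHom_ext (fun s => by simp [F]) (fun w => by
    simp [F]; rfl)
  refine eq_top_iff.2 fun x _ => ?_
  have := AlgHom.congr_fun hF x
  rw [AlgHom.id_apply] at this
  rw [← this]
  exact (F x).2

theorem induction_on {p : BimodTensorAlgebra k S W → Prop} (x : BimodTensorAlgebra k S W)
    (hs : ∀ s, p (ofScalar k S W s)) (hw : ∀ w, p (ofBimod k S W w))
    (hadd : ∀ x y, p x → p y → p (x + y)) (hmul : ∀ x y, p x → p y → p (x * y)) : p x := by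
  have hx : x ∈ Algebra.adjoin k (Set.range (ofScalar k S W) ∪ Set.range (ofBimod k S W)) := by
    rw [adjoin_eq_top]; trivial
  refine Algebra.adjoin_induction (p := fun x _ => p x) ?_ ?_ (fun x y _ _ => hadd x y)
    (fun x y _ _ => hmul x y) hx
  · rintro _ (⟨s, rfl⟩ | ⟨w, rfl⟩)
    · exact hs s
    · exact hw w
  · intro c
    rw [← AlgHom.commutes (ofScalar k S W) c]
    exact hs _

end BimodTensorAlgebra
end TensorAlgebraLemmas

/-! ### The grading of `T(Δ)` and its free generation -/

section Grading
open BimodTensorAlgebra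
variable (k : Type u) {Λ P : Type u} [Field k] [IsAlgClosed k] [Ring Λ] [Algebra k Λ]
  [Module.Finite k Λ] [DecidableEq P] [Fintype P] [Preorder P] (H : HomologicalSystem Λ P)

theorem ofBimod_eq (w : GenW k H) :
    ofBimod k (P → k) (GenW k H) w = ofSolid k H w.1 + ofDashed k H w.2 := by
  have : w = (LinearMap.inl k _ _ w.1 : GenW k H) + LinearMap.inr k _ _ w.2 := by
    refine Prod.ext ?_ ?_ <;> simp
  conv_lhs => rw [this, map_add]
  rfl

theorem ofSolid_smul (s : P → k) (a : HatDual (P → k) (YExt H.Δ 1)) :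
    ofSolid k H (s • a) = ofScalar k (P → k) (GenW k H) s * ofSolid k H a := by
  refine Eq.trans ?_ (ofBimod_smul k (P → k) (GenW k H) s (LinearMap.inl k _ _ a))
  exact congrArg (ofBimod k (P → k) (GenW k H))
    (show (LinearMap.inl k _ _ (s • a) : GenW k H) = s • LinearMap.inl k _ _ a from
      Prod.ext rfl (smul_zero s).symm)

theorem ofSolid_op_smul (s : P → k) (a : HatDual (P → k) (YExt H.Δ 1)) :
    ofSolid k H (op s • a) = ofSolid k H a * ofScalar k (P → k) (GenW k H) s := by
  refine Eq.trans ?_ (ofBimod_op_smul k (P → k) (GenW k H) (LinearMap.inl k _ _ a) s)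
  exact congrArg (ofBimod k (P → k) (GenW k H))
    (show (LinearMap.inl k _ _ (op s • a) : GenW k H) = op s • LinearMap.inl k _ _ a from
      Prod.ext rfl (smul_zero (op s)).symm)

theorem ofDashed_smul (s : P → k) (a : HatDual (P → k) (radJ k (Δ := H.Δ))) :
    ofDashed k H (s • a) = ofScalar k (P → k) (GenW k H) s * ofDashed k H a := by
  refine Eq.trans ?_ (ofBimod_smul k (P → k) (GenW k H) s (LinearMap.inr k _ _ a))
  exact congrArg (ofBimod k (P → k) (GenW k H))
    (show (LinearMap.inr k _ _ (s • a) : GenW k H) = s • LinearMap.inr k _ _ a from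
      Prod.ext (smul_zero s).symm rfl)

theorem ofDashed_op_smul (s : P → k) (a : HatDual (P → k) (radJ k (Δ := H.Δ))) :
    ofDashed k H (op s • a) = ofDashed k H a * ofScalar k (P → k) (GenW k H) s := by
  refine Eq.trans ?_ (ofBimod_op_smul k (P → k) (GenW k H) (LinearMap.inr k _ _ a) s)
  exact congrArg (ofBimod k (P → k) (GenW k H))
    (show (LinearMap.inr k _ _ (op s • a) : GenW k H) = op s • LinearMap.inr k _ _ a from
      Prod.ext (smul_zero (op s)).symm rfl)

theorem ofScalar_mem_algebraA (s : P → k) :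
    ofScalar k (P → k) (GenW k H) s ∈ algebraA k H := Algebra.subset_adjoin (Or.inl ⟨s, rfl⟩)

theorem ofSolid_mem_algebraA (a : HatDual (P → k) (YExt H.Δ 1)) : ofSolid k H a ∈ algebraA k H :=
  Algebra.subset_adjoin (Or.inr ⟨a, rfl⟩)

theorem algebraA_induction {p : TDelta k H → Prop} {x : TDelta k H} (hx : x ∈ algebraA k H)
    (hs : ∀ s, p (ofScalar k (P → k) (GenW k H) s)) (hw : ∀ a, p (ofSolid k H a))
    (hadd : ∀ x y, p x → p y → p (x + y))
    (hmul : ∀ x y, x ∈ algebraA k H → y ∈ algebraA k H → p x → p y → p (x * y)) : p x := by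
  refine Algebra.adjoin_induction (p := fun x _ => p x) ?_ ?_ (fun x y _ _ => hadd x y)
    (fun x y hx hy => hmul x y hx hy) hx
  · rintro _ (⟨s, rfl⟩ | ⟨w, rfl⟩)
    · exact hs s
    · exact hw w
  · intro c
    rw [← AlgHom.commutes (ofScalar k (P → k) (GenW k H)) c]
    exact hs _

theorem gradeT_eq (d : ℕ) : gradeT k H d = Subalgebra.toSubmodule (algebraA k H) *
    (layerW₁ k H * Subalgebra.toSubmodule (algebraA k H)) ^ d := rfl

theorem gradeT_zero : gradeT k H 0 = Subalgebra.toSubmodule (algebraA k H) := by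
  rw [gradeT, pow_zero, mul_one]

theorem gradeT_mul_algebraA (d : ℕ) :
    gradeT k H d * Subalgebra.toSubmodule (algebraA k H) = gradeT k H d := by
  cases d with
  | zero => rw [gradeT_zero, (algebraA k H).isIdempotentElem_toSubmodule.eq]
  | succ d => rw [gradeT, pow_succ, mul_assoc, mul_assoc, mul_assoc, (algebraA k H).isIdempotentElem_toSubmodule.eq]

theorem gradeT_mul_gradeT (i j : ℕ) : gradeT k H i * gradeT k H j = gradeT k H (i + j) := by
  rw [gradeT_eq k H j, ← mul_assoc, gradeT_mul_algebraA, gradeT_eq, gradeT_eq, pow_add, mul_assoc]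

theorem one_mem_gradeT : (1 : TDelta k H) ∈ gradeT k H 0 := by
  rw [gradeT_zero]; exact one_mem (algebraA k H)

theorem gradedMonoid_gradeT : SetLike.GradedMonoid (gradeT k H) where
  one_mem := one_mem_gradeT k H
  mul_mem i j x y hx hy := by
    rw [← gradeT_mul_gradeT]; exact Submodule.mul_mem_mul hx hy

theorem mul_mem_gradeT {i j n : ℕ} (h : i + j = n) {x y : TDelta k H} (hx : x ∈ gradeT k H i)
    (hy : y ∈ gradeT k H j) : x * y ∈ gradeT k H n := by
  rw [← h, ← gradeT_mul_gradeT]; exact Submodule.mul_mem_mul hx hy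

theorem gradeT_pow (d : ℕ) : gradeT k H 1 ^ (d + 1) = gradeT k H (d + 1) := by
  induction d with
  | zero => rw [zero_add, pow_one]
  | succ d ih => rw [pow_succ, ih, gradeT_mul_gradeT]

theorem ofScalar_mem_gradeT (s : P → k) : ofScalar k (P → k) (GenW k H) s ∈ gradeT k H 0 := by
  rw [gradeT_zero]; exact ofScalar_mem_algebraA k H s

theorem ofSolid_mem_gradeT (a : HatDual (P → k) (YExt H.Δ 1)) : ofSolid k H a ∈ gradeT k H 0 := by
  rw [gradeT_zero]; exact ofSolid_mem_algebraA k H a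

theorem ofDashed_mem_gradeT (a : HatDual (P → k) (radJ k (Δ := H.Δ))) :
    ofDashed k H a ∈ gradeT k H 1 := by
  have h : ofDashed k H a = 1 * (ofDashed k H a * 1) := by simp
  rw [h, gradeT, pow_one]
  exact Submodule.mul_mem_mul (one_mem (algebraA k H))
    (Submodule.mul_mem_mul ⟨a, rfl⟩ (one_mem (algebraA k H)))

theorem gradeT_one_induction {p : TDelta k H → Prop} (hadd : ∀ x y, p x → p y → p (x + y))
    (h : ∀ a ∈ gradeT k H 0, ∀ w, ∀ b ∈ gradeT k H 0, p (a * (ofDashed k H w * b)))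
    {x : TDelta k H} (hx : x ∈ gradeT k H 1) : p x := by
  rw [gradeT_eq, pow_one, ← gradeT_zero] at hx
  refine Submodule.mul_induction_on (C := p) hx (fun a ha y hy => ?_) hadd
  refine Submodule.mul_induction_on (C := fun y => p (a * y)) hy (fun w hw b hb => ?_)
    fun y z hy hz => ?_
  · obtain ⟨w, rfl⟩ := hw
    exact h a ha w b hb
  · rw [mul_add]; exact hadd _ _ hy hz

theorem gradeT_induction {p : ℕ → TDelta k H → Prop} (h0 : ∀ x ∈ gradeT k H 0, p 0 x)
    (h1 : ∀ a, p 1 (ofDashed k H a)) (hadd : ∀ d x y, p d x → p d y → p d (x + y))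
    (hmul : ∀ d e n x y, d + e = n → x ∈ gradeT k H d → y ∈ gradeT k H e → p d x → p e y →
      p n (x * y))
    {d : ℕ} {x : TDelta k H} (hx : x ∈ gradeT k H d) : p d x := by
  have h1' : ∀ x ∈ gradeT k H 1, p 1 x := fun x hx => by
    refine gradeT_one_induction k H (p := p 1) (hadd 1) (fun a ha w b hb => ?_) hx
    have hw := ofDashed_mem_gradeT k H w
    exact hmul 0 1 1 a _ (zero_add 1) ha (mul_mem_gradeT k H (add_zero 1) hw hb) (h0 a ha)
      (hmul 1 0 1 _ b (add_zero 1) hw hb (h1 w) (h0 b hb))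
  induction d generalizing x with
  | zero => exact h0 x hx
  | succ d ih =>
    rw [← gradeT_mul_gradeT] at hx
    exact Submodule.mul_induction_on (C := p (d + 1)) hx
      (fun y hy z hz => hmul d 1 (d + 1) y z rfl hy hz (ih hy) (h1' z hz)) (hadd _)

/-- The algebra map `T(Δ) → T(Δ)[X]` that sends `x` of degree `d` to `x X^d`. -/
noncomputable def gradeMap : TDelta k H →ₐ[k] Polynomial (TDelta k H) :=
  lift ((Polynomial.CAlgHom (R := k)).comp (ofScalar k (P → k) (GenW k H)))
    (LinearMap.coprod ((Polynomial.CAlgHom (R := k)).toLinearMap ∘ₗ ofSolid k H)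
      ((Polynomial.monomial 1).restrictScalars k ∘ₗ ofDashed k H))
    (fun s w => by
      change Polynomial.C (ofSolid k H (s • w.1)) +
        Polynomial.monomial 1 (ofDashed k H (s • w.2)) =
        Polynomial.C (ofScalar k (P → k) (GenW k H) s) *
          (Polynomial.C (ofSolid k H w.1) + Polynomial.monomial 1 (ofDashed k H w.2))
      rw [ofSolid_smul, ofDashed_smul, mul_add, Polynomial.C_mul_monomial, Polynomial.C_mul])
    (fun s w => by
      change Polynomial.C (ofSolid k H (op s • w.1)) +
        Polynomial.monomial 1 (ofDashed k H (op s • w.2)) =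
        (Polynomial.C (ofSolid k H w.1) + Polynomial.monomial 1 (ofDashed k H w.2)) *
          Polynomial.C (ofScalar k (P → k) (GenW k H) s)
      rw [ofSolid_op_smul, ofDashed_op_smul, add_mul, Polynomial.monomial_mul_C,
        Polynomial.C_mul])

theorem gradeMap_ofScalar (s : P → k) : gradeMap k H (ofScalar k (P → k) (GenW k H) s) =
    Polynomial.C (ofScalar k (P → k) (GenW k H) s) := lift_ofScalar _ _ _ _ s

theorem gradeMap_ofSolid (a : HatDual (P → k) (YExt H.Δ 1)) :
    gradeMap k H (ofSolid k H a) = Polynomial.C (ofSolid k H a) := by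
  refine (lift_ofBimod _ _ _ _ _).trans ?_
  change Polynomial.C (ofSolid k H a) + Polynomial.monomial 1 (ofDashed k H 0) = _
  rw [map_zero, map_zero, add_zero]

theorem gradeMap_ofDashed (a : HatDual (P → k) (radJ k (Δ := H.Δ))) :
    gradeMap k H (ofDashed k H a) = Polynomial.monomial 1 (ofDashed k H a) := by
  refine (lift_ofBimod _ _ _ _ _).trans ?_
  change Polynomial.C (ofSolid k H 0) + Polynomial.monomial 1 (ofDashed k H a) = _
  rw [map_zero, map_zero, zero_add]

theorem gradeMap_of_mem {d : ℕ} {x : TDelta k H} (hx : x ∈ gradeT k H d) :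
    gradeMap k H x = Polynomial.monomial d x := by
  refine gradeT_induction k H (p := fun d x => gradeMap k H x = Polynomial.monomial d x)
    (fun x hx => ?_) (gradeMap_ofDashed k H) (fun d x y hx hy => by rw [map_add, hx, hy, map_add])
    (fun d e n x y hn _ _ hx hy => by
      rw [map_mul, hx, hy, Polynomial.monomial_mul_monomial, hn]) hx
  rw [gradeT_zero] at hx
  exact algebraA_induction k H (p := fun x => gradeMap k H x = Polynomial.monomial 0 x) hx
    (gradeMap_ofScalar k H) (gradeMap_ofSolid k H)
    (fun x y hx hy => by rw [map_add, hx, hy, map_add])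
    (fun x y _ _ hx hy => by rw [map_mul, hx, hy, Polynomial.monomial_mul_monomial])

theorem iSup_gradeT : ⨆ d, gradeT k H d = ⊤ := by
  refine eq_top_iff.2 fun x _ => ?_
  refine induction_on (p := fun x => x ∈ ⨆ d, gradeT k H d) x
    (fun s => Submodule.mem_iSup_of_mem 0 (ofScalar_mem_gradeT k H s)) (fun w => ?_)
    (fun x y => add_mem) fun x y hx hy => ?_
  · rw [ofBimod_eq]
    exact add_mem (Submodule.mem_iSup_of_mem 0 (ofSolid_mem_gradeT k H _))
      (Submodule.mem_iSup_of_mem 1 (ofDashed_mem_gradeT k H _))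
  · have : (⨆ d, gradeT k H d) * (⨆ d, gradeT k H d) ≤ ⨆ d, gradeT k H d := by
      rw [Submodule.iSup_mul]
      refine iSup_le fun i => ?_
      rw [Submodule.mul_iSup]
      refine iSup_le fun j => ?_
      rw [gradeT_mul_gradeT]
      exact le_iSup (gradeT k H) _
    exact this (Submodule.mul_mem_mul hx hy)

/-- The grading is direct since `gradeMap` recovers the components of an element as coefficients. -/
theorem isInternal_gradeT : DirectSum.IsInternal (gradeT k H) := by
  classical
  refine ⟨?_, ?_⟩
  · rw [injective_iff_map_eq_zero]
    intro f hf
    refine DirectSum.ext_component ℕ fun d => Subtype.ext ?_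
    have h1 : ∀ f : DirectSum ℕ fun d => gradeT k H d,
        (gradeMap k H (DirectSum.coeAddMonoidHom (gradeT k H) f)).coeff d = f d := by
      intro f
      induction f using DirectSum.induction_on with
      | zero => simp
      | of e x =>
        rw [DirectSum.coeAddMonoidHom_of, gradeMap_of_mem k H x.2, Polynomial.coeff_monomial]
        by_cases h : e = d
        · subst h; simp
        · rw [if_neg h, DirectSum.of_eq_of_ne _ _ _ (Ne.symm h)]; rfl
      | add f g hf hg => rw [map_add, map_add, Polynomial.coeff_add, hf, hg]; rfl
    have h2 := h1 f
    rw [hf, map_zero, Polynomial.coeff_zero] at h2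
    exact h2.symm
  · intro x
    have hx : x ∈ ⨆ d, gradeT k H d := by rw [iSup_gradeT]; trivial
    rw [Submodule.iSup_eq_range_dfinsupp_lsum] at hx
    obtain ⟨f, hf⟩ := hx
    refine ⟨f, hf ▸ ?_⟩
    rfl

theorem layerW_sup : layerW₀ k H ⊔ layerW₁ k H = LinearMap.range (ofBimod k (P → k) (GenW k H)) := by
  refine le_antisymm (sup_le ?_ ?_) ?_
  · rintro _ ⟨a, rfl⟩; exact ⟨_, rfl⟩
  · rintro _ ⟨a, rfl⟩; exact ⟨_, rfl⟩
  · rintro _ ⟨w, rfl⟩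
    rw [ofBimod_eq]
    exact Submodule.add_mem_sup ⟨_, rfl⟩ ⟨_, rfl⟩

theorem disjoint_layerW : Disjoint (layerW₀ k H) (layerW₁ k H) := by
  have h0 : layerW₀ k H ≤ gradeT k H 0 := by rintro _ ⟨a, rfl⟩; exact ofSolid_mem_gradeT k H a
  have h1 : layerW₁ k H ≤ gradeT k H 1 := by rintro _ ⟨a, rfl⟩; exact ofDashed_mem_gradeT k H a
  exact ((isInternal_gradeT k H).submodule_iSupIndep.pairwiseDisjoint zero_ne_one).mono h0 h1

theorem freelyGenerated_layer :
    FreelyGenerated (layerS k H) (layerW₀ k H ⊔ layerW₁ k H) := by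
  rw [layerW_sup]
  refine ⟨?_, ?_⟩
  · rintro _ ⟨s, rfl⟩ _ ⟨w, rfl⟩
    exact ⟨⟨s • w, ofBimod_smul _ _ _ _ _⟩, ⟨op s • w, ofBimod_op_smul _ _ _ _ _⟩⟩
  · intro C _ _ f g hl hr
    let σ : (P → k) →ₐ[k] layerS k H := (ofScalar k (P → k) (GenW k H)).rangeRestrict
    let ι := (ofBimod k (P → k) (GenW k H)).rangeRestrict
    let F : TDelta k H →ₐ[k] C := lift (f.comp σ) (g ∘ₗ ι)
      (fun s w => hl (σ s) (ι w) _ (ofBimod_smul _ _ _ _ _))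
      (fun s w => hr (σ s) (ι w) _ (ofBimod_op_smul _ _ _ _ _))
    have hFs : ∀ s, F (ofScalar k (P → k) (GenW k H) s) = f (σ s) := fun s =>
      lift_ofScalar _ _ _ _ s
    have hFw : ∀ w, F (ofBimod k (P → k) (GenW k H) w) = g (ι w) := fun w =>
      lift_ofBimod _ _ _ _ w
    refine ⟨F, ⟨?_, ?_⟩, fun G hG => ?_⟩
    · rintro ⟨_, s, rfl⟩
      exact hFs s
    · rintro ⟨_, w, rfl⟩
      exact hFw w
    · refine algHom_ext (fun s => ?_) (fun w => ?_)
      · rw [hFs]; exact hG.1 (σ s)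
      · rw [hFw]; exact hG.2 (ι w)

/-- A tensor algebra `T_S(W₀ ⊕ W₁)` is also the tensor algebra, over `T_S(W₀)`, of its part of degree one
in `W₁`. -/
theorem freelyGenerated_algebraA : FreelyGenerated (algebraA k H) (gradeT k H 1) := by
  refine ⟨fun r hr w hw => ?_, ?_⟩
  · have hr' : r ∈ gradeT k H 0 := by rw [gradeT_zero]; exact hr
    exact ⟨mul_mem_gradeT k H (zero_add 1) hr' hw, mul_mem_gradeT k H (add_zero 1) hw hr'⟩
  · intro C _ _ f g hl hr
    let σ : (P → k) →ₐ[k] algebraA k H :=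
      (ofScalar k (P → k) (GenW k H)).codRestrict _ (ofScalar_mem_algebraA k H)
    let ι₀ := (ofSolid k H).codRestrict (Subalgebra.toSubmodule (algebraA k H))
      (ofSolid_mem_algebraA k H)
    let ι₁ := (ofDashed k H).codRestrict (gradeT k H 1) (ofDashed_mem_gradeT k H)
    let F : TDelta k H →ₐ[k] C := lift (f.comp σ) (LinearMap.coprod (f.toLinearMap ∘ₗ ι₀) (g ∘ₗ ι₁))
      (fun s w => by
        change f (ι₀ (s • w.1)) + g (ι₁ (s • w.2)) = f (σ s) * (f (ι₀ w.1) + g (ι₁ w.2))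
        rw [hl (σ s) (ι₁ w.2) (ι₁ (s • w.2)) (ofDashed_smul k H _ _), mul_add, ← map_mul]
        exact congr_arg₂ _ (congrArg f (Subtype.ext (ofSolid_smul k H _ _))) rfl)
      (fun s w => by
        change f (ι₀ (op s • w.1)) + g (ι₁ (op s • w.2)) = (f (ι₀ w.1) + g (ι₁ w.2)) * f (σ s)
        rw [hr (σ s) (ι₁ w.2) (ι₁ (op s • w.2)) (ofDashed_op_smul k H _ _), add_mul, ← map_mul]
        exact congr_arg₂ _ (congrArg f (Subtype.ext (ofSolid_op_smul k H _ _))) rfl)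
    have hFs : ∀ s, F (ofScalar k (P → k) (GenW k H) s) = f (σ s) := fun s =>
      lift_ofScalar _ _ _ _ s
    have hF0 : ∀ a, F (ofSolid k H a) = f (ι₀ a) := fun a => by
      refine (lift_ofBimod _ _ _ _ _).trans ?_
      change f (ι₀ a) + g (ι₁ 0) = f (ι₀ a)
      have h0 : g (ι₁ 0) = 0 := (g ∘ₗ ι₁).map_zero
      exact (congrArg (f (ι₀ a) + ·) h0).trans (add_zero _)
    have hF1 : ∀ a, F (ofDashed k H a) = g (ι₁ a) := fun a => by
      refine (lift_ofBimod _ _ _ _ _).trans ?_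
      change f (ι₀ 0) + g (ι₁ a) = g (ι₁ a)
      have h0 : f (ι₀ 0) = 0 := (f.toLinearMap ∘ₗ ι₀).map_zero
      exact (congrArg (· + g (ι₁ a)) h0).trans (zero_add _)
    have hFA : ∀ r : algebraA k H, F r = f r := by
      rintro ⟨r, hr⟩
      suffices ∃ h : r ∈ algebraA k H, F r = f ⟨r, h⟩ from this.2
      refine algebraA_induction k H (p := fun r => ∃ h : r ∈ algebraA k H, F r = f ⟨r, h⟩) hr
        (fun s => ⟨_, hFs s⟩) (fun a => ⟨_, hF0 a⟩) ?_ ?_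
      · rintro x y ⟨hx, hx'⟩ ⟨hy, hy'⟩
        exact ⟨add_mem hx hy, (map_add F x y).trans ((congr_arg₂ (· + ·) hx' hy').trans
          (map_add f ⟨x, hx⟩ ⟨y, hy⟩).symm)⟩
      · rintro x y - - ⟨hx, hx'⟩ ⟨hy, hy'⟩
        exact ⟨mul_mem hx hy, (map_mul F x y).trans ((congr_arg₂ (· * ·) hx' hy').trans
          (map_mul f ⟨x, hx⟩ ⟨y, hy⟩).symm)⟩
    have hFV : ∀ w : gradeT k H 1, F w = g w := by
      rintro ⟨w, hw⟩
      suffices ∃ h : w ∈ gradeT k H 1, F w = g ⟨w, h⟩ from this.2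
      refine gradeT_one_induction k H (p := fun w => ∃ h : w ∈ gradeT k H 1, F w = g ⟨w, h⟩)
        ?_ (fun a ha w b hb => ?_) hw
      · rintro x y ⟨hx, hx'⟩ ⟨hy, hy'⟩
        exact ⟨add_mem hx hy, (map_add F x y).trans ((congr_arg₂ (· + ·) hx' hy').trans
          (map_add g ⟨x, hx⟩ ⟨y, hy⟩).symm)⟩
      · have h1 : ofDashed k H w * b ∈ gradeT k H 1 :=
          mul_mem_gradeT k H (add_zero 1) (ofDashed_mem_gradeT k H w) hb
        have h2 : a * (ofDashed k H w * b) ∈ gradeT k H 1 := mul_mem_gradeT k H (zero_add 1) ha h1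
        rw [gradeT_zero] at ha hb
        refine ⟨h2, ?_⟩
        have e1 : F (ofDashed k H w * b) = g ⟨_, h1⟩ :=
          ((map_mul F _ _).trans (congr_arg₂ (· * ·) (hF1 w) (hFA ⟨b, hb⟩))).trans
            (hr ⟨b, hb⟩ (ι₁ w) ⟨_, h1⟩ rfl).symm
        exact ((map_mul F _ _).trans (congr_arg₂ (· * ·) (hFA ⟨a, ha⟩) e1)).trans
          (hl ⟨a, ha⟩ ⟨_, h1⟩ ⟨_, h2⟩ rfl).symm
    refine ⟨F, ⟨hFA, hFV⟩, fun G hG => algHom_ext (fun s => ?_) (fun w => ?_)⟩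
    · exact (hG.1 (σ s)).trans (hFs s).symm
    · let r : algebraA k H := ⟨ofSolid k H w.1, ofSolid_mem_algebraA k H w.1⟩
      let v : gradeT k H 1 := ⟨ofDashed k H w.2, ofDashed_mem_gradeT k H w.2⟩
      have e0 : G (ofSolid k H w.1) = F (ofSolid k H w.1) := (hG.1 r).trans (hFA r).symm
      have e1 : G (ofDashed k H w.2) = F (ofDashed k H w.2) := (hG.2 v).trans (hFV v).symm
      have e2 : ∀ K : TDelta k H →ₐ[k] C, K (ofBimod k (P → k) (GenW k H) w) =
          K (ofSolid k H w.1) + K (ofDashed k H w.2) := fun K => by rw [ofBimod_eq, map_add]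
      exact (e2 G).trans ((congr_arg₂ (· + ·) e0 e1).trans (e2 F).symm)

end Grading

/-! ### The differential on products -/

section Leibniz
open BimodTensorAlgebra
variable {k Λ P : Type u} [Field k] [IsAlgClosed k] [Ring Λ] [Algebra k Λ] [Module.Finite k Λ]
  [DecidableEq P] [Fintype P] [Preorder P] {H : HomologicalSystem Λ P}
  (m : StrictAInfinity k H.Δ)

theorem StrictAInfinity.deltaMatrix_apply_ofBimod (w : GenW k H) :
    m.deltaMatrix (ofBimod k (P → k) (GenW k H) w) =
      !![ofBimod k (P → k) (GenW k H) (gradeInvol k H w), m.deltaGen w; 0,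
        ofBimod k (P → k) (GenW k H) w] := lift_ofBimod _ _ _ _ w

theorem StrictAInfinity.deltaMatrix_apply_ofScalar (s : P → k) :
    m.deltaMatrix (ofScalar k (P → k) (GenW k H) s) =
      !![ofScalar k (P → k) (GenW k H) s, 0; 0, ofScalar k (P → k) (GenW k H) s] :=
  lift_ofScalar _ _ _ _ s

theorem StrictAInfinity.deltaMatrix_lower (x : TDelta k H) :
    m.deltaMatrix x 1 0 = 0 ∧ m.deltaMatrix x 1 1 = x := by
  refine induction_on (p := fun x => m.deltaMatrix x 1 0 = 0 ∧ m.deltaMatrix x 1 1 = x) x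
    (fun s => ?_) (fun w => ?_) (fun x y hx hy => ?_) fun x y hx hy => ?_
  · rw [deltaMatrix_apply_ofScalar]; exact ⟨rfl, rfl⟩
  · rw [deltaMatrix_apply_ofBimod]; exact ⟨rfl, rfl⟩
  · rw [map_add, Matrix.add_apply, Matrix.add_apply, hx.1, hy.1, hx.2, hy.2]
    exact ⟨add_zero _, rfl⟩
  · rw [map_mul, Matrix.mul_apply, Matrix.mul_apply, Fin.sum_univ_two, Fin.sum_univ_two, hx.1,
      hy.1, hx.2, hy.2, zero_mul, zero_mul, mul_zero, zero_add, zero_add]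
    exact ⟨rfl, rfl⟩

/-- The upper left entry of the matrix defining `δ` is the sign automorphism of the graded algebra. -/
theorem StrictAInfinity.deltaMatrix_zero_zero {d : ℕ} {x : TDelta k H} (hx : x ∈ gradeT k H d) :
    m.deltaMatrix x 0 0 = (-1) ^ d * x := by
  have hmul : ∀ x y, m.deltaMatrix (x * y) 0 0 = m.deltaMatrix x 0 0 * m.deltaMatrix y 0 0 :=
    fun x y => by
      rw [map_mul, Matrix.mul_apply, Fin.sum_univ_two, (m.deltaMatrix_lower y).1, mul_zero,
        add_zero]
  have hB : ∀ w, m.deltaMatrix (ofBimod k (P → k) (GenW k H) w) 0 0 =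
      ofBimod k (P → k) (GenW k H) (gradeInvol k H w) := fun w => by
    rw [deltaMatrix_apply_ofBimod]; rfl
  refine gradeT_induction k H (p := fun d x => m.deltaMatrix x 0 0 = (-1) ^ d * x)
    (fun x hx => ?_) (fun a => ?_) (fun d x y hx hy => ?_) (fun d e n x y hn _ _ hx hy => ?_) hx
  · rw [gradeT_zero] at hx
    rw [pow_zero, one_mul]
    refine algebraA_induction k H (p := fun x => m.deltaMatrix x 0 0 = x) hx (fun s => ?_)
      (fun a => ?_) (fun x y hx hy => ?_) fun x y _ _ hx hy => ?_
    · rw [deltaMatrix_apply_ofScalar]; rfl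
    · refine (hB (LinearMap.inl k _ _ a)).trans ?_
      refine congrArg (ofBimod k (P → k) (GenW k H)) (Prod.ext rfl ?_)
      simp [gradeInvol]
    · rw [map_add, Matrix.add_apply, hx, hy]
    · rw [hmul, hx, hy]
  · refine (hB (LinearMap.inr k _ _ a)).trans ?_
    have : gradeInvol k H (LinearMap.inr k _ _ a) = - (LinearMap.inr k _ _ a : GenW k H) := by
      refine Prod.ext ?_ ?_ <;> simp [gradeInvol]
    rw [this, map_neg, pow_one, neg_one_mul]
    rfl
  · rw [map_add, Matrix.add_apply, hx, hy, mul_add]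
  · rw [hmul, hx, hy, ← hn, pow_add]
    have : (-1 : TDelta k H) ^ e * x = x * (-1) ^ e := ((Commute.neg_one_left x).pow_left e).eq
    rw [mul_assoc, mul_assoc, ← mul_assoc x, ← this, mul_assoc]

/-- The graded Leibniz rule, read off the upper right entry of a product of upper triangular matrices. -/
theorem StrictAInfinity.delta_mul {d : ℕ} {x : TDelta k H} (hx : x ∈ gradeT k H d)
    (y : TDelta k H) : m.delta (x * y) = m.delta x * y + (-1) ^ d * (x * m.delta y) := by
  rw [delta_apply, map_mul, Matrix.mul_apply, Fin.sum_univ_two, (m.deltaMatrix_lower y).2,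
    m.deltaMatrix_zero_zero hx, add_comm, mul_assoc]
  rfl

/-- The square of the differential is a derivation: the signs cancel. -/
theorem StrictAInfinity.delta_delta_mul {d : ℕ} {x : TDelta k H} (hx : x ∈ gradeT k H d)
    (hδ : m.delta x ∈ gradeT k H (d + 1)) (y : TDelta k H) :
    m.delta (m.delta (x * y)) = m.delta (m.delta x) * y + x * m.delta (m.delta y) := by
  have h1 : ∀ z, m.delta ((-1) ^ d * z) = (-1) ^ d * m.delta z := fun z => by
    rcases neg_one_pow_eq_or (TDelta k H) d with h | h <;> simp [h]
  have h2 : (-1 : TDelta k H) ^ d * (-1) ^ d = 1 := by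
    rw [← pow_add, Even.neg_one_pow ⟨d, rfl⟩]
  rw [m.delta_mul hx, map_add, m.delta_mul hδ, h1, m.delta_mul hx, mul_add, ← mul_assoc _ _ (x * _),
    h2, one_mul, pow_succ, mul_neg_one, neg_mul]
  abel

end Leibniz

/-! ### The cobar formula for the differential and for `β` -/

section Cobar
open BimodTensorAlgebra
variable {k Λ P : Type u} [Field k] [IsAlgClosed k] [Ring Λ] [Algebra k Λ] [Module.Finite k Λ]
  [DecidableEq P] [Fintype P] [Preorder P] {H : HomologicalSystem Λ P}

instance finite_solidIdx : Finite (SolidIdx k H) := by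
  have := H.finite
  have : Module.Finite Λ (tot H.Δ) := inferInstanceAs (Module.Finite Λ (∀ i, H.Δ i))
  have : Module.Finite k (YExt H.Δ 1) := finite_ext (k := k) (tot H.Δ) (tot H.Δ) 1
  infer_instance

instance finite_dashedIdx : Finite (DashedIdx k H) := by
  have := H.finite
  have : Module.Finite Λ (tot H.Δ) := inferInstanceAs (Module.Finite Λ (∀ i, H.Δ i))
  have : Module.Finite k (YExt H.Δ 0) := finite_ext (k := k) (tot H.Δ) (tot H.Δ) 0
  infer_instance

noncomputable instance : Fintype (SolidIdx k H) := Fintype.ofFinite _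
noncomputable instance : Fintype (DashedIdx k H) := Fintype.ofFinite _

/-- The dual basis element of an arrow, in `D̂(B)₀ ⊕ D̂(J)`. -/
noncomputable def Arrow.gen : Arrow k H → GenW k H
  | .inl a => LinearMap.inl k _ _ a.dual
  | .inr a => LinearMap.inr k _ _ a.dual

theorem ofBimod_gen (x : Arrow k H) :
    ofBimod k (P → k) (GenW k H) x.gen = arrowDual k H x := by
  rcases x with a | a <;> rfl

theorem arrowDual_mem_gradeT (x : Arrow k H) : arrowDual k H x ∈ gradeT k H x.deg := by
  rcases x with a | a
  · exact ofSolid_mem_gradeT k H _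
  · exact ofDashed_mem_gradeT k H _

/-- The product in `T(Δ)` of the dual basis elements of the letters of a word. -/
noncomputable def word (l : List (Arrow k H)) : TDelta k H := (l.map (arrowDual k H)).prod

@[simp] theorem word_nil : word ([] : List (Arrow k H)) = 1 := rfl
@[simp] theorem word_cons (x : Arrow k H) (l) : word (x :: l) = arrowDual k H x * word l :=
  List.prod_cons
@[simp] theorem word_append (l l' : List (Arrow k H)) : word (l ++ l') = word l * word l' := by
  simp [word]

theorem word_mem_gradeT (l : List (Arrow k H)) : word l ∈ gradeT k H (dashCount l) := by
  induction l with
  | nil => exact one_mem_gradeT k H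
  | cons x l ih =>
    rw [word_cons, dashCount_cons]
    exact mul_mem_gradeT k H rfl (arrowDual_mem_gradeT x) ih

variable (H) in
/-- The functional on the Yoneda algebra defined by an element of `D̂(B)₀ ⊕ D̂(J)`. -/
noncomputable def genFunctional (w : GenW k H) : YAlg H.Δ →ₗ[k] k := sumS ∘ₗ extW H w

variable (H) in
/-- The functional on the Yoneda algebra defined by an element of `D̂(B)₋₁`. -/
noncomputable def extTwoFunctional (ζ : HatDual (P → k) (YExt H.Δ 2)) : YAlg H.Δ →ₗ[k] k :=
  sumS ∘ₗ ext2 H ζ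

theorem genFunctional_apply (w : GenW k H) (z : YAlg H.Δ) :
    genFunctional H w z =
      HatDual.functional w.1 (z 1) + HatDual.functional w.2 (H.projJ (k := k) (z 0)) := by
  change sumS (extW H w z) = _
  rw [extW_apply, map_add]; rfl

theorem extTwoFunctional_apply (ζ : HatDual (P → k) (YExt H.Δ 2)) (z : YAlg H.Δ) :
    extTwoFunctional H ζ z = HatDual.functional ζ (z 2) := rfl

theorem genFunctional_gen_inl (a : SolidIdx k H) (z : YAlg H.Δ) :
    genFunctional H (Arrow.gen (.inl a)) z = DirIdx.coef a (z 1) := by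
  rw [genFunctional_apply]
  change HatDual.functional a.dual (z 1) + HatDual.functional 0 _ = _
  rw [HatDual.functional_dual, map_zero, LinearMap.zero_apply, add_zero]

theorem genFunctional_gen_inr (a : DashedIdx k H) (z : YAlg H.Δ) :
    genFunctional H (Arrow.gen (.inr a)) z = DirIdx.coef a (H.projJ (k := k) (z 0)) := by
  rw [genFunctional_apply]
  change HatDual.functional 0 _ + HatDual.functional a.dual _ = _
  rw [HatDual.functional_dual, map_zero, LinearMap.zero_apply, zero_add]

variable (H) in
/-- The projection of the Yoneda algebra onto `Ext²(Δ, Δ)`. -/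
noncomputable def projTwo : YAlg H.Δ →ₗ[k] YAlg H.Δ :=
  DirectSum.lof k ℕ (YExt H.Δ) 2 ∘ₗ degComp k 2

theorem homog_apply_self {Δ : P → ModuleCat.{u} Λ} {d : ℕ} (x : YExt Δ d) : (homog x) d = x :=
  DirectSum.of_eq_same _ _

theorem homog_apply_ne {Δ : P → ModuleCat.{u} Λ} {d e : ℕ} (x : YExt Δ d) (h : e ≠ d) :
    (homog x) e = 0 := DirectSum.of_eq_of_ne _ _ _ h

/-- An element of the Yoneda algebra of degree at most two without component in `S` is expanded in
the arrows, up to its component in `Ext²(Δ, Δ)`. -/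
theorem expand_in_arrows (z : YAlg H.Δ) (h0 : z 0 ∈ radJ k (Δ := H.Δ))
    (h3 : ∀ e, 3 ≤ e → z e = 0) :
    z = ∑ x : Arrow k H, genFunctional H x.gen z • arrowElt k H x + projTwo (k := k) H z := by
  have e1 : ∑ x : Arrow k H, genFunctional H x.gen z • arrowElt k H x =
      homog (z 1) + homog (z 0) := by
    rw [Fintype.sum_sum_type]
    congr 1
    · conv_rhs => rw [← DirIdx.sum_coef (k := k) (P := P) (z 1)]
      rw [homog, map_sum]
      refine Finset.sum_congr rfl fun a _ => ?_
      rw [genFunctional_gen_inl]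
      exact smul_homog _ _
    · have hz : ((H.projJ (k := k) (z 0) : radJ k (Δ := H.Δ)) : YExt H.Δ 0) = z 0 :=
        congrArg Subtype.val (projJ_coe H ⟨z 0, h0⟩)
      conv_rhs => rw [← hz, ← DirIdx.sum_coef (k := k) (P := P) (H.projJ (z 0))]
      rw [Submodule.coe_sum, homog, map_sum]
      refine Finset.sum_congr rfl fun a _ => ?_
      rw [genFunctional_gen_inr]
      exact smul_homog _ _
  rw [e1]
  have e2 : projTwo (k := k) H z = homog (z 2) := rfl
  rw [e2]
  refine DirectSum.ext_component k fun e => ?_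
  change z e = (homog (z 1)) e + (homog (z 0)) e + (homog (z 2)) e
  match e with
  | 0 => rw [homog_apply_self, homog_apply_ne _ (by decide), homog_apply_ne _ (by decide)]; simp
  | 1 => rw [homog_apply_self, homog_apply_ne _ (by decide), homog_apply_ne _ (by decide)]; simp
  | 2 => rw [homog_apply_self, homog_apply_ne _ (by decide), homog_apply_ne _ (by decide)]; simp
  | e + 3 =>
    rw [homog_apply_ne _ (by omega), homog_apply_ne _ (by omega), homog_apply_ne _ (by omega),
      h3 _ (by omega)]; simp

variable (P) in
/-- A bound for the length of the words on which one or two bar operations do not vanish. -/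
def wordBound : ℕ := 2 * Fintype.card P + 4

variable (m : StrictAInfinity k H.Δ)

/-- The element `∑ f(b_n(x₁, …, x_n)) x₁^* ⋯ x_n^*` of `T(Δ)` attached to a functional `f` on the
Yoneda algebra, the sum being over all words of length at least two. -/
noncomputable def StrictAInfinity.cobar : (YAlg H.Δ →ₗ[k] k) →ₗ[k] TDelta k H where
  toFun f := ∑ n ∈ Finset.Icc 2 (wordBound P), wsum n fun l => f (m.bw (elts l)) • word l
  map_add' f g := by
    simp only [LinearMap.add_apply, add_smul, wsum_add_distrib, Finset.sum_add_distrib]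
  map_smul' c f := by
    simp only [LinearMap.smul_apply, smul_assoc, RingHom.id_apply, Finset.smul_sum]
    refine Finset.sum_congr rfl fun n _ => ?_
    exact (map_wsum (DistribSMul.toAddMonoidHom (TDelta k H) c) n _).symm

theorem StrictAInfinity.cobar_apply (f : YAlg H.Δ →ₗ[k] k) : m.cobar f =
    ∑ n ∈ Finset.Icc 2 (wordBound P), wsum n fun l => f (m.bw (elts l)) • word l := rfl

theorem StrictAInfinity.cobar_congr {f g : YAlg H.Δ →ₗ[k] k}
    (h : ∀ l : List (Arrow k H), 2 ≤ l.length → f (m.bw (elts l)) = g (m.bw (elts l))) :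
    m.cobar f = m.cobar g := by
  rw [cobar_apply, cobar_apply]
  refine Finset.sum_congr rfl fun n hn => wsum_congr fun l hl => ?_
  rw [h l (by rw [hl]; exact (Finset.mem_Icc.1 hn).1)]

theorem ofScalar_mul_arrowDual (s : P → k) (x : Arrow k H) :
    ofScalar k (P → k) (GenW k H) s * arrowDual k H x = s x.tgt • arrowDual k H x := by
  have h : ∀ {U : Type u} [AddCommGroup U] [Module k U] [Module (P → k) U] [Module (P → k)ᵐᵒᵖ U]
      [SMulCommClass (P → k) (P → k)ᵐᵒᵖ U] [IsScalarTower k (P → k) U]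
      [IsScalarTower k (P → k)ᵐᵒᵖ U] (a : DirIdx k (P := P) U), s • a.dual = s a.tgt • a.dual := by
    intro U _ _ _ _ _ _ _ a
    apply HatDual.functional.injective
    ext u
    rw [HatDual.functional_smul, HatDual.functional_dual, DirIdx.coef_smul,
      LinearEquiv.map_smul, LinearMap.smul_apply, HatDual.functional_dual]; rfl
  rcases x with a | a
  · change _ * ofSolid k H a.dual = s a.tgt • ofSolid k H a.dual
    rw [← ofSolid_smul, h, map_smul]
  · change _ * ofDashed k H a.dual = s a.tgt • ofDashed k H a.dual
    rw [← ofDashed_smul, h, map_smul]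

theorem StrictAInfinity.pathTerm_eq {n : ℕ} (hn : n ≠ 0) (a : Fin n → Arrow k H)
    (φ : YAlg H.Δ →ₗ[k] (P → k)) (hφ : ∀ (s : P → k) z, φ (s • z) = s * φ z) :
    m.pathTerm a φ = sumS (φ (m.bw (elts (List.ofFn a)))) • word (List.ofFn a) := by
  obtain ⟨n, rfl⟩ := Nat.exists_eq_succ_of_ne_zero hn
  have hb : m.b (n + 1) (fun r => arrowElt k H (a r)) = m.bw (elts (List.ofFn a)) :=
    m.b_eq_bw _ _ (by rw [elts, List.length_map, List.length_ofFn]) fun i => by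
      rw [elts, List.map_ofFn, List.getD_eq_getElem _ _ (by rw [List.length_ofFn]; exact i.2),
        List.getElem_ofFn]; rfl
  rw [pathTerm_apply, hb]
  have hw : (List.ofFn fun r => arrowDual k H (a r)) = (List.ofFn a).map (arrowDual k H) := by
    simp [List.map_ofFn]; rfl
  rw [hw, List.ofFn_succ, List.map_cons, List.prod_cons, ← mul_assoc, ofScalar_mul_arrowDual,
    smul_mul_assoc, word_cons]
  congr 1
  have := m.eS_smul_bw_cons (arrowElt k H (a 0)) (elts (List.ofFn fun i : Fin n => a i.succ))
    (a 0).tgt (a 0).eS_smul_elt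
  rw [show elts (a 0 :: List.ofFn fun i : Fin n => a i.succ) =
    arrowElt k H (a 0) :: elts (List.ofFn fun i : Fin n => a i.succ) from rfl, ← this, hφ,
    sumS_eS_mul, Pi.mul_apply]
  simp

theorem extW_smul_right (w : GenW k H) (s : P → k) (z : YAlg H.Δ) :
    extW H w (s • z) = s * extW H w z := by
  have hJ : H.projJ (k := k) (s • z 0) = s • H.projJ (k := k) (z 0) := by
    have hz : z 0 ∈ LinearMap.range (scalarS k H.Δ) ⊔ radJ k := by
      rw [(H.isCompl (k := k)).sup_eq_top]; trivial
    obtain ⟨_, ⟨c, rfl⟩, j, hj, hz⟩ := Submodule.mem_sup.1 hz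
    have h3 : s • (scalarS k H.Δ c + j) =
        scalarS k H.Δ (s * c) + (s • (⟨j, hj⟩ : radJ k (Δ := H.Δ))).1 := by
      rw [smul_add, smul_scalarS]; rfl
    have h4 : H.projJ (k := k) (scalarS k H.Δ c + j) = ⟨j, hj⟩ := by
      rw [LinearMap.map_add, projJ_scalarS, zero_add]; exact projJ_coe H ⟨j, hj⟩
    rw [← hz, h4, h3, LinearMap.map_add, projJ_scalarS, zero_add, projJ_coe]
  rw [extW_apply, extW_apply]
  change w.1 (s • z 1) + w.2 (H.projJ (k := k) (s • z 0)) = s * (w.1 (z 1) + w.2 (H.projJ (z 0)))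
  rw [hJ, map_smul, map_smul, mul_add]; rfl

theorem ext2_smul_right (ζ : HatDual (P → k) (YExt H.Δ 2)) (s : P → k) (z : YAlg H.Δ) :
    ext2 H ζ (s • z) = s * ext2 H ζ z := by
  change ζ (s • z 2) = s * ζ (z 2)
  rw [map_smul]; rfl

theorem card_add_two_le_wordBound : Fintype.card P + 2 ≤ wordBound P := by
  rw [wordBound]; omega

theorem StrictAInfinity.bw_eq_zero_of_wordBound_lt (l : List (Arrow k H))
    (h : wordBound P < l.length) : m.bw (elts l) = 0 := by
  by_contra h0
  have h1 := m.length_le_of_bw_ne_zero l (by rintro rfl; simp at h) h0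
  have := card_add_two_le_wordBound (P := P)
  omega

theorem exists_inl_of_dashCount_eq_zero (l : List (Arrow k H)) (h : dashCount l = 0)
    (x : Arrow k H) (hx : x ∈ l) : ∃ a, x = Sum.inl a := by
  induction l with
  | nil => simp at hx
  | cons y l ih =>
    rw [dashCount_cons] at h
    rcases List.mem_cons.1 hx with rfl | hx
    · rcases x with a | a
      · exact ⟨a, rfl⟩
      · exact absurd h (by simp [Arrow.deg])
    · exact ih (by omega) hx

theorem finsum_eq_sum_Icc {N : Type*} [AddCommMonoid N] (f : ℕ → N) (B : ℕ)
    (hf : ∀ n, B < n → f n = 0) : ∑ᶠ (n : ℕ) (_ : 2 ≤ n), f n = ∑ n ∈ Finset.Icc 2 B, f n := by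
  refine finsum_cond_eq_sum_of_cond_iff f fun {n} hn => ?_
  rw [Finset.mem_Icc]
  refine ⟨fun h => ⟨h, ?_⟩, fun h => h.1⟩
  by_contra hB
  exact hn (hf n (by omega))

/-- The values of `δ` on generators are cobar elements. The defining sum over all `n` is finite since
long words do not contribute. -/
theorem StrictAInfinity.deltaGen_eq (w : GenW k H) :
    m.deltaGen w = m.cobar (genFunctional H w) := by
  rw [deltaGen, finsum_eq_sum_Icc _ (wordBound P), LinearMap.sum_apply, cobar_apply]
  · refine Finset.sum_congr rfl fun n hn => ?_
    rw [finsum_eq_sum_of_fintype, LinearMap.sum_apply, wsum_eq_sum_ofFn]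
    refine Finset.sum_congr rfl fun a _ => ?_
    exact m.pathTerm_eq (by have := (Finset.mem_Icc.1 hn).1; omega) a _ (extW_smul_right w)
  · intro n hn
    rw [finsum_eq_sum_of_fintype]
    refine Finset.sum_eq_zero fun a _ => LinearMap.ext fun w => ?_
    refine (m.pathTerm_eq (by omega) a _ (extW_smul_right w)).trans ?_
    rw [m.bw_eq_zero_of_wordBound_lt _ (by simpa using hn), map_zero, map_zero, zero_smul]; rfl

theorem StrictAInfinity.beta_eq (ζ : HatDual (P → k) (YExt H.Δ 2)) :
    m.beta ζ = m.cobar (extTwoFunctional H ζ) := by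
  rw [beta, finsum_eq_sum_Icc _ (wordBound P), LinearMap.sum_apply, cobar_apply]
  · refine Finset.sum_congr rfl fun n hn => ?_
    have hn0 : n ≠ 0 := by have := (Finset.mem_Icc.1 hn).1; omega
    rw [finsum_eq_sum_of_fintype, LinearMap.sum_apply, wsum_eq_sum_ofFn]
    refine Fintype.sum_of_injective (fun a r => Sum.inl (a r))
      (fun a b h => funext fun r => Sum.inl_injective (congrFun h r)) _ _ (fun a ha => ?_) fun a => ?_
    · have hd : dashCount (List.ofFn a) ≠ 0 := fun h0 => ha <| by
        choose b hb using fun r => exists_inl_of_dashCount_eq_zero _ h0 (a r)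
          (List.mem_ofFn.2 ⟨r, rfl⟩)
        exact ⟨b, funext fun r => (hb r).symm⟩
      rw [extTwoFunctional_apply, m.bw_elts_apply _ (by simpa using hn0) 2 (by omega), map_zero,
        zero_smul]
    · exact m.pathTerm_eq hn0 _ _ (ext2_smul_right ζ)
  · intro n hn
    rw [finsum_eq_sum_of_fintype]
    refine Finset.sum_eq_zero fun a _ => LinearMap.ext fun ζ => ?_
    refine (m.pathTerm_eq (by omega) _ _ (ext2_smul_right ζ)).trans ?_
    rw [m.bw_eq_zero_of_wordBound_lt _ (by simpa using hn), map_zero, map_zero, zero_smul]; rfl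

end Cobar

/-! ### The square of the differential -/

section Square
open BimodTensorAlgebra
variable {k Λ P : Type u} [Field k] [IsAlgClosed k] [Ring Λ] [Algebra k Λ] [Module.Finite k Λ]
  [DecidableEq P] [Fintype P] [Preorder P] {H : HomologicalSystem Λ P}
  (m : StrictAInfinity k H.Δ)

theorem wsum_comm {X M : Type u} [Fintype X] [AddCommMonoid M] (p q : ℕ)
    (f : List X → List X → M) :
    wsum p (fun l => wsum q (f l)) = wsum q fun l' => wsum p fun l => f l l' := by
  induction p generalizing f with
  | zero => rfl
  | succ p ih =>
    simp only [wsum_succ, ih]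
    exact (wsum_sum _ _ _).symm

theorem neg_one_pow_mul_eq_smul {T : Type u} [Ring T] [Algebra k T] (d : ℕ) (x : T) :
    (-1 : T) ^ d * x = (-1 : k) ^ d • x := by
  rcases Nat.even_or_odd d with h | h <;> simp [h.neg_one_pow]

theorem StrictAInfinity.delta_one : m.delta 1 = 0 := by
  rw [← map_one (ofScalar k (P → k) (GenW k H)), delta_ofScalar]

theorem StrictAInfinity.delta_arrowDual (x : Arrow k H) :
    m.delta (arrowDual k H x) = m.cobar (genFunctional H x.gen) := by
  rw [← ofBimod_gen, delta_ofBimod, deltaGen_eq]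

/-- The graded Leibniz rule on a sum over words: the differential hits one letter after the other. -/
theorem StrictAInfinity.wsum_smul_delta_word (n : ℕ) (c : List (Arrow k H) → k) :
    wsum n (fun l => c l • m.delta (word l)) =
      ∑ r ∈ Finset.range n, wsum r fun l₁ => wsum (n - 1 - r) fun l₂ => (-1 : k) ^ dashCount l₁ •
        (word l₁ * (∑ x, c (l₁ ++ x :: l₂) • m.delta (arrowDual k H x)) * word l₂) := by
  induction n generalizing c with
  | zero => simp only [wsum, word_nil, m.delta_one, smul_zero, Finset.range_zero, Finset.sum_empty]
  | succ n ih =>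
    rw [Finset.sum_range_succ', wsum_succ, add_comm]
    have h1 (x : Arrow k H) : wsum n (fun l => c (x :: l) • m.delta (word (x :: l))) =
        wsum n (fun l => c (x :: l) • (m.delta (arrowDual k H x) * word l)) +
        ∑ r ∈ Finset.range n, wsum r fun l₁ => wsum (n - 1 - r) fun l₂ =>
          (-1 : k) ^ dashCount (x :: l₁) • (word (x :: l₁) *
          (∑ y, c (x :: l₁ ++ y :: l₂) • m.delta (arrowDual k H y)) * word l₂) := by
      have h2 := congrArg (LinearMap.mulLeft k ((-1 : k) ^ x.deg • arrowDual k H x))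
        (ih fun l => c (x :: l))
      rw [map_wsum, map_sum] at h2
      simp only [map_wsum] at h2
      have h3 : ∀ l₁ l₂, LinearMap.mulLeft k ((-1 : k) ^ x.deg • arrowDual k H x)
          ((-1 : k) ^ dashCount l₁ • (word l₁ *
          (∑ y, c (x :: (l₁ ++ y :: l₂)) • m.delta (arrowDual k H y)) * word l₂)) =
          (-1 : k) ^ dashCount (x :: l₁) • (word (x :: l₁) *
          (∑ y, c (x :: l₁ ++ y :: l₂) • m.delta (arrowDual k H y)) * word l₂) := by
        intro l₁ l₂
        rw [LinearMap.mulLeft_apply, dashCount_cons, pow_add, word_cons, smul_mul_assoc,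
          mul_smul_comm, smul_smul]
        simp only [mul_assoc, List.cons_append]
      simp only [h3] at h2
      rw [← h2, ← wsum_add_distrib]
      refine wsum_congr fun l _ => ?_
      rw [word_cons, m.delta_mul (arrowDual_mem_gradeT x), smul_add, neg_one_pow_mul_eq_smul (k := k)]
      congr 1
      rw [LinearMap.mulLeft_apply, mul_smul_comm, smul_mul_assoc]
    simp only [h1]
    rw [Finset.sum_add_distrib]
    congr 1
    · rw [← wsum_sum]
      change _ = wsum (n + 1 - 1 - 0) _
      refine wsum_congr fun l _ => ?_
      simp only [List.nil_append, dashCount_nil, pow_zero, one_smul, word_nil, one_mul,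
        Finset.sum_mul, smul_mul_assoc]
    · rw [Finset.sum_comm]
      refine Finset.sum_congr rfl fun r _ => ?_
      rw [wsum_succ]
      have : n + 1 - 1 - (r + 1) = n - 1 - r := by omega
      rw [this]

/-- The differential applied to the linear part of a functional `μ`: the bar operations take their
values in `J ⊕ Ext¹ ⊕ Ext²`, so that the missing part is the restriction of `μ` to `Ext²`. -/
theorem StrictAInfinity.sum_smul_delta_arrowDual (μ : YAlg H.Δ →ₗ[k] k) :
    ∑ x, μ (arrowElt k H x) • m.delta (arrowDual k H x) =
      m.cobar μ - m.cobar (μ ∘ₗ projTwo (k := k) H) := by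
  have h : m.cobar μ = m.cobar (∑ x : Arrow k H, μ (arrowElt k H x) • genFunctional H x.gen +
      μ ∘ₗ projTwo (k := k) H) := by
    refine m.cobar_congr fun l hl => ?_
    conv_lhs => rw [expand_in_arrows (k := k) (m.bw (elts l)) (m.bw_elts_zero_mem_radJ l hl)
      fun e he => m.bw_elts_apply l (by rintro rfl; simp at hl) e (by omega)]
    rw [map_add, map_sum, LinearMap.add_apply, LinearMap.sum_apply]
    congr 1
    refine Finset.sum_congr rfl fun x _ => ?_
    rw [map_smul, LinearMap.smul_apply, smul_eq_mul, smul_eq_mul, mul_comm]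
  rw [h, map_add, add_sub_cancel_right, map_sum]
  refine Finset.sum_congr rfl fun x _ => ?_
  rw [map_smul, delta_arrowDual]

/-- Two parametrizations of the triples `(r, s, t)` of lengths of the parts of a subdivided word: by the
length `r + 1 + t` of the outer word, and by the total length `r + s + t`. The summands outside the
range of the first parametrization are required to vanish. -/
theorem sum_triples {M : Type u} [AddCommMonoid M] (G : ℕ → ℕ → ℕ → M) (B : ℕ)
    (h : ∀ r s t, 1 ≤ s → ¬ (2 ≤ s ∧ s ≤ B ∧ 1 ≤ r + t ∧ r + t + 1 ≤ B) → G r s t = 0) :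
    ∑ n ∈ Finset.Icc 2 B, ∑ r ∈ Finset.range n, ∑ s ∈ Finset.Icc 2 B, G r s (n - 1 - r) =
      ∑ n ∈ Finset.range (2 * B), ∑ r ∈ Finset.range n, ∑ s ∈ Finset.Icc 1 (n - r),
        G r s (n - r - s) := by
  let C := Finset.range (2 * B) ×ˢ Finset.Icc 1 (2 * B) ×ˢ Finset.range (2 * B)
  trans ∑ x ∈ C, G x.1 x.2.1 x.2.2
  · simp only [Finset.sum_sigma']
    refine Finset.sum_of_injOn (fun x => (x.2.1, x.2.2, x.1 - 1 - x.2.1)) ?_ ?_ ?_ ?_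
    · rintro ⟨n, r, s⟩ h1 ⟨n', r', s'⟩ h2 h3
      simp only [Finset.coe_sigma, Set.mem_sigma_iff, Finset.mem_coe,
        Finset.mem_Icc, Finset.mem_range, Prod.mk.injEq] at h1 h2 h3
      obtain ⟨rfl, rfl, h3⟩ := h3
      obtain rfl : n = n' := by omega
      rfl
    · rintro ⟨n, r, s⟩ h1
      simp only [Finset.coe_sigma, Set.mem_sigma_iff, Finset.mem_coe,
        Finset.mem_Icc, Finset.mem_range, C, Finset.mem_product] at h1 ⊢
      omega
    · rintro ⟨r, s, t⟩ hC h2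
      simp only [C, Finset.mem_product, Finset.mem_Icc] at hC
      refine h r s t hC.2.1.1 fun h3 => h2 ⟨⟨r + t + 1, r, s⟩, ?_, ?_⟩
      · simp only [Finset.coe_sigma, Set.mem_sigma_iff, Finset.mem_coe,
          Finset.mem_Icc, Finset.mem_range]
        omega
      · simp only [Prod.mk.injEq, true_and]; omega
    · rintro ⟨n, r, s⟩ -; rfl
  · simp only [Finset.sum_sigma']
    symm
    refine Finset.sum_of_injOn (fun x => (x.2.1, x.2.2, x.1 - x.2.1 - x.2.2)) ?_ ?_ ?_ ?_
    · rintro ⟨n, r, s⟩ h1 ⟨n', r', s'⟩ h2 h3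
      simp only [Finset.coe_sigma, Set.mem_sigma_iff, Finset.mem_coe,
        Finset.mem_Icc, Finset.mem_range, Prod.mk.injEq] at h1 h2 h3
      obtain ⟨rfl, rfl, h3⟩ := h3
      obtain rfl : n = n' := by omega
      rfl
    · rintro ⟨n, r, s⟩ h1
      simp only [Finset.coe_sigma, Set.mem_sigma_iff, Finset.mem_coe,
        Finset.mem_Icc, Finset.mem_range, C, Finset.mem_product] at h1 ⊢
      omega
    · rintro ⟨r, s, t⟩ hC h2
      simp only [C, Finset.mem_product, Finset.mem_Icc] at hC
      refine h r s t hC.2.1.1 fun h3 => h2 ⟨⟨r + s + t, r, s⟩, ?_, ?_⟩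
      · simp only [Finset.coe_sigma, Set.mem_sigma_iff, Finset.mem_coe,
          Finset.mem_Icc, Finset.mem_range]
        omega
      · simp only [Prod.mk.injEq, true_and]; omega
    · rintro ⟨n, r, s⟩ -; rfl

/-- The Stasheff identities, summed over all words of length `n`. -/
theorem StrictAInfinity.sum_stasheff_word (f : YAlg H.Δ →ₗ[k] k) (n : ℕ) :
    ∑ r ∈ Finset.range n, ∑ s ∈ Finset.Icc 1 (n - r), wsum r (fun l₁ => wsum (n - r - s) fun l₂ =>
      wsum s fun l' : List (Arrow k H) => (-1 : k) ^ dashCount l₁ •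
        (f (m.bw (elts l₁ ++ m.bw (elts l') :: elts l₂)) • (word l₁ * word l' * word l₂))) = 0 := by
  rcases Nat.eq_zero_or_pos n with rfl | hn
  · rfl
  have key : wsum n (fun L : List (Arrow k H) => ∑ r ∈ Finset.range n, ∑ s ∈ Finset.Icc 1 (n - r),
      (-1 : k) ^ dashCount (L.take r) • (f (m.bw (elts (L.take r) ++
        m.bw (elts ((L.drop r).take s)) :: elts (L.drop (r + s)))) • word L)) = 0 := by
    refine wsum_eq_zero fun L hL => ?_
    have h := m.stasheff_bw (L.map Arrow.hom) (by rintro h; simp at h; simp [h] at hL; omega)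
    have h1 := congrArg (fun z => f z • word L) h
    simp only [map_sum, Finset.sum_smul, map_zero, zero_smul, List.length_map, hL] at h1
    refine Eq.trans ?_ h1
    refine Finset.sum_congr rfl fun r hr => Finset.sum_congr rfl fun s _ => ?_
    rw [map_smul, smul_assoc, ← List.map_take, ← List.map_drop, ← List.map_drop, ← List.map_take,
      map_val_map_hom, map_val_map_hom, map_val_map_hom]
    congr 1
    have h2 := solidCount_add_dashCount (L.take r)
    have h3 : (L.take r).length = r := by
      rw [List.length_take, hL]; exact min_eq_left (Finset.mem_range.1 hr).le
    change _ = (-1 : k) ^ (solidCount (L.take r) + r)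
    have h4 : solidCount (L.take r) + r =
        solidCount (L.take r) + solidCount (L.take r) + dashCount (L.take r) := by omega
    rw [h4, pow_add, Even.neg_one_pow ⟨_, rfl⟩, one_mul]
  rw [wsum_sum] at key
  refine Eq.trans (Finset.sum_congr rfl fun r hr => ?_) key
  rw [wsum_sum]
  refine Finset.sum_congr rfl fun s hs => ?_
  rw [Finset.mem_range] at hr
  rw [Finset.mem_Icc] at hs
  have hn : n = r + (s + (n - r - s)) := by omega
  conv_rhs => rw [hn, wsum_add]
  refine wsum_congr fun l₁ h₁ => ?_
  rw [wsum_add, wsum_comm]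
  refine wsum_congr fun l' h' => wsum_congr fun l₂ h₂ => ?_
  subst h₁ h'
  have e1 : (l₁ ++ (l' ++ l₂)).take l₁.length = l₁ := by simp
  have e2 : ((l₁ ++ (l' ++ l₂)).drop l₁.length).take l'.length = l' := by simp
  have e3 : (l₁ ++ (l' ++ l₂)).drop (l₁.length + l'.length) = l₂ := by
    rw [← List.append_assoc, ← List.length_append]; simp
  rw [e1, e2, e3, word_append, word_append, mul_assoc]

/-- The sum of the Stasheff identities over all lengths, ordered by the outer word: the inner operations
are collected into a cobar element. -/
theorem StrictAInfinity.sum_word_cobar_word (f : YAlg H.Δ →ₗ[k] k) :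
    ∑ n ∈ Finset.Icc 2 (wordBound P), ∑ r ∈ Finset.range n, wsum r (fun l₁ =>
      wsum (n - 1 - r) fun l₂ : List (Arrow k H) => (-1 : k) ^ dashCount l₁ •
        (word l₁ * m.cobar (f ∘ₗ m.bwMid (elts l₁) (elts l₂)) * word l₂)) = 0 := by
  let G : ℕ → ℕ → ℕ → TDelta k H := fun r s t => wsum r (fun l₁ => wsum t fun l₂ =>
      wsum s fun l' : List (Arrow k H) => (-1 : k) ^ dashCount l₁ •
        (f (m.bw (elts l₁ ++ m.bw (elts l') :: elts l₂)) • (word l₁ * word l' * word l₂)))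
  have h1 : ∀ n r, wsum r (fun l₁ =>
      wsum (n - 1 - r) fun l₂ : List (Arrow k H) => (-1 : k) ^ dashCount l₁ •
        (word l₁ * m.cobar (f ∘ₗ m.bwMid (elts l₁) (elts l₂)) * word l₂)) =
      ∑ s ∈ Finset.Icc 2 (wordBound P), G r s (n - 1 - r) := by
    intro n r
    rw [← wsum_sum]
    refine wsum_congr fun l₁ _ => ?_
    rw [← wsum_sum]
    refine wsum_congr fun l₂ _ => ?_
    rw [cobar_apply, Finset.mul_sum, Finset.sum_mul, Finset.smul_sum]
    refine Finset.sum_congr rfl fun s _ => ?_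
    have := map_wsum ((((-1 : k) ^ dashCount l₁) • LinearMap.mulRight k (word l₂) ∘ₗ
      LinearMap.mulLeft k (word l₁)) : TDelta k H →ₗ[k] TDelta k H) s
      (fun l => (f ∘ₗ m.bwMid (elts l₁) (elts l₂)) (m.bw (elts l)) • word l)
    refine this.trans (wsum_congr fun l' _ => ?_)
    rw [LinearMap.smul_apply, map_smul]
    rfl
  simp only [h1]
  rw [sum_triples]
  · refine Finset.sum_eq_zero fun n _ => ?_
    exact m.sum_stasheff_word f n
  · intro r s t hs h
    refine wsum_eq_zero fun l₁ h₁ => wsum_eq_zero fun l₂ h₂ => wsum_eq_zero fun l' h' => ?_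
    suffices h0 : m.bw (elts l₁ ++ m.bw (elts l') :: elts l₂) = 0 by
      rw [h0, map_zero, zero_smul, smul_zero]
    by_contra h0
    have hin : m.bw (elts l') ≠ 0 := fun h3 => h0 (by rw [h3, ← bwMid_apply, map_zero])
    have hs1 : l'.length ≠ 1 := fun h3 => by
      obtain ⟨x, rfl⟩ := List.length_eq_one_iff.1 h3
      exact hin (m.bw_singleton _)
    have hrt : l₁.length + l₂.length ≠ 0 := fun h3 => by
      have e1 : l₁ = [] := List.eq_nil_of_length_eq_zero (by omega)
      have e2 : l₂ = [] := List.eq_nil_of_length_eq_zero (by omega)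
      subst e1 e2
      exact h0 (m.bw_singleton _)
    rcases l' with _ | ⟨x, l'⟩
    · exact absurd h' (by rw [List.length_nil]; omega)
    · have h3 := m.length_le_of_bw_ne_zero _ (by simp) hin
      have h4 := m.length_le_of_bw_bw_ne_zero l₁ _ l₂ (by simp) h0
      simp only [List.length_cons] at h3 hs1 h'
      rw [wordBound] at h
      omega

/-- The square of the differential on a cobar element: by the Stasheff identities only the part
that factors through `Ext²` remains. -/
theorem StrictAInfinity.delta_cobar (f : YAlg H.Δ →ₗ[k] k) :
    m.delta (m.cobar f) = - ∑ n ∈ Finset.Icc 2 (wordBound P), ∑ r ∈ Finset.range n,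
      wsum r (fun l₁ => wsum (n - 1 - r) fun l₂ : List (Arrow k H) => (-1 : k) ^ dashCount l₁ •
        (word l₁ * m.cobar ((f ∘ₗ m.bwMid (elts l₁) (elts l₂)) ∘ₗ projTwo (k := k) H) *
          word l₂)) := by
  rw [cobar_apply, map_sum]
  rw [eq_neg_iff_add_eq_zero, ← m.sum_word_cobar_word f, ← Finset.sum_add_distrib]
  refine Finset.sum_congr rfl fun n _ => ?_
  rw [map_wsum]
  simp only [map_smul]
  rw [m.wsum_smul_delta_word, ← Finset.sum_add_distrib]
  refine Finset.sum_congr rfl fun r _ => ?_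
  rw [← wsum_add_distrib]
  refine wsum_congr fun l₁ _ => ?_
  rw [← wsum_add_distrib]
  refine wsum_congr fun l₂ _ => ?_
  have : ∀ x : Arrow k H, f (m.bw (elts (l₁ ++ x :: l₂))) =
      (f ∘ₗ m.bwMid (elts l₁) (elts l₂)) (arrowElt k H x) := fun x => by
    simp [elts, bwMid_apply]
  simp only [this]
  rw [m.sum_smul_delta_arrowDual, ← smul_add, mul_sub, sub_mul, sub_add_cancel]

end Square

/-! ### The weak ditalgebra and the interlacing -/

section Interlacing
open BimodTensorAlgebra
variable {k Λ P : Type u} [Field k] [IsAlgClosed k] [Ring Λ] [Algebra k Λ] [Module.Finite k Λ]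
  [DecidableEq P] [Fintype P] [Preorder P] {H : HomologicalSystem Λ P}
  (m : StrictAInfinity k H.Δ)

theorem StrictAInfinity.cobar_mem {f : YAlg H.Δ →ₗ[k] k} {p : Submodule k (TDelta k H)}
    (h : ∀ l : List (Arrow k H), 2 ≤ l.length → f (m.bw (elts l)) ≠ 0 → word l ∈ p) :
    m.cobar f ∈ p := by
  rw [cobar_apply]
  refine sum_mem fun n hn => wsum_mem fun l hl => ?_
  by_cases h0 : f (m.bw (elts l)) = 0
  · rw [h0, zero_smul]; exact zero_mem p
  · exact Submodule.smul_mem _ _ (h l (by rw [hl]; exact (Finset.mem_Icc.1 hn).1) h0)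

theorem StrictAInfinity.dashCount_eq_of_apply_ne_zero {l : List (Arrow k H)} (hl : 2 ≤ l.length)
    {e : ℕ} (h : m.bw (elts l) e ≠ 0) : e + dashCount l = 2 := by
  by_contra h0
  exact h (m.bw_elts_apply l (by rintro rfl; simp at hl) e h0)

theorem genFunctional_inl_apply (φ : HatDual (P → k) (YExt H.Δ 1)) (z : YAlg H.Δ) :
    genFunctional H (LinearMap.inl k _ _ φ) z = HatDual.functional φ (z 1) := by
  rw [genFunctional_apply]
  change HatDual.functional φ (z 1) + HatDual.functional 0 _ = _
  rw [map_zero, LinearMap.zero_apply, add_zero]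

theorem genFunctional_inr_apply (ψ : HatDual (P → k) (radJ k (Δ := H.Δ))) (z : YAlg H.Δ) :
    genFunctional H (LinearMap.inr k _ _ ψ) z =
      HatDual.functional ψ (H.projJ (k := k) (z 0)) := by
  rw [genFunctional_apply]
  change HatDual.functional 0 _ + HatDual.functional ψ _ = _
  rw [map_zero, LinearMap.zero_apply, zero_add]

theorem StrictAInfinity.delta_ofSolid (φ : HatDual (P → k) (YExt H.Δ 1)) :
    m.delta (ofSolid k H φ) = m.cobar (genFunctional H (LinearMap.inl k _ _ φ)) :=
  (m.delta_ofBimod _).trans (m.deltaGen_eq _)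

theorem StrictAInfinity.delta_ofDashed (ψ : HatDual (P → k) (radJ k (Δ := H.Δ))) :
    m.delta (ofDashed k H ψ) = m.cobar (genFunctional H (LinearMap.inr k _ _ ψ)) :=
  (m.delta_ofBimod _).trans (m.deltaGen_eq _)

theorem StrictAInfinity.cobar_mem_gradeT {f : YAlg H.Δ →ₗ[k] k} {d e : ℕ} (hd : e + d = 2)
    (hf : ∀ z : YAlg H.Δ, z e = 0 → f z = 0) : m.cobar f ∈ gradeT k H d := by
  refine m.cobar_mem fun l hl h => ?_
  have := m.dashCount_eq_of_apply_ne_zero hl (e := e) fun h0 => h (hf _ h0)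
  have h1 : dashCount l = d := by omega
  rw [← h1]
  exact word_mem_gradeT l

theorem StrictAInfinity.delta_ofSolid_mem (φ : HatDual (P → k) (YExt H.Δ 1)) :
    m.delta (ofSolid k H φ) ∈ gradeT k H 1 := by
  rw [delta_ofSolid]
  refine m.cobar_mem_gradeT (e := 1) rfl fun z hz => ?_
  rw [genFunctional_inl_apply, hz, map_zero]

theorem StrictAInfinity.delta_ofDashed_mem (ψ : HatDual (P → k) (radJ k (Δ := H.Δ))) :
    m.delta (ofDashed k H ψ) ∈ gradeT k H 2 := by
  rw [delta_ofDashed]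
  refine m.cobar_mem_gradeT (e := 0) rfl fun z hz => ?_
  rw [genFunctional_inr_apply, hz, map_zero, map_zero]

theorem StrictAInfinity.beta_mem (ζ : HatDual (P → k) (YExt H.Δ 2)) :
    m.beta ζ ∈ gradeT k H 0 := by
  rw [beta_eq]
  refine m.cobar_mem_gradeT (e := 2) rfl fun z hz => ?_
  rw [extTwoFunctional_apply, hz, map_zero]

theorem StrictAInfinity.delta_mem {d : ℕ} {x : TDelta k H} (hx : x ∈ gradeT k H d) :
    m.delta x ∈ gradeT k H (d + 1) := by
  refine gradeT_induction k H (p := fun d x => m.delta x ∈ gradeT k H (d + 1))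
    (fun x hx => ?_) m.delta_ofDashed_mem (fun d x y hx hy => ?_)
    (fun d e n x y hn hx hy hx' hy' => ?_) hx
  · rw [gradeT_zero] at hx
    refine algebraA_induction k H (p := fun x => m.delta x ∈ gradeT k H 1) hx (fun s => ?_)
      m.delta_ofSolid_mem (fun x y hx hy => ?_) fun x y hx hy hx' hy' => ?_
    · rw [delta_ofScalar]; exact zero_mem _
    · rw [map_add]; exact add_mem hx hy
    · rw [← Subalgebra.mem_toSubmodule, ← gradeT_zero] at hx hy
      rw [m.delta_mul hx, pow_zero, one_mul]
      exact add_mem (mul_mem_gradeT k H (add_zero 1) hx' hy) (mul_mem_gradeT k H (zero_add 1) hx hy')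
  · rw [map_add]; exact add_mem hx hy
  · rw [m.delta_mul hx, neg_one_pow_mul_eq_smul (k := k)]
    exact add_mem (mul_mem_gradeT k H (by omega) hx' hy)
      (Submodule.smul_mem _ _ (mul_mem_gradeT k H (by omega) hx hy'))

theorem StrictAInfinity.isWeakDitalgebra : IsWeakDitalgebra (gradeT k H) m.delta where
  graded := gradedMonoid_gradeT k H
  internal := isInternal_gradeT k H
  free := ⟨algebraA k H, (gradeT_zero k H).symm, freelyGenerated_algebraA k H⟩
  degree _ _ hx := m.delta_mem hx
  leibniz _ _ hx y := m.delta_mul hx y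

theorem StrictAInfinity.idealI_eq :
    m.idealI = gradeT k H 0 * LinearMap.range m.beta * gradeT k H 0 := by
  rw [gradeT_zero]; rfl

theorem gradeT_zero_mul_self : gradeT k H 0 * gradeT k H 0 = gradeT k H 0 :=
  gradeT_mul_gradeT k H 0 0

theorem StrictAInfinity.gradeT_zero_mul_idealI : gradeT k H 0 * m.idealI = m.idealI := by
  rw [idealI_eq, ← mul_assoc, ← mul_assoc, gradeT_zero_mul_self]

theorem StrictAInfinity.idealI_mul_gradeT_zero : m.idealI * gradeT k H 0 = m.idealI := by
  rw [idealI_eq, mul_assoc, gradeT_zero_mul_self]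

theorem StrictAInfinity.beta_mem_idealI (ζ : HatDual (P → k) (YExt H.Δ 2)) :
    m.beta ζ ∈ m.idealI := by
  rw [idealI_eq]
  have := Submodule.mul_mem_mul (Submodule.mul_mem_mul (one_mem_gradeT k H)
    (LinearMap.mem_range_self m.beta ζ)) (one_mem_gradeT k H)
  rwa [one_mul, mul_one] at this

theorem StrictAInfinity.idealI_le : m.idealI ≤ gradeT k H 0 := by
  rw [idealI_eq, Submodule.mul_le]
  intro x hx y hy
  refine mul_mem_gradeT k H (add_zero 0) ?_ hy
  refine Submodule.mul_le.2 ?_ hx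
  rintro a ha _ ⟨ζ, rfl⟩
  exact mul_mem_gradeT k H (add_zero 0) ha (m.beta_mem ζ)

/-- The part of degree `n` of the ideal of `T(Δ)` generated by `I`. -/
noncomputable def StrictAInfinity.idealT (n : ℕ) : Submodule k (TDelta k H) :=
  ⨆ x : {x : ℕ × ℕ // x.1 + x.2 = n}, gradeT k H x.1.1 * m.idealI * gradeT k H x.1.2

theorem StrictAInfinity.mul_mem_idealT {i j n : ℕ} (h : i + j = n) {a x b : TDelta k H}
    (ha : a ∈ gradeT k H i) (hx : x ∈ m.idealI) (hb : b ∈ gradeT k H j) :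
    a * x * b ∈ m.idealT n :=
  Submodule.mem_iSup_of_mem (⟨(i, j), h⟩ : {x : ℕ × ℕ // x.1 + x.2 = n})
    (Submodule.mul_mem_mul (Submodule.mul_mem_mul ha hx) hb)

theorem StrictAInfinity.gradeT_mul_mem_idealT {i n l : ℕ} (h : i + n = l) {a x : TDelta k H}
    (ha : a ∈ gradeT k H i) (hx : x ∈ m.idealT n) : a * x ∈ m.idealT l := by
  suffices h0 : gradeT k H i * m.idealT n ≤ m.idealT l from h0 (Submodule.mul_mem_mul ha hx)
  rw [idealT, Submodule.mul_iSup]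
  refine iSup_le ?_
  rintro ⟨⟨p, q⟩, hpq⟩
  rw [← mul_assoc, ← mul_assoc, gradeT_mul_gradeT]
  exact le_iSup (fun x : {x : ℕ × ℕ // x.1 + x.2 = l} =>
    gradeT k H x.1.1 * m.idealI * gradeT k H x.1.2) ⟨(i + p, q), by dsimp only at hpq ⊢; omega⟩

theorem StrictAInfinity.mem_idealT_mul {i n l : ℕ} (h : n + i = l) {a x : TDelta k H}
    (hx : x ∈ m.idealT n) (ha : a ∈ gradeT k H i) : x * a ∈ m.idealT l := by
  suffices h0 : m.idealT n * gradeT k H i ≤ m.idealT l from h0 (Submodule.mul_mem_mul hx ha)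
  rw [idealT, Submodule.iSup_mul]
  refine iSup_le ?_
  rintro ⟨⟨p, q⟩, hpq⟩
  rw [mul_assoc, gradeT_mul_gradeT]
  exact le_iSup (fun x : {x : ℕ × ℕ // x.1 + x.2 = l} =>
    gradeT k H x.1.1 * m.idealI * gradeT k H x.1.2) ⟨(p, q + i), by dsimp only at hpq ⊢; omega⟩

/-- The element of `D̂(B)₋₁` given by the restriction to `Ext²` of a functional on the Yoneda
algebra. -/
noncomputable def extTwoDual (μ : YAlg H.Δ →ₗ[k] k) : HatDual (P → k) (YExt H.Δ 2) :=
  HatDual.functional.symm (μ ∘ₗ DirectSum.lof k ℕ (YExt H.Δ) 2)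

theorem functional_extTwoDual (μ : YAlg H.Δ →ₗ[k] k) (z : YExt H.Δ 2) :
    HatDual.functional (extTwoDual μ) z = μ (homog z) := by
  rw [extTwoDual, LinearEquiv.apply_symm_apply]; rfl

theorem StrictAInfinity.cobar_comp_projTwo (μ : YAlg H.Δ →ₗ[k] k) :
    m.cobar (μ ∘ₗ projTwo (k := k) H) = m.beta (extTwoDual μ) := by
  rw [beta_eq]
  congr 1
  refine LinearMap.ext fun z => ?_
  rw [extTwoFunctional_apply, functional_extTwoDual]; rfl

/-- A criterion for `δ (cobar f)` to lie in a subspace: only the words `l₁`, `l₂` for which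
`z ↦ f (b(l₁, z, l₂))` does not vanish on `Ext²` have to be considered. -/
theorem StrictAInfinity.delta_cobar_mem (f : YAlg H.Δ →ₗ[k] k) (p : Submodule k (TDelta k H))
    (h : ∀ l₁ l₂ : List (Arrow k H), 1 ≤ l₁.length + l₂.length →
      (∃ z : YExt H.Δ 2, f (m.bw (elts l₁ ++ homog z :: elts l₂)) ≠ 0) →
      word l₁ * m.beta (extTwoDual (f ∘ₗ m.bwMid (elts l₁) (elts l₂))) * word l₂ ∈ p) :
    m.delta (m.cobar f) ∈ p := by
  rw [delta_cobar]
  refine neg_mem (sum_mem fun n hn => sum_mem fun r hr => wsum_mem fun l₁ h₁ =>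
    wsum_mem fun l₂ h₂ => Submodule.smul_mem _ _ ?_)
  rw [cobar_comp_projTwo]
  by_cases hz : ∃ z : YExt H.Δ 2, f (m.bw (elts l₁ ++ homog z :: elts l₂)) ≠ 0
  · rw [Finset.mem_Icc] at hn
    rw [Finset.mem_range] at hr
    exact h l₁ l₂ (by omega) hz
  · push Not at hz
    have : extTwoDual (f ∘ₗ m.bwMid (elts l₁) (elts l₂)) = 0 := by
      apply HatDual.functional.injective
      refine LinearMap.ext fun z => ?_
      rw [functional_extTwoDual, map_zero]
      exact hz z
    rw [this, map_zero, mul_zero, zero_mul]; exact zero_mem p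

theorem StrictAInfinity.delta_cobar_mem_idealT {f : YAlg H.Δ →ₗ[k] k} {n e : ℕ} (h : e + n = 3)
    (hf : ∀ z : YAlg H.Δ, z e = 0 → f z = 0) : m.delta (m.cobar f) ∈ m.idealT n := by
  refine m.delta_cobar_mem f _ fun l₁ l₂ _ ⟨z, hz⟩ => ?_
  refine m.mul_mem_idealT ?_ (word_mem_gradeT l₁) (m.beta_mem_idealI _) (word_mem_gradeT l₂)
  by_contra h0
  refine hz (hf _ (m.bw_mid_apply l₁ l₂ ⟨2, z⟩ e ?_))
  change _ ≠ 2 + 1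
  omega

/-- The square of the differential takes its values in the ideal generated by `I`. -/
theorem StrictAInfinity.delta_delta_mem {d : ℕ} {x : TDelta k H} (hx : x ∈ gradeT k H d) :
    m.delta (m.delta x) ∈ m.idealT (d + 2) := by
  have hmul : ∀ d e n x y, d + e = n → x ∈ gradeT k H d → y ∈ gradeT k H e →
      m.delta (m.delta x) ∈ m.idealT (d + 2) → m.delta (m.delta y) ∈ m.idealT (e + 2) →
      m.delta (m.delta (x * y)) ∈ m.idealT (n + 2) := fun d e n x y hn hx hy hx' hy' => by
    rw [m.delta_delta_mul hx (m.delta_mem hx)]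
    exact add_mem (m.mem_idealT_mul (by omega) hx' hy) (m.gradeT_mul_mem_idealT (by omega) hx hy')
  have hadd : ∀ d x y, m.delta (m.delta x) ∈ m.idealT (d + 2) →
      m.delta (m.delta y) ∈ m.idealT (d + 2) → m.delta (m.delta (x + y)) ∈ m.idealT (d + 2) :=
    fun d x y hx hy => by rw [map_add, map_add]; exact add_mem hx hy
  refine gradeT_induction k H (p := fun d x => m.delta (m.delta x) ∈ m.idealT (d + 2))
    (fun x hx => ?_) (fun ψ => ?_) hadd hmul hx
  · rw [gradeT_zero] at hx
    refine algebraA_induction k H (p := fun x => m.delta (m.delta x) ∈ m.idealT (0 + 2)) hx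
      (fun s => ?_) (fun φ => ?_) (hadd 0) fun x y hx hy => ?_
    · rw [delta_ofScalar, map_zero]; exact zero_mem _
    · rw [delta_ofSolid]
      refine m.delta_cobar_mem_idealT (e := 1) rfl fun z hz => ?_
      rw [genFunctional_inl_apply, hz, map_zero]
    · rw [← Subalgebra.mem_toSubmodule, ← gradeT_zero] at hx hy
      exact hmul 0 0 0 x y rfl hx hy
  · rw [delta_ofDashed]
    refine m.delta_cobar_mem_idealT (e := 0) rfl fun z hz => ?_
    rw [genFunctional_inr_apply, hz, map_zero, map_zero]

theorem StrictAInfinity.delta_beta_mem (ζ : HatDual (P → k) (YExt H.Δ 2)) :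
    m.delta (m.beta ζ) ∈ m.idealT 1 := by
  rw [beta_eq]
  refine m.delta_cobar_mem_idealT (e := 2) rfl fun z hz => ?_
  rw [extTwoFunctional_apply, hz, map_zero]

/-- The Leibniz rule for the product of three elements, the first two of which have degree zero. -/
theorem StrictAInfinity.delta_mul_mul {a x : TDelta k H} (ha : a ∈ gradeT k H 0)
    (hx : x ∈ gradeT k H 0) (b : TDelta k H) :
    m.delta (a * x * b) = m.delta a * x * b + a * m.delta x * b + a * x * m.delta b := by
  rw [m.delta_mul (mul_mem_gradeT k H (add_zero 0) ha hx), m.delta_mul ha, pow_zero, one_mul,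
    one_mul, add_mul]

theorem idealI_induction {p : Submodule k (TDelta k H)}
    (h : ∀ a ∈ gradeT k H 0, ∀ ζ, ∀ b ∈ gradeT k H 0, a * m.beta ζ * b ∈ p) : m.idealI ≤ p := by
  rw [StrictAInfinity.idealI_eq, Submodule.mul_le]
  intro x hx b hb
  refine Submodule.mul_induction_on (C := fun x => x * b ∈ p) hx ?_ fun x y hx hy => ?_
  · rintro a ha _ ⟨ζ, rfl⟩
    exact h a ha ζ b hb
  · rw [add_mul]; exact add_mem hx hy

theorem StrictAInfinity.delta_idealI_le : m.idealI.map m.delta ≤ m.idealT 1 := by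
  rw [Submodule.map_le_iff_le_comap]
  refine idealI_induction m fun a ha ζ b hb => ?_
  rw [Submodule.mem_comap, m.delta_mul_mul ha (m.beta_mem ζ)]
  refine add_mem (add_mem ?_ ?_) ?_
  · exact m.mul_mem_idealT (add_zero 1) (m.delta_mem ha) (m.beta_mem_idealI ζ) hb
  · exact m.mem_idealT_mul (add_zero 1) (m.gradeT_mul_mem_idealT (zero_add 1) ha (m.delta_beta_mem ζ)) hb
  · exact m.mul_mem_idealT (zero_add 1) ha (m.beta_mem_idealI ζ) (m.delta_mem hb)

theorem StrictAInfinity.isInterlaced : IsInterlaced (gradeT k H) m.delta m.idealI where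
  le := m.idealI_le
  mul_left := m.gradeT_zero_mul_idealI.le
  mul_right := m.idealI_mul_gradeT_zero.le
  delta_ideal := by
    refine m.delta_idealI_le.trans (iSup_le ?_)
    rintro ⟨⟨p, q⟩, h⟩
    dsimp only at h ⊢
    obtain ⟨rfl, rfl⟩ | ⟨rfl, rfl⟩ : (p = 0 ∧ q = 1) ∨ (p = 1 ∧ q = 0) := by omega
    · rw [gradeT_zero_mul_idealI]; exact le_sup_left
    · rw [mul_assoc, idealI_mul_gradeT_zero]; exact le_sup_right
  delta_sq_zero := by
    rintro _ ⟨x, hx, rfl⟩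
    refine (show m.idealT (0 + 2) ≤ _ from iSup_le ?_) (m.delta_delta_mem hx)
    rintro ⟨⟨p, q⟩, h⟩
    rw [gradeT_pow k H 1]
    dsimp only at h ⊢
    obtain ⟨rfl, rfl⟩ | ⟨rfl, rfl⟩ | ⟨rfl, rfl⟩ :
      (p = 0 ∧ q = 2) ∨ (p = 1 ∧ q = 1) ∨ (p = 2 ∧ q = 0) := by omega
    · rw [gradeT_zero_mul_idealI]; exact le_sup_of_le_left le_sup_left
    · exact le_sup_of_le_left le_sup_right
    · rw [mul_assoc, idealI_mul_gradeT_zero]; exact le_sup_right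
  delta_sq_one := by
    rintro _ ⟨x, hx, rfl⟩
    refine (show m.idealT (1 + 2) ≤ _ from iSup_le ?_) (m.delta_delta_mem hx)
    rintro ⟨⟨p, q⟩, h⟩
    rw [gradeT_pow k H 1, gradeT_pow k H 2]
    dsimp only at h ⊢
    obtain ⟨rfl, rfl⟩ | ⟨rfl, rfl⟩ | ⟨rfl, rfl⟩ | ⟨rfl, rfl⟩ :
      (p = 0 ∧ q = 3) ∨ (p = 1 ∧ q = 2) ∨ (p = 2 ∧ q = 1) ∨ (p = 3 ∧ q = 0) := by omega
    · rw [gradeT_zero_mul_idealI]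
      exact le_sup_of_le_left (le_sup_of_le_left le_sup_left)
    · exact le_sup_of_le_left (le_sup_of_le_left le_sup_right)
    · exact le_sup_of_le_left le_sup_right
    · rw [mul_assoc, idealI_mul_gradeT_zero]; exact le_sup_right

end Interlacing

/-! ### The radical filtration and the weight filtration -/

section RadicalFiltration
variable {k Λ P : Type u} [Field k] [Ring Λ] [Algebra k Λ] {Δ : P → ModuleCat.{u} Λ}

variable (k) in
/-- The map `z ↦ g z f` on `Extᵈ(Δ, Δ)`, for endomorphisms `f` and `g` of `Δ`. -/
noncomputable def YExt.sandwich (g f : Module.End Λ (∀ i, Δ i)) {d : ℕ} :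
    YExt Δ d →ₗ[k] YExt Δ d where
  toFun z := Ext.comp (Ext.comp (Ext.mk₀ (ModuleCat.ofHom f))
    (show Ext (tot Δ) (tot Δ) d from z) (zero_add d)) (Ext.mk₀ (ModuleCat.ofHom g)) (add_zero d)
  map_add' x y := by
    refine Eq.trans ?_ (Ext.add_comp _ _ _ _)
    exact congrArg (fun w => Ext.comp w _ _) (Ext.comp_add _ _ _ _)
  map_smul' c x := by
    refine Eq.trans ?_ (Ext.smul_comp _ _ _ c)
    exact congrArg (fun w => Ext.comp w _ _) (Ext.comp_smul _ _ _ c)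

theorem YExt.sandwich_apply (g f : Module.End Λ (∀ i, Δ i)) {d : ℕ} (z : YExt Δ d) :
    YExt.sandwich k g f z = Ext.comp (Ext.comp (Ext.mk₀ (ModuleCat.ofHom f))
    (show Ext (tot Δ) (tot Δ) d from z) (zero_add d)) (Ext.mk₀ (ModuleCat.ofHom g)) (add_zero d) :=
  rfl

theorem YExt.sandwich_one_one {d : ℕ} (z : YExt Δ d) : YExt.sandwich k 1 1 z = z :=
  (Ext.comp_mk₀_id _).trans (Ext.mk₀_id_comp _)

theorem YExt.sandwich_zero_left (f : Module.End Λ (∀ i, Δ i)) {d : ℕ} (z : YExt Δ d) :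
    YExt.sandwich k 0 f z = 0 := by
  rw [sandwich_apply, ModuleCat.ofHom_zero, Ext.mk₀_zero, Ext.comp_zero]; rfl

theorem YExt.sandwich_zero_right (g : Module.End Λ (∀ i, Δ i)) {d : ℕ} (z : YExt Δ d) :
    YExt.sandwich k g 0 z = 0 := by
  rw [sandwich_apply, ModuleCat.ofHom_zero, Ext.mk₀_zero, Ext.zero_comp, Ext.zero_comp]; rfl

theorem YExt.sandwich_sandwich (g f g' f' : Module.End Λ (∀ i, Δ i)) {d : ℕ} (z : YExt Δ d) :
    YExt.sandwich k g f (YExt.sandwich k g' f' z) = YExt.sandwich k (g * g') (f' * f) z := by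
  have e1 : (ModuleCat.ofHom (g * g') : tot Δ ⟶ tot Δ) =
    ModuleCat.ofHom g' ≫ ModuleCat.ofHom g := rfl
  have e2 : (ModuleCat.ofHom (f' * f) : tot Δ ⟶ tot Δ) =
    ModuleCat.ofHom f ≫ ModuleCat.ofHom f' := rfl
  rw [sandwich_apply (k := k) (g * g'), e1, e2, ← Ext.mk₀_comp_mk₀, ← Ext.mk₀_comp_mk₀]
  have key : ∀ (w : Ext (tot Δ) (tot Δ) d) (a b c e : tot Δ ⟶ tot Δ),
      Ext.comp (Ext.comp (Ext.mk₀ a) (Ext.comp (Ext.comp (Ext.mk₀ b) w (zero_add d))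
        (Ext.mk₀ c) (add_zero d)) (zero_add d)) (Ext.mk₀ e) (add_zero d) =
      Ext.comp (Ext.comp (Ext.comp (Ext.mk₀ a) (Ext.mk₀ b) (zero_add 0)) w (zero_add d))
        (Ext.comp (Ext.mk₀ c) (Ext.mk₀ e) (zero_add 0)) (add_zero d) := fun w a b c e => by
    simp only [Ext.comp_assoc_of_second_deg_zero, Ext.comp_assoc_of_third_deg_zero]
  exact key z _ _ _ _

theorem homog_mul_left (x : YExt Δ 0) {d : ℕ} (z : YExt Δ d) :
    homog (x.mul z) = homog (YExt.sandwich k (YExt.toEnd x) 1 z) := by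
  have h : YExt.sandwich k (YExt.toEnd x) 1 z =
      Ext.comp (show Ext (tot Δ) (tot Δ) d from z) (show Ext (tot Δ) (tot Δ) 0 from x)
        (add_zero d) := by
    rw [YExt.sandwich_apply]
    refine congr_arg₂ (fun a b => Ext.comp a b (add_zero d)) (Ext.mk₀_id_comp _) ?_
    exact YExt.mk₀_toEnd x
  rw [h]
  have key : ∀ e (he : d + 0 = e), (homog (Ext.comp (show Ext (tot Δ) (tot Δ) d from z)
      (show Ext (tot Δ) (tot Δ) 0 from x) he : YExt Δ e) : YAlg Δ) =
      homog (Ext.comp (show Ext (tot Δ) (tot Δ) d from z) (show Ext (tot Δ) (tot Δ) 0 from x)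
        (add_zero d) : YExt Δ d) := by
    rintro _ rfl; rfl
  exact key _ (add_comm d 0)

theorem homog_mul_right (x : YExt Δ 0) {d : ℕ} (z : YExt Δ d) :
    homog (z.mul x) = homog (YExt.sandwich k 1 (YExt.toEnd x) z) := by
  have h : YExt.sandwich k 1 (YExt.toEnd x) z =
      Ext.comp (show Ext (tot Δ) (tot Δ) 0 from x) (show Ext (tot Δ) (tot Δ) d from z)
        (zero_add d) := by
    rw [YExt.sandwich_apply]
    refine (Ext.comp_mk₀_id _).trans ?_
    exact congrArg (fun a => Ext.comp a _ (zero_add d)) (YExt.mk₀_toEnd x)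
  rw [h]
  have key : ∀ e (he : 0 + d = e) (he' : 0 + d = d),
      (homog (Ext.comp (show Ext (tot Δ) (tot Δ) 0 from x)
      (show Ext (tot Δ) (tot Δ) d from z) he : YExt Δ e) : YAlg Δ) =
      homog (Ext.comp (show Ext (tot Δ) (tot Δ) 0 from x) (show Ext (tot Δ) (tot Δ) d from z)
        he' : YExt Δ d) := by
    intro e he he'
    obtain rfl : e = d := by omega
    rfl
  exact key _ (add_comm 0 d) (zero_add d)

variable (k Δ) in
/-- The radical filtration of `Extᵈ(Δ, Δ)`: the span of the elements `g z f` with `g ∈ radᵃ End(Δ)`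
and `f ∈ radᵇ End(Δ)`, where `a + b ≥ p`. -/
noncomputable def radFil (d p : ℕ) : Submodule k (YExt Δ d) :=
  Submodule.span k {z | ∃ a b, p ≤ a + b ∧ ∃ g ∈ Ring.jacobson (Module.End Λ (∀ i, Δ i)) ^ a,
    ∃ f ∈ Ring.jacobson (Module.End Λ (∀ i, Δ i)) ^ b, ∃ y, z = YExt.sandwich k g f y}

theorem sandwich_mem_radFil {d p a b : ℕ} (h : p ≤ a + b) {g f : Module.End Λ (∀ i, Δ i)}
    (hg : g ∈ Ring.jacobson (Module.End Λ (∀ i, Δ i)) ^ a)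
    (hf : f ∈ Ring.jacobson (Module.End Λ (∀ i, Δ i)) ^ b) (y : YExt Δ d) :
    YExt.sandwich k g f y ∈ radFil k Δ d p :=
  Submodule.subset_span ⟨a, b, h, g, hg, f, hf, y, rfl⟩

theorem radFil_le {d p : ℕ} {W : Submodule k (YExt Δ d)}
    (h : ∀ a b, p ≤ a + b → ∀ g ∈ Ring.jacobson (Module.End Λ (∀ i, Δ i)) ^ a,
      ∀ f ∈ Ring.jacobson (Module.End Λ (∀ i, Δ i)) ^ b, ∀ y, YExt.sandwich k g f y ∈ W) :
    radFil k Δ d p ≤ W := by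
  refine Submodule.span_le.2 ?_
  rintro _ ⟨a, b, hab, g, hg, f, hf, y, rfl⟩
  exact h a b hab g hg f hf y

theorem radFil_antitone {d p q : ℕ} (h : p ≤ q) : radFil k Δ d q ≤ radFil k Δ d p :=
  radFil_le fun _ _ hab _ hg _ hf y => sandwich_mem_radFil (h.trans hab) hg hf y

theorem mem_radFil_zero {d : ℕ} (z : YExt Δ d) : z ∈ radFil k Δ d 0 := by
  have h : (1 : Module.End Λ (∀ i, Δ i)) ∈ Ring.jacobson (Module.End Λ (∀ i, Δ i)) ^ 0 :=
    ⟨1, one_smul _ _⟩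
  rw [← YExt.sandwich_one_one (k := k) z]
  exact sandwich_mem_radFil le_rfl h h z

theorem mul_mem_jacobson_pow {R : Type u} [Ring R] {x y : R} {a : ℕ} (hx : x ∈ Ring.jacobson R)
    (hy : y ∈ Ring.jacobson R ^ a) : x * y ∈ Ring.jacobson R ^ (a + 1) := by
  rw [Ideal.IsTwoSided.pow_succ]; exact Ideal.mul_mem_mul hx hy

theorem mul_mem_jacobson_pow' {R : Type u} [Ring R] {x y : R} {a : ℕ} (hx : x ∈ Ring.jacobson R)
    (hy : y ∈ Ring.jacobson R ^ a) : y * x ∈ Ring.jacobson R ^ (a + 1) := by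
  rw [Submodule.pow_succ]; exact Ideal.mul_mem_mul hy hx

theorem sandwich_mem_radFil_left {d p : ℕ} {x : Module.End Λ (∀ i, Δ i)}
    (hx : x ∈ Ring.jacobson (Module.End Λ (∀ i, Δ i))) {z : YExt Δ d} (hz : z ∈ radFil k Δ d p) :
    YExt.sandwich k x 1 z ∈ radFil k Δ d (p + 1) := by
  suffices h : radFil k Δ d p ≤ (radFil k Δ d (p + 1)).comap (YExt.sandwich k x 1) from h hz
  refine radFil_le fun a b hab g hg f hf y => ?_
  rw [Submodule.mem_comap, YExt.sandwich_sandwich, mul_one]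
  exact sandwich_mem_radFil (a := a + 1) (by omega) (mul_mem_jacobson_pow hx hg) hf y

theorem sandwich_mem_radFil_right {d p : ℕ} {x : Module.End Λ (∀ i, Δ i)}
    (hx : x ∈ Ring.jacobson (Module.End Λ (∀ i, Δ i))) {z : YExt Δ d} (hz : z ∈ radFil k Δ d p) :
    YExt.sandwich k 1 x z ∈ radFil k Δ d (p + 1) := by
  suffices h : radFil k Δ d p ≤ (radFil k Δ d (p + 1)).comap (YExt.sandwich k 1 x) from h hz
  refine radFil_le fun a b hab g hg f hf y => ?_
  rw [Submodule.mem_comap, YExt.sandwich_sandwich, one_mul]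
  exact sandwich_mem_radFil (b := b + 1) (by omega) hg (mul_mem_jacobson_pow' hx hf) y

/-- In `g z f` of order at least `2 * N`, one of `g` and `f` lies in the `N`-th power of the radical. -/
theorem radFil_eq_bot {N : ℕ} (hN : Ring.jacobson (Module.End Λ (∀ i, Δ i)) ^ N = 0) (d : ℕ) :
    radFil k Δ d (2 * N) = ⊥ := by
  refine le_bot_iff.1 (radFil_le fun a b hab g hg f hf y => ?_)
  rw [Submodule.mem_bot]
  have h0 : ∀ {a : ℕ} {g : Module.End Λ (∀ i, Δ i)}, N ≤ a →
      g ∈ Ring.jacobson (Module.End Λ (∀ i, Δ i)) ^ a → g = 0 := fun ha hg => by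
    have h1 := Ideal.pow_le_pow_right ha hg
    rw [hN] at h1; exact h1
  rcases le_total N a with ha | ha
  · rw [h0 ha hg, YExt.sandwich_zero_left]
  · rw [h0 (by omega) hf, YExt.sandwich_zero_right]

end RadicalFiltration

section WeightFiltration
variable {k Λ P : Type u} [Field k] [IsAlgClosed k] [Ring Λ] [Algebra k Λ] [Module.Finite k Λ]
  [DecidableEq P] [Fintype P] [Preorder P] {H : HomologicalSystem Λ P}

variable (P) in
/-- The height difference from `i` to `j`, normalized to be non-negative. -/
noncomputable def heightDiff (i j : P) : ℕ := height j + Fintype.card P - height i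

variable (k H) in
/-- The weight filtration of `Extᵈ(Δ, Δ)`: an element of `Extᵈ(Δ_i, Δ_j)` of order `p` with respect
to the radical filtration has weight `p + N h`, where `h` is the height difference from `i` to
`j`. -/
noncomputable def weightFil (N d q : ℕ) : Submodule k (YExt H.Δ d) :=
  ⨅ i : P, ⨅ j : P, (radFil k H.Δ d (q - N * heightDiff P i j)).comap (cut k (YExt H.Δ d) i j)

variable {N d q : ℕ}

theorem mem_weightFil {z : YExt H.Δ d} : z ∈ weightFil k H N d q ↔
    ∀ i j, cut k (YExt H.Δ d) i j z ∈ radFil k H.Δ d (q - N * heightDiff P i j) := by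
  simp only [weightFil, Submodule.mem_iInf, Submodule.mem_comap]

theorem weightFil_zero : weightFil k H N d 0 = ⊤ := by
  refine eq_top_iff.2 fun z _ => mem_weightFil.2 fun i j => ?_
  rw [Nat.zero_sub]; exact mem_radFil_zero _

theorem weightFil_succ_le : weightFil k H N d (q + 1) ≤ weightFil k H N d q := fun _ hz =>
  mem_weightFil.2 fun i j => radFil_antitone (by omega) (mem_weightFil.1 hz i j)

theorem heightDiff_le (i j : P) : heightDiff P i j ≤ 2 * Fintype.card P := by
  have := height_lt_card j
  rw [heightDiff]; omega

theorem weightFil_eq_bot (hN : radFil k H.Δ d N = ⊥) :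
    weightFil k H N d (N * (2 * Fintype.card P + 1)) = ⊥ := by
  refine (Submodule.eq_bot_iff _).2 fun z hz => ?_
  rw [← sum_cut (k := k) (P := P) z]
  refine Finset.sum_eq_zero fun i _ => Finset.sum_eq_zero fun j _ => ?_
  have h1 := Nat.mul_le_mul_left N (heightDiff_le i j)
  have h2 := radFil_antitone (p := N) (by rw [mul_add, mul_one]; omega) (mem_weightFil.1 hz i j)
  rwa [hN, Submodule.mem_bot] at h2

theorem smul_mem_weightFil (s : P → k) {z : YExt H.Δ d} (hz : z ∈ weightFil k H N d q) :
    s • z ∈ weightFil k H N d q := mem_weightFil.2 fun i j => by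
  rw [cut_smul]; exact Submodule.smul_mem _ _ (mem_weightFil.1 hz i j)

theorem op_smul_mem_weightFil (s : P → k) {z : YExt H.Δ d} (hz : z ∈ weightFil k H N d q) :
    op s • z ∈ weightFil k H N d q := mem_weightFil.2 fun i j => by
  rw [cut_op_smul]; exact Submodule.smul_mem _ _ (mem_weightFil.1 hz i j)

variable (m : StrictAInfinity k H.Δ)

/-- A non-vanishing value on `l, z, t` has a target, whose height exceeds the height of the target of `z`
by at least the number of solid letters of `l`. -/
theorem StrictAInfinity.exists_tgt_of_bw_ne_zero (l : List (Arrow k H)) (t : List (YAlg H.Δ)) (j : P)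
    (z : YAlg H.Δ) (hz : eS k j • z = z) (h : m.bw (elts l ++ z :: t) ≠ 0) :
    ∃ j' : P, eS k j' • m.bw (elts l ++ z :: t) = m.bw (elts l ++ z :: t) ∧
      height j + solidCount l ≤ height j' := by
  rcases l with _ | ⟨x, l⟩
  · exact ⟨j, m.eS_smul_bw_cons z t j hz, by rw [solidCount_nil, add_zero]⟩
  · refine ⟨x.tgt, m.eS_smul_bw_cons _ _ _ x.eS_smul_elt, ?_⟩
    have hc := m.isChain_of_bw_ne_zero [] (z :: t) (x :: l) (by simpa using h)
    have hh := height_getLast_add_le x l hc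
    have hj : ((x :: l).getLast (by simp)).src = j := by
      by_contra hne
      refine h ?_
      have hl : x :: l = (x :: l).dropLast ++ [(x :: l).getLast (by simp)] :=
        (List.dropLast_append_getLast _).symm
      rw [hl]
      have := m.bw_eq_zero_of_ne (elts (x :: l).dropLast) t hne
        ((x :: l).getLast (by simp)).op_eS_smul_elt hz
      simpa [elts] using this
    rwa [hj] at hh

/-- A non-vanishing value on `t, z, l` has a source, whose height lies below the height of the source of
`z` by at least the number of solid letters of `l`. -/
theorem StrictAInfinity.exists_src_of_bw_ne_zero (t : List (YAlg H.Δ)) (l : List (Arrow k H)) (i : P)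
    (z : YAlg H.Δ) (hz : op (eS k i) • z = z) (h : m.bw (t ++ z :: elts l) ≠ 0) :
    ∃ i' : P, op (eS k i') • m.bw (t ++ z :: elts l) = m.bw (t ++ z :: elts l) ∧
      height i' + solidCount l ≤ height i := by
  rcases l with _ | ⟨y, l⟩
  · exact ⟨i, m.op_eS_smul_bw_concat z t i hz, by rw [solidCount_nil, add_zero]⟩
  · have hi : i = y.tgt := by
      by_contra hne
      exact h (m.bw_eq_zero_of_ne t (elts l) hne hz y.eS_smul_elt)
    have hc := m.isChain_of_bw_ne_zero (t ++ [z]) [] (y :: l) (by simpa using h)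
    have hh := height_getLast_add_le y l hc
    refine ⟨((y :: l).getLast (by simp)).src, ?_, hi ▸ hh⟩
    have hl : y :: l = (y :: l).dropLast ++ [(y :: l).getLast (by simp)] :=
      (List.dropLast_append_getLast _).symm
    have e : t ++ z :: elts (y :: l) = (t ++ z :: elts (y :: l).dropLast) ++
        [arrowElt k H ((y :: l).getLast (by simp))] := by
      conv_lhs => rw [hl]
      simp [elts]
    rw [e]
    exact m.op_eS_smul_bw_concat _ _ _ ((y :: l).getLast (by simp)).op_eS_smul_elt

theorem cut_eq_zero_of_eS_smul {U : Type u} [AddCommGroup U] [Module k U]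
    [Module (P → k) U] [Module (P → k)ᵐᵒᵖ U] [SMulCommClass (P → k) (P → k)ᵐᵒᵖ U]
    [IsScalarTower k (P → k) U] [IsScalarTower k (P → k)ᵐᵒᵖ U] {i j i' j' : P} {w : U}
    (hj : eS k j' • w = w) (hi : op (eS k i') • w = w) (h : ¬ (i = i' ∧ j = j')) :
    cut k U i j w = 0 := by
  have e : w = cut k U i' j' w := by
    change w = eS k j' • (op (eS k i') • w)
    rw [hi, hj]
  rw [e, cut_cut, if_neg h]

/-- The bar operations with one argument `z` and at least one further argument, all further
arguments being arrows, and with exactly one dashed arrow among them, increase the weight of `z`: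
a solid arrow increases the height difference, and the product with an element of `J` increases the
order with respect to the radical filtration. -/
theorem StrictAInfinity.bw_mid_mem_weightFil (hN : ∀ d, radFil k H.Δ d N = ⊥)
    (l₁ l₂ : List (Arrow k H)) (hl : 1 ≤ l₁.length + l₂.length) {z : YExt H.Δ d}
    (hz : z ∈ weightFil k H N d q) :
    m.bw (elts l₁ ++ homog z :: elts l₂) d ∈ weightFil k H N d (q + 1) := by
  by_cases hd : dashCount l₁ + dashCount l₂ = 1
  swap
  · have h0 := m.bw_mid_apply l₁ l₂ ⟨d, z⟩ d (by change _ ≠ d + 1; omega)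
    rw [HomEl.val] at h0
    rw [h0]; exact zero_mem _
  have hsplit : m.bw (elts l₁ ++ homog z :: elts l₂) d = ∑ i : P, ∑ j : P,
      m.bw (elts l₁ ++ homog (cut k (YExt H.Δ d) i j z) :: elts l₂) d := by
    have h1 := congrArg (degComp k d ∘ₗ m.bwMid (elts l₁) (elts l₂) ∘ₗ
      DirectSum.lof k ℕ (YExt H.Δ) d) (sum_cut (k := k) (P := P) z)
    simp only [map_sum] at h1
    exact h1.symm
  rw [hsplit]
  refine sum_mem fun i _ => sum_mem fun j _ => mem_weightFil.2 fun i₁ j₁ => ?_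
  have hy := mem_weightFil.1 hz i j
  have hyj : eS k j • cut k (YExt H.Δ d) i j z = cut k (YExt H.Δ d) i j z := eS_smul_cut i j z
  have hyi : op (eS k i) • cut k (YExt H.Δ d) i j z = cut k (YExt H.Δ d) i j z := by
    rw [op_smul_cut]; simp
  generalize cut k (YExt H.Δ d) i j z = y at hy hyj hyi
  by_cases hw : m.bw (elts l₁ ++ homog y :: elts l₂) = 0
  · rw [hw, DirectSum.zero_apply, map_zero]; exact zero_mem _
  have hy0 : y ≠ 0 := by
    rintro rfl
    refine hw ?_
    have h0 : (homog (0 : YExt H.Δ d) : YAlg H.Δ) = 0 := map_zero _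
    rw [h0, ← bwMid_apply, map_zero]
  -- The component is non-zero, so its order is less than `N`; hence a rise of the height difference
  -- by one outweighs the order.
  have hqN : q - N * heightDiff P i j < N := by
    by_contra hge
    have := radFil_antitone (not_lt.1 hge) hy
    rw [hN] at this
    exact hy0 this
  obtain ⟨j', hj', hhj⟩ := m.exists_tgt_of_bw_ne_zero l₁ (elts l₂) j (homog y)
    ((smul_homog_S _ _).trans (congrArg homog hyj)) hw
  obtain ⟨i', hi', hhi⟩ := m.exists_src_of_bw_ne_zero (elts l₁) l₂ i (homog y)
    ((op_smul_homog _ _).trans (congrArg homog hyi)) hw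
  have hj'' := congrArg (degComp k d) hj'
  have hi'' := congrArg (degComp k d) hi'
  rw [degComp_smul] at hj''
  rw [degComp_op_smul] at hi''
  by_cases hij : i₁ = i' ∧ j₁ = j'
  swap
  · rw [cut_eq_zero_of_eS_smul (w := m.bw (elts l₁ ++ homog y :: elts l₂) d) hj'' hi'' hij]
    exact zero_mem _
  obtain ⟨rfl, rfl⟩ := hij
  have hcut : cut k (YExt H.Δ d) i₁ j₁ (m.bw (elts l₁ ++ homog y :: elts l₂) d) =
      m.bw (elts l₁ ++ homog y :: elts l₂) d := by
    change eS k j₁ • (op (eS k i₁) • degComp k d (m.bw (elts l₁ ++ homog y :: elts l₂))) = _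
    rw [hi'', hj'']; rfl
  rw [hcut]
  have hlt := height_lt_card i
  have hlt1 := height_lt_card i₁
  have hdiff : heightDiff P i j + (solidCount l₁ + solidCount l₂) ≤ heightDiff P i₁ j₁ := by
    rw [heightDiff, heightDiff]; omega
  have h1 := solidCount_add_dashCount l₁
  have h2 := solidCount_add_dashCount l₂
  by_cases hs : solidCount l₁ + solidCount l₂ = 0
  swap
  · have h3 : N * (heightDiff P i j + 1) ≤ N * heightDiff P i₁ j₁ :=
      Nat.mul_le_mul_left N (by omega)
    rw [mul_add, mul_one] at h3
    have h4 : q + 1 - N * heightDiff P i₁ j₁ = 0 := by omega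
    rw [h4]
    exact mem_radFil_zero _
  have h3 : N * heightDiff P i j ≤ N * heightDiff P i₁ j₁ := Nat.mul_le_mul_left N (by omega)
  refine radFil_antitone (q := q - N * heightDiff P i j + 1) (by omega) ?_
  obtain ⟨h5, h6⟩ | ⟨h5, h6⟩ : (l₁.length = 1 ∧ l₂.length = 0) ∨ (l₁.length = 0 ∧ l₂.length = 1) := by
    omega
  · obtain ⟨x, rfl⟩ := List.length_eq_one_iff.1 h5
    obtain rfl := List.eq_nil_of_length_eq_zero h6
    rcases x with a | a
    · simp [Arrow.deg] at hd
    · have h7 := m.b_two (Arrow.hom (.inr a)) ⟨d, y⟩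
      rw [Arrow.val_hom] at h7
      change m.bw [arrowElt k H (.inr a), homog y] = _ • homog (a.elt.1.mul y) at h7
      rw [homog_mul_left (k := k)] at h7
      change m.bw [arrowElt k H (.inr a), homog y] d ∈ _
      rw [h7, DirectSum.smul_apply, homog_apply_self]
      exact Submodule.smul_mem _ _ (sandwich_mem_radFil_left a.elt.2 hy)
  · obtain ⟨x, rfl⟩ := List.length_eq_one_iff.1 h6
    obtain rfl := List.eq_nil_of_length_eq_zero h5
    rcases x with a | a
    · simp [Arrow.deg] at hd
    · have h7 := m.b_two ⟨d, y⟩ (Arrow.hom (.inr a))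
      rw [Arrow.val_hom] at h7
      change m.bw [homog y, arrowElt k H (.inr a)] = _ • homog (y.mul a.elt.1) at h7
      rw [homog_mul_right (k := k)] at h7
      change m.bw [homog y, arrowElt k H (.inr a)] d ∈ _
      rw [h7, DirectSum.smul_apply, homog_apply_self]
      exact Submodule.smul_mem _ _ (sandwich_mem_radFil_right a.elt.2 hy)

end WeightFiltration

/-! ### Annihilators and change of letters -/

section Annihilator
variable {k P : Type u} [Field k] [DecidableEq P] [Fintype P] {U : Type u} [AddCommGroup U]
  [Module k U] [Module (P → k) U] [Module (P → k)ᵐᵒᵖ U] [SMulCommClass (P → k) (P → k)ᵐᵒᵖ U]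
  [IsScalarTower k (P → k) U] [IsScalarTower k (P → k)ᵐᵒᵖ U]

/-- The elements of `D̂(U)` that vanish on the subspace `Q`, when regarded as functionals. -/
noncomputable def HatDual.ann (Q : Submodule k U) : Submodule k (HatDual (P → k) U) :=
  Q.dualAnnihilator.comap (HatDual.functional (k := k) (P := P) (U := U)).toLinearMap

theorem HatDual.mem_ann {Q : Submodule k U} {φ : HatDual (P → k) U} :
    φ ∈ HatDual.ann Q ↔ ∀ u ∈ Q, HatDual.functional φ u = 0 :=
  Submodule.mem_dualAnnihilator _

theorem HatDual.ann_top : HatDual.ann (P := P) (⊤ : Submodule k U) = ⊥ := by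
  refine (Submodule.eq_bot_iff _).2 fun φ hφ => ?_
  apply HatDual.functional.injective
  rw [map_zero]
  exact LinearMap.ext fun u => HatDual.mem_ann.1 hφ u trivial

theorem HatDual.ann_bot : HatDual.ann (P := P) (⊥ : Submodule k U) = ⊤ := by
  refine eq_top_iff.2 fun φ _ => HatDual.mem_ann.2 ?_
  rintro u hu
  rw [(Submodule.mem_bot k).1 hu, map_zero]

theorem HatDual.ann_antitone {Q Q' : Submodule k U} (h : Q ≤ Q') :
    HatDual.ann (P := P) Q' ≤ HatDual.ann Q := fun _ hφ =>
  HatDual.mem_ann.2 fun u hu => HatDual.mem_ann.1 hφ u (h hu)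

theorem HatDual.smul_mem_ann {Q : Submodule k U} (s : P → k) (hQ : ∀ u ∈ Q, s • u ∈ Q)
    {φ : HatDual (P → k) U} (hφ : φ ∈ HatDual.ann Q) : s • φ ∈ HatDual.ann Q :=
  HatDual.mem_ann.2 fun u hu => by
    rw [HatDual.functional_smul]; exact HatDual.mem_ann.1 hφ _ (hQ u hu)

theorem HatDual.op_smul_mem_ann {Q : Submodule k U} (s : P → k) (hQ : ∀ u ∈ Q, op s • u ∈ Q)
    {φ : HatDual (P → k) U} (hφ : φ ∈ HatDual.ann Q) : op s • φ ∈ HatDual.ann Q :=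
  HatDual.mem_ann.2 fun u hu => by
    rw [HatDual.functional_op_smul]; exact HatDual.mem_ann.1 hφ _ (hQ u hu)

/-- For a functional that vanishes on a subspace `Q`, the dual basis may be replaced in the expansion
of the functional by elements of the annihilator of `Q`. -/
theorem HatDual.exists_ann_letters [Fintype (DirIdx k (P := P) U)] (Q : Submodule k U) :
    ∃ γ : DirIdx k (P := P) U → HatDual (P → k) U, (∀ a, γ a ∈ HatDual.ann Q) ∧
      ∀ μ : U →ₗ[k] k, (∀ u ∈ Q, μ u = 0) →
        ∑ a : DirIdx k (P := P) U, μ a.elt • γ a = ∑ a : DirIdx k (P := P) U, μ a.elt • a.dual := by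
  obtain ⟨s, hs⟩ := LinearMap.exists_rightInverse_of_surjective Q.mkQ Q.range_mkQ
  refine ⟨fun a => HatDual.functional.symm (a.coef ∘ₗ s ∘ₗ Q.mkQ), fun a => ?_, fun μ hμ => ?_⟩
  · refine HatDual.mem_ann.2 fun u hu => ?_
    rw [LinearEquiv.apply_symm_apply, LinearMap.comp_apply, LinearMap.comp_apply,
      Submodule.mkQ_apply, (Submodule.Quotient.mk_eq_zero Q).2 hu, map_zero, map_zero]
  · apply HatDual.functional.injective
    refine LinearMap.ext fun u => ?_
    have e : ∀ v : U, μ v = ∑ a : DirIdx k (P := P) U, μ a.elt * a.coef v := fun v => by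
      conv_lhs => rw [← DirIdx.sum_coef (k := k) (P := P) v]
      simp only [map_sum, map_smul, smul_eq_mul, mul_comm]
    simp only [map_sum, map_smul, LinearEquiv.apply_symm_apply, HatDual.functional_dual,
      LinearMap.sum_apply, LinearMap.smul_apply, LinearMap.comp_apply, smul_eq_mul]
    rw [← e, ← e, ← sub_eq_zero, ← map_sub]
    refine hμ _ ((Submodule.Quotient.mk_eq_zero Q).1 ?_)
    have h1 := LinearMap.congr_fun hs (Q.mkQ u)
    rw [← Submodule.mkQ_apply, map_sub, sub_eq_zero]
    exact h1

end Annihilator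

section Letters
open BimodTensorAlgebra
variable {k Λ P : Type u} [Field k] [IsAlgClosed k] [Ring Λ] [Algebra k Λ] [Module.Finite k Λ]
  [DecidableEq P] [Fintype P] [Preorder P] {H : HomologicalSystem Λ P}
  (m : StrictAInfinity k H.Δ)

/-- In a sum over words, the letters may be exchanged one position at a time, if each exchange leaves the
linear combination with the other letters fixed unchanged. -/
theorem wsum_smul_prod (g : Arrow k H → TDelta k H) (n : ℕ) (c : List (Arrow k H) → k)
    (h : ∀ l₁ l₂ : List (Arrow k H), l₁.length + l₂.length + 1 = n →
      ∑ x, c (l₁ ++ x :: l₂) • g x = ∑ x, c (l₁ ++ x :: l₂) • arrowDual k H x) :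
    wsum n (fun l => c l • (l.map g).prod) = wsum n fun l => c l • word l := by
  induction n generalizing c with
  | zero => rfl
  | succ n ih =>
    rw [wsum_succ, wsum_succ]
    have h1 (x : Arrow k H) : wsum n (fun l => c (x :: l) • ((x :: l).map g).prod) =
        wsum n fun l => (c (x :: l) • g x) * word l := by
      have h2 := congrArg (LinearMap.mulLeft k (g x)) (ih (fun l => c (x :: l)) fun l₁ l₂ hl =>
        h (x :: l₁) l₂ (by rw [List.length_cons]; omega))
      rw [map_wsum, map_wsum] at h2
      refine Eq.trans (wsum_congr fun l _ => ?_) (h2.trans (wsum_congr fun l _ => ?_))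
      · rw [List.map_cons, List.prod_cons, LinearMap.mulLeft_apply, mul_smul_comm]
      · rw [LinearMap.mulLeft_apply, mul_smul_comm, smul_mul_assoc]
    simp only [h1]
    rw [← wsum_sum, ← wsum_sum]
    refine wsum_congr fun l hl => ?_
    have h2 := h [] l (by rw [List.length_nil]; omega)
    simp only [List.nil_append] at h2
    rw [← Finset.sum_mul, h2, Finset.sum_mul]
    refine Finset.sum_congr rfl fun x _ => ?_
    rw [word_cons, smul_mul_assoc]

/-- A criterion for a cobar element to lie in a subspace, which allows for a change of the letters
of the words that is not seen by the functionals obtained by fixing all letters but one. -/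
theorem StrictAInfinity.cobar_mem_of_letters {f : YAlg H.Δ →ₗ[k] k} {p : Submodule k (TDelta k H)}
    (g : Arrow k H → TDelta k H)
    (hg : ∀ l₁ l₂ : List (Arrow k H), 1 ≤ l₁.length + l₂.length →
      ∑ x, (f ∘ₗ m.bwMid (elts l₁) (elts l₂)) (arrowElt k H x) • g x =
        ∑ x, (f ∘ₗ m.bwMid (elts l₁) (elts l₂)) (arrowElt k H x) • arrowDual k H x)
    (h : ∀ l : List (Arrow k H), 2 ≤ l.length → f (m.bw (elts l)) ≠ 0 → (l.map g).prod ∈ p) :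
    m.cobar f ∈ p := by
  rw [cobar_apply]
  refine sum_mem fun n hn => ?_
  rw [Finset.mem_Icc] at hn
  rw [← wsum_smul_prod g]
  · refine wsum_mem fun l hl => ?_
    by_cases h0 : f (m.bw (elts l)) = 0
    · rw [h0, zero_smul]; exact zero_mem p
    · exact Submodule.smul_mem _ _ (h l (by omega) h0)
  · intro l₁ l₂ hl
    have : ∀ x : Arrow k H, f (m.bw (elts (l₁ ++ x :: l₂))) =
        (f ∘ₗ m.bwMid (elts l₁) (elts l₂)) (arrowElt k H x) := fun x => by
      simp [elts, bwMid_apply]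
    simp only [this]
    exact hg l₁ l₂ (by omega)

theorem prod_letters_mem (B : Subalgebra k (TDelta k H)) (W : Submodule k (TDelta k H))
    (g : Arrow k H → TDelta k H) (hB : ∀ a, g (.inl a) ∈ B) (hW : ∀ a, g (.inr a) ∈ W)
    (l : List (Arrow k H)) : (l.map g).prod ∈
      Subalgebra.toSubmodule B * (W * Subalgebra.toSubmodule B) ^ dashCount l := by
  induction l with
  | nil =>
    rw [dashCount_nil, pow_zero, mul_one]; exact one_mem B
  | cons x l ih =>
    rw [List.map_cons, List.prod_cons, dashCount_cons]
    rcases x with a | a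
    · rw [show Arrow.deg (Sum.inl a : Arrow k H) = 0 from rfl, zero_add,
        ← B.isIdempotentElem_toSubmodule.eq, mul_assoc, B.isIdempotentElem_toSubmodule.eq]
      exact Submodule.mul_mem_mul (hB a) ih
    · rw [show Arrow.deg (Sum.inr a : Arrow k H) = 1 from rfl, pow_add, pow_one, mul_assoc W,
        ← one_mul (g _ * _)]
      exact Submodule.mul_mem_mul (one_mem B) (Submodule.mul_mem_mul (hW a) ih)

end Letters

/-! ### The triangular layer -/

section Layer
open BimodTensorAlgebra
variable {k Λ P : Type u} [Field k] [IsAlgClosed k] [Ring Λ] [Algebra k Λ] [Module.Finite k Λ]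
  [DecidableEq P] [Fintype P] [Preorder P] {H : HomologicalSystem Λ P}
  (m : StrictAInfinity k H.Δ) {N q : ℕ}

variable (k H) in
/-- The part of `J` of weight at least `q`. -/
noncomputable def weightFilJ (N q : ℕ) : Submodule k (radJ k (Δ := H.Δ)) :=
  (weightFil k H N 0 q).comap (radJ k).subtype

variable (k H) in
/-- The filtration of `D̂(B)₀` by annihilators of the weight filtration. -/
noncomputable def layerFil₀ (N q : ℕ) : Submodule k (TDelta k H) :=
  (HatDual.ann (weightFil k H N 1 q)).map (ofSolid k H)

variable (k H) in
/-- The filtration of `D̂(J)` by annihilators of the weight filtration. -/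
noncomputable def layerFil₁ (N q : ℕ) : Submodule k (TDelta k H) :=
  (HatDual.ann (weightFilJ k H N q)).map (ofDashed k H)

theorem layerFil₀_zero : layerFil₀ k H N 0 = ⊥ := by
  rw [layerFil₀, weightFil_zero, HatDual.ann_top, Submodule.map_bot]

theorem layerFil₁_zero : layerFil₁ k H N 0 = ⊥ := by
  rw [layerFil₁, weightFilJ, weightFil_zero, Submodule.comap_top, HatDual.ann_top,
    Submodule.map_bot]

theorem layerFil₀_last (hN : ∀ d, radFil k H.Δ d N = ⊥) :
    layerFil₀ k H N (N * (2 * Fintype.card P + 1)) = layerW₀ k H := by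
  rw [layerFil₀, weightFil_eq_bot (hN 1), HatDual.ann_bot, Submodule.map_top]; rfl

theorem layerFil₁_last (hN : ∀ d, radFil k H.Δ d N = ⊥) :
    layerFil₁ k H N (N * (2 * Fintype.card P + 1)) = layerW₁ k H := by
  rw [layerFil₁, weightFilJ, weightFil_eq_bot (hN 0), Submodule.comap_bot,
    Submodule.ker_subtype, HatDual.ann_bot, Submodule.map_top]; rfl

theorem layerFil₀_le_succ : layerFil₀ k H N q ≤ layerFil₀ k H N (q + 1) :=
  Submodule.map_mono (HatDual.ann_antitone weightFil_succ_le)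

theorem layerFil₁_le_succ : layerFil₁ k H N q ≤ layerFil₁ k H N (q + 1) :=
  Submodule.map_mono (HatDual.ann_antitone (Submodule.comap_mono weightFil_succ_le))

theorem layerFil₀_stable {r w : TDelta k H} (hr : r ∈ layerS k H) (hw : w ∈ layerFil₀ k H N q) :
    r * w ∈ layerFil₀ k H N q ∧ w * r ∈ layerFil₀ k H N q := by
  obtain ⟨s, rfl⟩ := hr
  obtain ⟨φ, hφ, rfl⟩ := hw
  exact ⟨⟨s • φ, HatDual.smul_mem_ann s (fun _ hu => smul_mem_weightFil s hu) hφ,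
      ofSolid_smul k H s φ⟩,
    ⟨op s • φ, HatDual.op_smul_mem_ann s (fun _ hu => op_smul_mem_weightFil s hu) hφ,
      ofSolid_op_smul k H s φ⟩⟩

theorem layerFil₁_stable {r w : TDelta k H} (hr : r ∈ layerS k H) (hw : w ∈ layerFil₁ k H N q) :
    r * w ∈ layerFil₁ k H N q ∧ w * r ∈ layerFil₁ k H N q := by
  obtain ⟨s, rfl⟩ := hr
  obtain ⟨φ, hφ, rfl⟩ := hw
  exact ⟨⟨s • φ, HatDual.smul_mem_ann s (fun u hu => smul_mem_weightFil (z := u.1) s hu) hφ,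
      ofDashed_smul k H s φ⟩,
    ⟨op s • φ, HatDual.op_smul_mem_ann s (fun u hu => op_smul_mem_weightFil (z := u.1) s hu) hφ,
      ofDashed_op_smul k H s φ⟩⟩

theorem StrictAInfinity.bw_mid_zero_mem_radJ (l₁ l₂ : List (Arrow k H))
    (hl : 1 ≤ l₁.length + l₂.length) (z : radJ k (Δ := H.Δ)) :
    m.bw (elts l₁ ++ homog z.1 :: elts l₂) 0 ∈ radJ k (Δ := H.Δ) := by
  have h1 := congrArg (degComp k 0 ∘ₗ m.bwMid (elts l₁) (elts l₂) ∘ₗ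
    DirectSum.lof k ℕ (YExt H.Δ) 0 ∘ₗ (radJ k).subtype) (DirIdx.sum_coef (k := k) (P := P) z)
  rw [map_sum] at h1
  refine (congrArg (· ∈ radJ k (Δ := H.Δ)) h1).mp (sum_mem fun a _ => ?_)
  rw [map_smul]
  refine Submodule.smul_mem _ _ ?_
  have h2 := m.bw_elts_zero_mem_radJ (l₁ ++ Sum.inr a :: l₂)
    (by rw [List.length_append, List.length_cons]; omega)
  rwa [elts, List.map_append, List.map_cons] at h2

/-- With the solid letters replaced by elements of the annihilator of the `q`-th step, each word of the
cobar element has solid letters in the `q`-th step of the filtration and exactly one dashed letter. -/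
theorem StrictAInfinity.delta_layerFil₀_le (hN : ∀ d, radFil k H.Δ d N = ⊥) :
    (layerFil₀ k H N (q + 1)).map m.delta ≤
      Subalgebra.toSubmodule (Algebra.adjoin k
        ((layerS k H : Set (TDelta k H)) ∪ (layerFil₀ k H N q : Set (TDelta k H)))) *
      layerW₁ k H * Subalgebra.toSubmodule (Algebra.adjoin k
        ((layerS k H : Set (TDelta k H)) ∪ (layerFil₀ k H N q : Set (TDelta k H)))) := by
  rintro _ ⟨_, ⟨φ, hφ, rfl⟩, rfl⟩
  rw [delta_ofSolid]
  obtain ⟨γ, hγ, hsum⟩ := HatDual.exists_ann_letters (P := P) (weightFil k H N 1 q)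
  let g : Arrow k H → TDelta k H := fun x =>
    x.elim (fun a => ofSolid k H (γ a)) fun a => ofDashed k H a.dual
  refine m.cobar_mem_of_letters g (fun l₁ l₂ hl => ?_) fun l hl h0 => ?_
  · rw [Fintype.sum_sum_type, Fintype.sum_sum_type]
    congr 1
    have h1 := congrArg (ofSolid k H) (hsum
      (genFunctional H (LinearMap.inl k _ _ φ) ∘ₗ m.bwMid (elts l₁) (elts l₂) ∘ₗ
        DirectSum.lof k ℕ (YExt H.Δ) 1) fun z hz => ?_)
    · rw [map_sum, map_sum] at h1
      simp only [map_smul] at h1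
      exact h1
    · refine (genFunctional_inl_apply _ _).trans ?_
      exact HatDual.mem_ann.1 hφ _ (m.bw_mid_mem_weightFil hN l₁ l₂ hl hz)
  · have hd : dashCount l = 1 := by
      have := m.dashCount_eq_of_apply_ne_zero hl (e := 1) fun h1 => h0 (by
        rw [genFunctional_inl_apply, h1, map_zero])
      omega
    have h1 := prod_letters_mem (Algebra.adjoin k
        ((layerS k H : Set (TDelta k H)) ∪ (layerFil₀ k H N q : Set (TDelta k H))))
      (layerW₁ k H) g (fun a => Algebra.subset_adjoin (Or.inr ⟨γ a, hγ a, rfl⟩))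
      (fun a => ⟨_, rfl⟩) l
    rwa [hd, pow_one, ← mul_assoc] at h1

/-- With the dashed letters replaced by elements of the annihilator of the `q`-th step, each word of the
cobar element has exactly two dashed letters, both in the `q`-th step of the filtration. -/
theorem StrictAInfinity.delta_layerFil₁_le (hN : ∀ d, radFil k H.Δ d N = ⊥) :
    (layerFil₁ k H N (q + 1)).map m.delta ≤
      gradeT k H 0 * layerFil₁ k H N q * gradeT k H 0 * layerFil₁ k H N q * gradeT k H 0 := by
  rintro _ ⟨_, ⟨ψ, hψ, rfl⟩, rfl⟩
  rw [delta_ofDashed]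
  obtain ⟨γ, hγ, hsum⟩ := HatDual.exists_ann_letters (P := P) (weightFilJ k H N q)
  let g : Arrow k H → TDelta k H := fun x =>
    x.elim (fun a => ofSolid k H a.dual) fun a => ofDashed k H (γ a)
  refine m.cobar_mem_of_letters g (fun l₁ l₂ hl => ?_) fun l hl h0 => ?_
  · rw [Fintype.sum_sum_type, Fintype.sum_sum_type]
    congr 1
    have h1 := congrArg (ofDashed k H) (hsum
      (genFunctional H (LinearMap.inr k _ _ ψ) ∘ₗ m.bwMid (elts l₁) (elts l₂) ∘ₗ
        DirectSum.lof k ℕ (YExt H.Δ) 0 ∘ₗ (radJ k).subtype) fun z hz => ?_)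
    · rw [map_sum, map_sum] at h1
      simp only [map_smul] at h1
      exact h1
    · refine (genFunctional_inr_apply _ _).trans (HatDual.mem_ann.1 hψ _ ?_)
      change ((H.projJ (k := k) _ : radJ k (Δ := H.Δ)) : YExt H.Δ 0) ∈ weightFil k H N 0 (q + 1)
      have h2 : H.projJ (k := k) (m.bw (elts l₁ ++ homog z.1 :: elts l₂) 0) =
          ⟨_, m.bw_mid_zero_mem_radJ l₁ l₂ hl z⟩ := projJ_coe H ⟨_, _⟩
      exact (congrArg (fun w : radJ k (Δ := H.Δ) => w.1 ∈ weightFil k H N 0 (q + 1)) h2).mpr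
        (m.bw_mid_mem_weightFil hN l₁ l₂ hl hz)
  · have hd : dashCount l = 2 := by
      have := m.dashCount_eq_of_apply_ne_zero hl (e := 0) fun h1 => h0 (by
        rw [genFunctional_inr_apply, h1, map_zero, map_zero])
      omega
    have h1 := prod_letters_mem (algebraA k H) (layerFil₁ k H N q) g
      (fun a => ofSolid_mem_algebraA k H _) (fun a => ⟨γ a, hγ a, rfl⟩) l
    rw [hd, pow_two, ← gradeT_zero] at h1
    simpa only [mul_assoc] using h1

theorem StrictAInfinity.isLayer :
    IsLayer (gradeT k H) m.delta (layerS k H) (layerW₀ k H) (layerW₁ k H) where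
  scalars_le := by rintro _ ⟨s, rfl⟩; exact ofScalar_mem_gradeT k H s
  zero_le := by rintro _ ⟨a, rfl⟩; exact ofSolid_mem_gradeT k H a
  one_le := by rintro _ ⟨a, rfl⟩; exact ofDashed_mem_gradeT k H a
  zero_stable := by
    rintro _ ⟨s, rfl⟩ _ ⟨φ, rfl⟩
    exact ⟨⟨s • φ, ofSolid_smul k H s φ⟩, ⟨op s • φ, ofSolid_op_smul k H s φ⟩⟩
  one_stable := by
    rintro _ ⟨s, rfl⟩ _ ⟨φ, rfl⟩
    exact ⟨⟨s • φ, ofDashed_smul k H s φ⟩, ⟨op s • φ, ofDashed_op_smul k H s φ⟩⟩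
  disjoint := disjoint_layerW k H
  free := freelyGenerated_layer k H
  delta_scalars := by rintro _ ⟨s, rfl⟩; exact m.delta_ofScalar s

variable (k H) in
theorem exists_radFil_eq_bot : ∃ N, ∀ d, radFil k H.Δ d N = ⊥ := by
  obtain ⟨N, hN⟩ := isNilpotent_jacobson_end k H.Δ H.finite
  exact ⟨2 * N, fun d => radFil_eq_bot hN d⟩

theorem StrictAInfinity.isTriangularLayer :
    IsTriangularLayer (gradeT k H) m.delta (layerS k H) (layerW₀ k H) (layerW₁ k H) := by
  obtain ⟨N, hN⟩ := exists_radFil_eq_bot k H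
  exact
    { m.isLayer with
      filtration_zero := ⟨_, layerFil₀ k H N, layerFil₀_zero, layerFil₀_last hN,
        fun _ _ => layerFil₀_le_succ, fun _ _ _ hs _ hw => layerFil₀_stable hs hw,
        fun _ _ => m.delta_layerFil₀_le hN⟩
      filtration_one := ⟨_, layerFil₁ k H N, layerFil₁_zero, layerFil₁_last hN,
        fun _ _ => layerFil₁_le_succ, fun _ _ _ hs _ hw => layerFil₁_stable hs hw,
        fun _ _ => m.delta_layerFil₁_le hN⟩ }

end Layer

/-! ### The triangular ideal -/

section TriangularIdeal
open BimodTensorAlgebra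
variable {k Λ P : Type u} [Field k] [IsAlgClosed k] [Ring Λ] [Algebra k Λ] [Module.Finite k Λ]
  [DecidableEq P] [Fintype P] [Preorder P] {H : HomologicalSystem Λ P}
  (m : StrictAInfinity k H.Δ) {N q : ℕ}

/-- The filtration of the image of `β` given by the annihilators of the weight filtration. -/
noncomputable def StrictAInfinity.betaFil (N q : ℕ) : Submodule k (TDelta k H) :=
  (HatDual.ann (weightFil k H N 2 q)).map m.beta

theorem StrictAInfinity.betaFil_last (hN : ∀ d, radFil k H.Δ d N = ⊥) :
    m.betaFil N (N * (2 * Fintype.card P + 1)) = LinearMap.range m.beta := by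
  rw [betaFil, weightFil_eq_bot (hN 2), HatDual.ann_bot, Submodule.map_top]

/-- By degrees, exactly one dashed letter surrounds the inner value of `β` in `δ (β ζ)`. -/
theorem StrictAInfinity.delta_beta_mem_of (ζ : HatDual (P → k) (YExt H.Δ 2))
    (R : Submodule k (TDelta k H))
    (h : ∀ l₁ l₂ : List (Arrow k H), 1 ≤ l₁.length + l₂.length →
      m.beta (extTwoDual (extTwoFunctional H ζ ∘ₗ m.bwMid (elts l₁) (elts l₂))) ∈ R) :
    m.delta (m.beta ζ) ∈ gradeT k H 0 * R * gradeT k H 1 ⊔ gradeT k H 1 * R * gradeT k H 0 := by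
  rw [beta_eq]
  refine m.delta_cobar_mem _ _ fun l₁ l₂ hl ⟨z, hz⟩ => ?_
  have hmem := Submodule.mul_mem_mul (Submodule.mul_mem_mul (word_mem_gradeT l₁) (h l₁ l₂ hl))
    (word_mem_gradeT l₂)
  have hd : dashCount l₁ + dashCount l₂ = 1 := by
    by_contra hd
    refine hz ?_
    have h1 := m.bw_mid_apply l₁ l₂ ⟨2, z⟩ 2 (by change _ ≠ 2 + 1; omega)
    rw [HomEl.val] at h1
    rw [extTwoFunctional_apply, h1, map_zero]
  obtain ⟨h1, h2⟩ | ⟨h1, h2⟩ : (dashCount l₁ = 0 ∧ dashCount l₂ = 1) ∨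
      (dashCount l₁ = 1 ∧ dashCount l₂ = 0) := by omega
  · rw [h1, h2] at hmem
    exact Submodule.mem_sup_left hmem
  · rw [h1, h2] at hmem
    exact Submodule.mem_sup_right hmem

theorem StrictAInfinity.delta_betaFil_le (hN : ∀ d, radFil k H.Δ d N = ⊥) :
    (m.betaFil N (q + 1)).map m.delta ≤ gradeT k H 0 * m.betaFil N q * gradeT k H 1 ⊔
      gradeT k H 1 * m.betaFil N q * gradeT k H 0 := by
  rintro _ ⟨_, ⟨ζ, hζ, rfl⟩, rfl⟩
  refine m.delta_beta_mem_of ζ _ fun l₁ l₂ hl => ⟨_, HatDual.mem_ann.2 fun z hz => ?_, rfl⟩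
  rw [functional_extTwoDual]
  exact HatDual.mem_ann.1 hζ _ (m.bw_mid_mem_weightFil hN l₁ l₂ hl hz)

theorem StrictAInfinity.range_beta_le : LinearMap.range m.beta ≤ m.idealI := by
  rintro _ ⟨ζ, rfl⟩
  exact m.beta_mem_idealI ζ

/-- The differential maps the ideal into the span of the products with a value of `β` and without
further factors from the ideal, so that one step is enough above the image of `β`. -/
theorem StrictAInfinity.delta_idealI_le_range : m.idealI.map m.delta ≤
    gradeT k H 0 * LinearMap.range m.beta * gradeT k H 1 ⊔
      gradeT k H 1 * LinearMap.range m.beta * gradeT k H 0 := by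
  rw [Submodule.map_le_iff_le_comap]
  refine idealI_induction m fun a ha ζ b hb => ?_
  have hβ := LinearMap.mem_range_self m.beta ζ
  rw [Submodule.mem_comap, m.delta_mul_mul ha (m.beta_mem ζ)]
  refine add_mem (add_mem ?_ ?_) ?_
  · exact Submodule.mem_sup_right
      (Submodule.mul_mem_mul (Submodule.mul_mem_mul (m.delta_mem ha) hβ) hb)
  · have h1 := Submodule.mul_mem_mul (Submodule.mul_mem_mul ha
      (m.delta_beta_mem_of ζ (LinearMap.range m.beta) fun l₁ l₂ _ => LinearMap.mem_range_self _ _))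
      hb
    rw [Submodule.mul_sup, Submodule.sup_mul, ← mul_assoc, ← mul_assoc, ← mul_assoc,
      ← mul_assoc, gradeT_mul_gradeT, gradeT_mul_gradeT, mul_assoc _ (gradeT k H 1),
      mul_assoc _ (gradeT k H 0) (gradeT k H 0), gradeT_mul_gradeT, gradeT_mul_gradeT] at h1
    exact h1
  · exact Submodule.mem_sup_left
      (Submodule.mul_mem_mul (Submodule.mul_mem_mul ha hβ) (m.delta_mem hb))

theorem StrictAInfinity.isTriangularIdeal : IsTriangularIdeal (gradeT k H) m.delta m.idealI := by
  obtain ⟨N, hN⟩ := exists_radFil_eq_bot k H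
  let M := N * (2 * Fintype.card P + 1)
  -- The filtration of the image of `β` is completed by the ideal that the image generates.
  let F : ℕ → Submodule k (TDelta k H) := fun q => if q ≤ M then m.betaFil N q else m.idealI
  have hle : ∀ {q}, q ≤ M → F q = m.betaFil N q := fun h => if_pos h
  have hlast : F (M + 1) = m.idealI := if_neg (by omega)
  refine ⟨M + 1, F, ?_, hlast, fun q hq => ?_, fun q hq => ?_⟩
  · rw [hle (Nat.zero_le M), betaFil, weightFil_zero, HatDual.ann_top, Submodule.map_bot]
  · rw [hle (by omega)]
    rcases (Nat.lt_succ_iff.1 hq).lt_or_eq with h | rfl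
    · rw [hle (by omega)]
      exact Submodule.map_mono (HatDual.ann_antitone weightFil_succ_le)
    · rw [hlast, m.betaFil_last hN]
      exact m.range_beta_le
  · rw [hle (q := q) (by omega)]
    rcases (Nat.lt_succ_iff.1 hq).lt_or_eq with h | rfl
    · rw [hle (by omega)]
      exact m.delta_betaFil_le hN
    · rw [hlast, m.betaFil_last hN]
      exact m.delta_idealI_le_range

end TriangularIdeal
end Yoneda

theorem mainTheorem6 {k Λ P : Type u} [Field k] [IsAlgClosed k] [Ring Λ] [Algebra k Λ]
    [Module.Finite k Λ] [DecidableEq P] [Fintype P] [Nonempty P] [Preorder P]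
    (H : Yoneda.HomologicalSystem Λ P) (hH : H.IsAdmissible) (m : Yoneda.StrictAInfinity k H.Δ) :
    Yoneda.IsTriangularInterlacedWeakDitalgebra (Yoneda.gradeT k H) m.delta m.idealI ∧
      Yoneda.IsTriangularLayer (Yoneda.gradeT k H) m.delta (Yoneda.layerS k H)
        (Yoneda.layerW₀ k H) (Yoneda.layerW₁ k H) := by
  exact ⟨⟨m.isWeakDitalgebra, m.isInterlaced, ⟨_, _, _, m.isTriangularLayer⟩,
    m.isTriangularIdeal⟩, m.isTriangularLayer⟩
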